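/- Equip the unit sphere $S^5\subset\mathbb C^3$ with the round metric and the contact form $\alpha=\sum_j(x_jdy_j-y_jdx_j)$ (Reeb field $z\mapsto iz$), and let $J$ be the endomorphism of $TS^5$ that projects to $\ker\alpha$ along the Reeb field and then multiplies by $i$. An immersion $F:\Sigma\to S^5$ of a surface is Legendrian if $F^*\alpha=0$. Let $B$ be its second fundamental form in $S^5$, $H=\operatorname{tr}B$, and $\nabla$, $\operatorname{Div}$ the Levi-Civita connection and the divergence of the induced metric. Tangent vectors of $\Sigma$ are identified with their images under $dF$. $F$ is minimal if $H\equiv 0$. A Legendrian immersion is called csL if it is a critical point of the area, and csL Willmore if it is a critical point of the Willmore functional $\int_\Sigma\left(\tfrac14|H|^2+1\right)d\mu$, in both cases among all smooth compactly supported variations through Legendrian immersions. (1) (Mironov's examples.) Let $a,b,c>0$, $u(x)=\tfrac c2\left(a+b+(b-a)\cos 2x\right)$ and $$F(x,y)=\left(\phi(x)e^{iay},\ \psi(x)e^{iby},\ \zeta(x)e^{-icy}\right),\qquad (x,y)\in\mathbb R^2,$$ $$\phi=\sqrt{\tfrac{c}{a+c}}\,\sin x,\qquad \psi=\sqrt{\tfrac{c}{b+c}}\,\cos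 x,\qquad \zeta=\sqrt{\tfrac{a\sin^2x}{a+c}+\tfrac{b\cos^2x}{b+c}} .$$ Then $F$ is a Legendrian immersion in $S^5$ that is $2\pi$-periodic in $x$; it is $T$-periodic in $y$ if and only if $aT,bT,cT\in2\pi\mathbb Z$ (if such a $T>0$ exists, $F$ descends to the torus $\mathbb R/2\pi\mathbb Z\times\mathbb R/T\mathbb Z$). Moreover $u>0$, the induced metric is $\frac{u}{ab+u}dx^2+u\,dy^2$, $$H=\frac{a+b-c}{u(x)}\,i\,\partial_y,\qquad JH=iH,\qquad \operatorname{Div}(iH)=0,$$ $$\nabla_{\partial_x}(JH)=\frac{(a+b-c)u'}{2u^2}\,\partial_y,\qquad \nabla_{\partial_y}(JH)=\frac{(ab+u)(a+b-c)u'}{2u^2}\,\partial_x,$$ and $\sum_{i=1}^2\langle B(e_i,\nabla_{e_i}(JH)),H\rangle=0$ for every orthonormal basis $e_1,e_2$ of a tangent plane. For every discrete subgroup $\Lambda\subset\mathbb R^2$ of periods of $F$ (in particular for the torus above when it exists), the induced immersion $\mathbb R^2/\Lambda\to S^5$ is csL and csL Willmore. It is minimal if and only if $a+b=c$, and $JH$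 is parallel if and only if $a+b=c$ or $a=b$. (2) (Calabi tori.) Let $r_1,r_2,r_3,r_4$ be nonzero reals with $r_1^2+r_2^2=r_3^2+r_4^2=1$, and $$F(t,s)=\left(r_1r_3e^{i\left(\frac{r_2}{r_1}t+\frac{r_4}{r_3}s\right)},\ r_1r_4e^{i\left(\frac{r_2}{r_1}t-\frac{r_3}{r_4}s\right)},\ r_2e^{-i\frac{r_1}{r_2}t}\right),\qquad (t,s)\in\mathbb R^2.$$ Then $F$ is a Legendrian immersion in $S^5$; $(t_0,s_0)$ is a period of $F$ if and only if $\frac{r_2}{r_1}t_0+\frac{r_4}{r_3}s_0$, $\frac{r_2}{r_1}t_0-\frac{r_3}{r_4}s_0$ and $\frac{r_1}{r_2}t_0$ all lie in $2\pi\mathbb Z$. With $E_1=\partial_tF$ and $E_2=\frac1{r_1}\partial_sF$, $$H=\left(\frac{2r_2}{r_1}-\frac{r_1}{r_2}\right)iE_1+\frac1{r_1}\left(\frac{r_4}{r_3}-\frac{r_3}{r_4}\right)iE_2,$$ $JH$ is parallel, and for every discrete subgroup $\Lambda\subset\mathbb R^2$ of periods of $F$ the induced immersion $\mathbb R^2/\Lambda\to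 S^5$ is csL and csL Willmore. -/

import Mathlib

open scoped ContDiff Pointwise

noncomputable section

namespace CsL

/-- The space `ℂ³` that contains the unit sphere `S⁵`. -/
abbrev E : Type := EuclideanSpace ℂ (Fin 3)

/-- The Euclidean inner product of `ℂ³ = ℝ⁶`: the real part of the hermitian product. -/
def rinner (v w : E) : ℝ := (inner ℂ v w).re

/-- The form `∑ (x_j dy_j - y_j dx_j)` at the point `z`, with `z_j = x_j + i y_j`. Restricted to `S⁵`
it is the standard contact form, with Reeb field `z ↦ i z`. -/
def contactForm (z v : E) : ℝ := ∑ j, ((z j).re * (v j).im - (z j).im * (v j).re)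

/-- The endomorphism `J` of `T_z S⁵`: project to the contact hyperplane along the Reeb field,
then multiply by `i`. -/
def contactJ (z v : E) : E := Complex.I • (v - contactForm z v • (Complex.I • z))

/-! Geometry of a parametrized surface `F : ℝ² → S⁵ ⊂ ℂ³`. A tangent vector of the surface at the
parameter `p` is given by a vector `w : ℝ × ℝ`, which stands for `dF_p(w)`. -/

/-- The coordinate vectors of `ℝ²`. -/
def coordVec : Fin 2 → ℝ × ℝ := ![(1, 0), (0, 1)]

/-- The first fundamental form. -/
def metric (F : ℝ × ℝ → E) (p v w : ℝ × ℝ) : ℝ := rinner (fderiv ℝ F p v) (fderiv ℝ F p w)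

/-- The matrix `(g_ij)` of the first fundamental form. -/
def gram (F : ℝ × ℝ → E) (p : ℝ × ℝ) : Matrix (Fin 2) (Fin 2) ℝ :=
  Matrix.of fun i j => metric F p (coordVec i) (coordVec j)

/-- The tangential part of `v : ℂ³`, as a tangent vector in the parameter plane:
`∑ g^{kl} ⟨v, ∂_l F⟩ ∂_k`. -/
def tanCoord (F : ℝ × ℝ → E) (p : ℝ × ℝ) (v : E) : ℝ × ℝ :=
  ∑ k, ∑ l, ((gram F p)⁻¹ k l * rinner v (fderiv ℝ F p (coordVec l))) • coordVec k

/-- The component of `v : ℂ³` in the normal space of the surface in `S⁵`: remove the part along the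
position vector `F p` and the part tangent to the surface. -/
def normalPart (F : ℝ × ℝ → E) (p : ℝ × ℝ) (v : E) : E :=
  v - rinner v (F p) • F p - fderiv ℝ F p (tanCoord F p v)

/-- The second fundamental form `B(v, w)` of the surface in `S⁵`: the normal part of the second
derivative of `F`. -/
def secondFF (F : ℝ × ℝ → E) (p v w : ℝ × ℝ) : E :=
  normalPart F p (fderiv ℝ (fun q => fderiv ℝ F q w) p v)

/-- The mean curvature vector `H = tr B`. -/
def meanCurv (F : ℝ × ℝ → E) (p : ℝ × ℝ) : E :=
  ∑ i, ∑ j, (gram F p)⁻¹ i j • secondFF F p (coordVec i) (coordVec j)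

/-- The field `JH` along the surface. -/
def JH (F : ℝ × ℝ → E) (p : ℝ × ℝ) : E := contactJ (F p) (meanCurv F p)

/-- The Levi-Civita derivative `∇_w V` of a field `V` tangent to the surface: the tangential part of the
derivative of `V` in `ℂ³`. -/
def covDeriv (F V : ℝ × ℝ → E) (p w : ℝ × ℝ) : ℝ × ℝ := tanCoord F p (fderiv ℝ V p w)

/-- The divergence of a field `V` tangent to the surface: the trace of `w ↦ ∇_w V`. -/
def divergence (F V : ℝ × ℝ → E) (p : ℝ × ℝ) : ℝ :=
  ∑ i, ∑ j, (gram F p)⁻¹ i j * metric F p (covDeriv F V p (coordVec i)) (coordVec j)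

/-- Two tangent vectors that form an orthonormal basis of the tangent plane. -/
def IsOrthonormalFrame (F : ℝ × ℝ → E) (p : ℝ × ℝ) (e : Fin 2 → ℝ × ℝ) : Prop :=
  ∀ i j, metric F p (e i) (e j) = if i = j then 1 else 0

/-- A minimal surface of `S⁵`. -/
def IsMinimal (F : ℝ × ℝ → E) : Prop := ∀ p, meanCurv F p = 0

/-- `V` is a parallel tangent field. -/
def IsParallel (F V : ℝ × ℝ → E) : Prop := ∀ p w, covDeriv F V p w = 0

/-- A smooth Legendrian immersion of the plane in `S⁵`. -/
structure IsLegendrianImmersion (F : ℝ × ℝ → E) : Prop where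
  smooth : ContDiff ℝ ∞ F
  mem_sphere : ∀ p, ‖F p‖ = 1
  immersion : ∀ p, Function.Injective (fderiv ℝ F p)
  isotropic : ∀ p w, contactForm (F p) (fderiv ℝ F p w) = 0

/-! For a discrete subgroup `Λ` of `ℝ²`, maps on the surface `ℝ² / Λ` (a plane, a cylinder or a torus)
are the `Λ`-periodic maps on `ℝ²`. -/

/-- `F` descends to `ℝ² / Λ`. -/
def IsPeriodic (Λ : AddSubgroup (ℝ × ℝ)) (F : ℝ × ℝ → E) : Prop :=
  ∀ l ∈ Λ, ∀ p, F (p + l) = F p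

/-- The area density. -/
def areaDensity (F : ℝ × ℝ → E) (p : ℝ × ℝ) : ℝ := Real.sqrt (gram F p).det

/-- The density of the Willmore functional `∫ (|H|² / 4 + κ) dμ`, where `κ = 1` is the sectional
curvature of `S⁵` on the tangent plane. -/
def willmoreDensity (F : ℝ × ℝ → E) (p : ℝ × ℝ) : ℝ :=
  (‖meanCurv F p‖ ^ 2 / 4 + 1) * areaDensity F p

/-- `Φ t`, for `|t| < ε`, is a smooth variation of `F` through Legendrian immersions of `ℝ² / Λ`,
supported in the image of the compact set `K`. -/
structure IsLegendrianVariation (Λ : AddSubgroup (ℝ × ℝ)) (F : ℝ × ℝ → E) (ε : ℝ)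
    (K : Set (ℝ × ℝ)) (Φ : ℝ → ℝ × ℝ → E) : Prop where
  smooth : ContDiffOn ℝ ∞ (fun q : ℝ × (ℝ × ℝ) => Φ q.1 q.2) (Set.Ioo (-ε) ε ×ˢ Set.univ)
  start : Φ 0 = F
  legendrian : ∀ t ∈ Set.Ioo (-ε) ε, IsLegendrianImmersion (Φ t)
  periodic : ∀ t ∈ Set.Ioo (-ε) ε, IsPeriodic Λ (Φ t)
  support : ∀ t ∈ Set.Ioo (-ε) ε, ∀ p ∉ K + (Λ : Set (ℝ × ℝ)), Φ t p = F p

/-- `F`, as a surface `ℝ² / Λ → S⁵`, is a critical point among Legendrian immersions of the functional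
with the given density: its first derivative vanishes along all compactly supported Legendrian
variations. Integrals over `ℝ² / Λ` are taken over a fundamental domain `D` of `Λ`; only the support
of the variation counts. -/
def IsLegendrianCritical (density : (ℝ × ℝ → E) → ℝ × ℝ → ℝ) (Λ : AddSubgroup (ℝ × ℝ))
    (F : ℝ × ℝ → E) : Prop :=
  ∀ (ε : ℝ) (K D : Set (ℝ × ℝ)) (Φ : ℝ → ℝ × ℝ → E), 0 < ε → IsCompact K →
    MeasureTheory.IsAddFundamentalDomain Λ D MeasureTheory.volume →
    IsLegendrianVariation Λ F ε K Φ →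
    HasDerivAt (fun t => ∫ p in D ∩ (K + (Λ : Set (ℝ × ℝ))), density (Φ t) p) 0 0

/-- `F : ℝ² / Λ → S⁵` is a csL (contact stationary Legendrian) surface: a Legendrian immersion that is
critical for the area among Legendrian immersions. -/
structure IsCsL (Λ : AddSubgroup (ℝ × ℝ)) (F : ℝ × ℝ → E) : Prop where
  legendrian : IsLegendrianImmersion F
  periodic : IsPeriodic Λ F
  critical : IsLegendrianCritical areaDensity Λ F

/-- `F : ℝ² / Λ → S⁵` is a csL Willmore surface: a Legendrian immersion that is critical for the Willmore
functional among Legendrian immersions. -/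
structure IsCsLWillmore (Λ : AddSubgroup (ℝ × ℝ)) (F : ℝ × ℝ → E) : Prop where
  legendrian : IsLegendrianImmersion F
  periodic : IsPeriodic Λ F
  critical : IsLegendrianCritical willmoreDensity Λ F

/-- The function `u` of Mironov's examples. -/
def mironovU (a b c x : ℝ) : ℝ := c * (a + b + (b - a) * Real.cos (2 * x)) / 2

/-- Mironov's examples. -/
def mironov (a b c : ℝ) (p : ℝ × ℝ) : E :=
  !₂[((Real.sqrt (c / (a + c)) * Real.sin p.1 : ℝ) : ℂ) * Complex.exp (Complex.I * (a * p.2 : ℝ)),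
    ((Real.sqrt (c / (b + c)) * Real.cos p.1 : ℝ) : ℂ) * Complex.exp (Complex.I * (b * p.2 : ℝ)),
    ((Real.sqrt (a * Real.sin p.1 ^ 2 / (a + c) + b * Real.cos p.1 ^ 2 / (b + c)) : ℝ) : ℂ) *
      Complex.exp (-(Complex.I * (c * p.2 : ℝ)))]

/-- The Calabi tori. -/
def calabi (r₁ r₂ r₃ r₄ : ℝ) (p : ℝ × ℝ) : E :=
  !₂[((r₁ * r₃ : ℝ) : ℂ) * Complex.exp (Complex.I * (r₂ / r₁ * p.1 + r₄ / r₃ * p.2 : ℝ)),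
    ((r₁ * r₄ : ℝ) : ℂ) * Complex.exp (Complex.I * (r₂ / r₁ * p.1 - r₃ / r₄ * p.2 : ℝ)),
    (r₂ : ℂ) * Complex.exp (-(Complex.I * (r₁ / r₂ * p.1 : ℝ)))]

end CsL

end

noncomputable section
namespace CsL

/-! ### The real inner product of `ℂ³` -/

/-! For a Legendrian immersion, `F, ∂₁F, ∂₂F` is a complex basis of `ℂ³`, and the phase of its
complex determinant is the Legendrian angle `θ`; `angleForm` is `dθ`. The cubic form `⟨B(u,v), i dF
w⟩` is totally symmetric, and its trace gives `H = i dF(grad θ)`, hence `|H|² = |dθ|²`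
(`norm_meanCurv_sq`). Area and Willmore energy thus both belong to the family `∫ (κ|dθ|² + 1) dμ`,
with `κ = 0` and `κ = 1/4`, whose density involves only the metric and `dθ`.

Along a Legendrian variation with field `V`, the contact condition gives `df(w) = 2⟨V, i dF w⟩` for
`f = ⟨V, iF⟩`, and since `d log det` is closed in space and time, `dθ` varies by an exact form `dψ`
with `ψ` periodic and supported where the variation is (`isFirstVariation`). The derivative of the
density is therefore a first order linear expression in `f`, `ψ` and the products `⟨V, ∂ᵢF⟩`.

Suppose now that the metric is diagonal, that the metric and the coefficients of `B` depend on `x`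
only, and that `dθ = m dx + k dy`. The expression is a divergence `∂₁X₁ + ∂₂X₂` as soon as the
stress tensor `(A, B, C)` is divergence free, the `x`-component of its contraction with the second
fundamental form is constant, and the `x`-flux of `dθ` is constant; nothing is required in the
`y`-direction (`HasDiagonalCoords.isLegendrianCritical`). Divergences of periodic fields integrate
to zero over any fundamental domain, by translation invariance (`setIntegral_fderiv_eq_zero`).

Both families are swept out by a one-parameter group `diag(exp(iσ_j y))`, so the structure equations
reduce to identities along a profile curve (`orbitSurface.hasDiagonalCoords`). For Mironov's
surfaces the profile is real and `dθ = (a+b-c) dy`; one conservation law remains to be checked. For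
Calabi tori all coefficients are constant. The formulas for `H` and `∇JH` are read off from the same
structure equations. -/

lemma rinner_apply (v w : E) :
    rinner v w = ∑ j, ((v j).re * (w j).re + (v j).im * (w j).im) := by
  simp only [rinner, PiLp.inner_apply, Complex.re_sum]
  refine Finset.sum_congr rfl fun j _ => ?_
  simp [Complex.mul_re, mul_comm]

lemma contactForm_eq (z v : E) : contactForm z v = rinner (Complex.I • z) v := by
  rw [rinner_apply, contactForm]
  refine Finset.sum_congr rfl fun j _ => ?_
  simp
  ring

lemma rinner_comm (v w : E) : rinner v w = rinner w v := by
  simp only [rinner_apply]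
  exact Finset.sum_congr rfl fun j _ => by ring

lemma rinner_add_left (u v w : E) : rinner (u + v) w = rinner u w + rinner v w := by
  simp [rinner]

lemma rinner_add_right (u v w : E) : rinner u (v + w) = rinner u v + rinner u w := by
  simp [rinner]

lemma rinner_smul_left (r : ℝ) (v w : E) : rinner (r • v) w = r * rinner v w := by
  simp only [rinner_apply, Finset.mul_sum]
  exact Finset.sum_congr rfl fun j _ => by simp; ring

lemma rinner_smul_right (r : ℝ) (v w : E) : rinner v (r • w) = r * rinner v w := by
  rw [rinner_comm, rinner_smul_left, rinner_comm]

lemma rinner_neg_right (v w : E) : rinner v (-w) = -rinner v w := by simp [rinner]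

lemma rinner_zero_left (w : E) : rinner 0 w = 0 := by simp [rinner]

lemma rinner_I_I (v w : E) : rinner (Complex.I • v) (Complex.I • w) = rinner v w := by
  simp only [rinner_apply]
  exact Finset.sum_congr rfl fun j _ => by simp; ring

lemma rinner_I_right (v w : E) : rinner v (Complex.I • w) = -rinner (Complex.I • v) w := by
  rw [← rinner_I_I, smul_smul, Complex.I_mul_I, neg_one_smul, rinner_neg_right]

lemma rinner_I_self (v : E) : rinner (Complex.I • v) v = 0 := by
  have h := rinner_I_right v v
  rw [rinner_comm] at h
  linarith

lemma rinner_self (v : E) : rinner v v = ‖v‖ ^ 2 := by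
  rw [rinner, ← inner_self_eq_norm_sq (𝕜 := ℂ)]; rfl

lemma rinner_self_pos {v : E} (hv : v ≠ 0) : 0 < rinner v v := by
  rw [rinner_self]; positivity

lemma inner_eq_rinner (v w : E) :
    inner ℂ v w = (rinner v w : ℂ) + (rinner (Complex.I • v) w : ℂ) * Complex.I := by
  apply Complex.ext <;> simp [rinner]

lemma I_smul_real_smul (r : ℝ) (v : E) : Complex.I • r • v = r • Complex.I • v :=
  smul_comm _ _ _

lemma I_smul_I_smul (v : E) : Complex.I • Complex.I • v = -v := by
  rw [smul_smul, Complex.I_mul_I, neg_one_smul]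

section Calculus

variable {W : Type*} [NormedAddCommGroup W] [NormedSpace ℝ W]

lemma hasFDerivAt_I_smul {f : W → E} {f' : W →L[ℝ] E} {q : W} (hf : HasFDerivAt f f' q) :
    HasFDerivAt (fun q => Complex.I • f q) (Complex.I • f') q := hf.const_smul Complex.I

lemma differentiableAt_I_smul {f : W → E} {q : W} (hf : DifferentiableAt ℝ f q) :
    DifferentiableAt ℝ (fun q => Complex.I • f q) q :=
  (hasFDerivAt_I_smul hf.hasFDerivAt).differentiableAt

lemma fderiv_I_smul {f : W → E} {q : W} (hf : DifferentiableAt ℝ f q) (e : W) :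
    fderiv ℝ (fun q => Complex.I • f q) q e = Complex.I • fderiv ℝ f q e := by
  rw [(hasFDerivAt_I_smul hf.hasFDerivAt).fderiv]; rfl

lemma fderiv_rinner {f g : W → E} {q : W} (hf : DifferentiableAt ℝ f q)
    (hg : DifferentiableAt ℝ g q) (e : W) :
    fderiv ℝ (fun q => rinner (f q) (g q)) q e =
      rinner (fderiv ℝ f q e) (g q) + rinner (f q) (fderiv ℝ g q e) := by
  have h := Complex.reCLM.hasFDerivAt.comp q (hf.hasFDerivAt.inner ℂ hg.hasFDerivAt)
  rw [show (fun q => rinner (f q) (g q)) = (Complex.reCLM ∘ fun q => inner ℂ (f q) (g q)) from rfl,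
    h.fderiv]
  simp [rinner, add_comm]

lemma contDiffOn_rinner {f g : W → E} {s : Set W} {n : WithTop ℕ∞} (hf : ContDiffOn ℝ n f s)
    (hg : ContDiffOn ℝ n g s) : ContDiffOn ℝ n (fun q => rinner (f q) (g q)) s :=
  Complex.reCLM.contDiff.comp_contDiffOn (hf.inner ℂ hg)

lemma contDiff_rinner {f g : W → E} {n : WithTop ℕ∞} (hf : ContDiff ℝ n f)
    (hg : ContDiff ℝ n g) : ContDiff ℝ n (fun q => rinner (f q) (g q)) :=
  Complex.reCLM.contDiff.comp (hf.inner ℂ hg)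

end Calculus

/-! ### Linear algebra of the first fundamental form -/

lemma vec_eq (w : ℝ × ℝ) : w = w.1 • ((1, 0) : ℝ × ℝ) + w.2 • ((0, 1) : ℝ × ℝ) := by
  ext <;> simp

lemma clm_apply_eq {G : Type*} [NormedAddCommGroup G] [NormedSpace ℝ G] (L : ℝ × ℝ →L[ℝ] G)
    (w : ℝ × ℝ) : L w = w.1 • L (1, 0) + w.2 • L (0, 1) := by
  conv_lhs => rw [vec_eq w]
  simp only [map_add, map_smul]

lemma metric_comm (F : ℝ × ℝ → E) (p v w : ℝ × ℝ) : metric F p v w = metric F p w v :=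
  rinner_comm _ _

lemma metric_apply (F : ℝ × ℝ → E) (p v w : ℝ × ℝ) :
    metric F p v w = v.1 * w.1 * metric F p (1, 0) (1, 0) +
      (v.1 * w.2 + v.2 * w.1) * metric F p (1, 0) (0, 1) + v.2 * w.2 * metric F p (0, 1) (0, 1) := by
  have h : rinner (fderiv ℝ F p (0, 1)) (fderiv ℝ F p (1, 0)) =
    rinner (fderiv ℝ F p (1, 0)) (fderiv ℝ F p (0, 1)) := rinner_comm _ _
  rw [metric, clm_apply_eq _ v, clm_apply_eq _ w]
  simp only [rinner_add_left, rinner_add_right, rinner_smul_left, rinner_smul_right, metric, h]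
  ring

lemma gram_eq (F : ℝ × ℝ → E) (p : ℝ × ℝ) :
    gram F p = !![metric F p (1, 0) (1, 0), metric F p (1, 0) (0, 1);
      metric F p (1, 0) (0, 1), metric F p (0, 1) (0, 1)] := by
  ext i j
  fin_cases i <;> fin_cases j <;> simp [gram, coordVec, metric_comm F p (0, 1) (1, 0)]

lemma gram_det (F : ℝ × ℝ → E) (p : ℝ × ℝ) :
    (gram F p).det = metric F p (1, 0) (1, 0) * metric F p (0, 1) (0, 1) -
      metric F p (1, 0) (0, 1) ^ 2 := by
  rw [gram_eq, Matrix.det_fin_two_of]; ring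

lemma gram_inv (F : ℝ × ℝ → E) (p : ℝ × ℝ) :
    (gram F p)⁻¹ = !![metric F p (0, 1) (0, 1) / (gram F p).det,
      -metric F p (1, 0) (0, 1) / (gram F p).det; -metric F p (1, 0) (0, 1) / (gram F p).det,
      metric F p (1, 0) (1, 0) / (gram F p).det] := by
  rw [Matrix.inv_def, Ring.inverse_eq_inv', Matrix.adjugate_fin_two]
  ext i j
  fin_cases i <;> fin_cases j <;> simp [gram_eq, div_eq_inv_mul]

lemma metric_self_pos {F : ℝ × ℝ → E} {p : ℝ × ℝ} (h : Function.Injective (fderiv ℝ F p))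
    {w : ℝ × ℝ} (hw : w ≠ 0) : 0 < metric F p w w :=
  rinner_self_pos fun h0 => hw (h (by rw [h0, map_zero]))

lemma gram_det_pos {F : ℝ × ℝ → E} {p : ℝ × ℝ} (h : Function.Injective (fderiv ℝ F p)) :
    0 < (gram F p).det := by
  have h1 : 0 < metric F p (1, 0) (1, 0) := metric_self_pos h (by simp)
  -- This vector is orthogonal to `∂₁`, and its squared length is `g₁₁ det g`.
  have h2 := metric_self_pos h
    (w := (-metric F p (1, 0) (0, 1), metric F p (1, 0) (1, 0))) (by simp [h1.ne'])
  rw [metric_apply] at h2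
  rw [gram_det]
  refine (mul_pos_iff_of_pos_left h1).1 ?_
  dsimp only at h2
  linarith

lemma tanCoord_eq (F : ℝ × ℝ → E) (p : ℝ × ℝ) (v : E) :
    tanCoord F p v =
      ((metric F p (0, 1) (0, 1) * rinner v (fderiv ℝ F p (1, 0)) -
        metric F p (1, 0) (0, 1) * rinner v (fderiv ℝ F p (0, 1))) / (gram F p).det,
      (metric F p (1, 0) (1, 0) * rinner v (fderiv ℝ F p (0, 1)) -
        metric F p (1, 0) (0, 1) * rinner v (fderiv ℝ F p (1, 0))) / (gram F p).det) := by
  simp only [tanCoord, Fin.sum_univ_two, gram_inv, coordVec]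
  ext <;> simp <;> ring

/-- `v` has real coordinates `x₀, y₀, x, y` in the frame `F, iF, dF, i dF`. -/
def HasCoords (F : ℝ × ℝ → E) (p : ℝ × ℝ) (v : E) (x₀ y₀ : ℝ) (x y : ℝ × ℝ) : Prop :=
  v = x₀ • F p + y₀ • (Complex.I • F p) + fderiv ℝ F p x + Complex.I • fderiv ℝ F p y

/-- The frame `F, iF, dF, i dF` of a Legendrian immersion has the expected inner products. -/
structure IsLegendrianFrame (F : ℝ × ℝ → E) (p : ℝ × ℝ) : Prop where
  immersion : Function.Injective (fderiv ℝ F p)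
  self : rinner (F p) (F p) = 1
  tangent : ∀ w, rinner (F p) (fderiv ℝ F p w) = 0
  reeb : ∀ w, rinner (Complex.I • F p) (fderiv ℝ F p w) = 0
  lagrangian : ∀ v w, rinner (Complex.I • fderiv ℝ F p v) (fderiv ℝ F p w) = 0

namespace HasCoords

variable {F : ℝ × ℝ → E} {p : ℝ × ℝ} {v : E} {x₀ y₀ : ℝ} {x y : ℝ × ℝ}

lemma rinner_position (h : HasCoords F p v x₀ y₀ x y) (hF : IsLegendrianFrame F p) :
    rinner v (F p) = x₀ := by
  have h1 := hF.tangent x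
  have h2 := hF.reeb y
  rw [rinner_comm] at h1
  have h3 := rinner_I_right (fderiv ℝ F p y) (F p)
  rw [rinner_comm, h2] at h3
  rw [h]
  simp only [rinner_add_left, rinner_smul_left, rinner_I_self, hF.self, h1]
  linarith

lemma rinner_reeb (h : HasCoords F p v x₀ y₀ x y) (hF : IsLegendrianFrame F p) :
    rinner v (Complex.I • F p) = y₀ := by
  have h1 := hF.reeb x
  have h2 := hF.tangent y
  rw [rinner_comm] at h1 h2
  rw [h]
  simp only [rinner_add_left, rinner_smul_left, rinner_I_I, hF.self, h1, h2]
  rw [rinner_comm, rinner_I_self]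
  simp

lemma rinner_tangent (h : HasCoords F p v x₀ y₀ x y) (hF : IsLegendrianFrame F p) (w : ℝ × ℝ) :
    rinner v (fderiv ℝ F p w) = metric F p x w := by
  rw [h]
  simp only [rinner_add_left, rinner_smul_left, hF.tangent, hF.reeb, hF.lagrangian, metric]
  simp

lemma rinner_normal (h : HasCoords F p v x₀ y₀ x y) (hF : IsLegendrianFrame F p) (w : ℝ × ℝ) :
    rinner v (Complex.I • fderiv ℝ F p w) = metric F p y w := by
  rw [h]
  simp only [rinner_add_left, rinner_smul_left, rinner_I_I, hF.tangent, metric]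
  simp only [rinner_I_right (F p), rinner_I_right (fderiv ℝ F p x), hF.reeb, hF.lagrangian]
  simp

lemma tanCoord (h : HasCoords F p v x₀ y₀ x y) (hF : IsLegendrianFrame F p) :
    tanCoord F p v = x := by
  have hd := (gram_det_pos hF.immersion).ne'
  rw [tanCoord_eq, h.rinner_tangent hF, h.rinner_tangent hF, metric_apply F p x (1, 0),
    metric_apply F p x (0, 1)]
  ext <;> dsimp only <;> rw [div_eq_iff hd, gram_det] <;> ring

lemma normalPart (h : HasCoords F p v x₀ y₀ x y) (hF : IsLegendrianFrame F p) :
    normalPart F p v = y₀ • (Complex.I • F p) + Complex.I • fderiv ℝ F p y := by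
  rw [CsL.normalPart, h.rinner_position hF, h.tanCoord hF]
  nth_rewrite 1 [h]
  abel

end HasCoords

/-- The determinant of three vectors of `ℂ³`. -/
def det3 (u v w : E) : ℂ :=
  u 0 * (v 1 * w 2 - v 2 * w 1) - u 1 * (v 0 * w 2 - v 2 * w 0) + u 2 * (v 0 * w 1 - v 1 * w 0)

/-- Cramer's rule in a division-free form. -/
lemma cramer3 (a b c v : E) :
    det3 a b c • v = det3 v b c • a + det3 a v c • b + det3 a b v • c := by
  ext j
  fin_cases j <;> simp [det3] <;> ring

/-- The squared modulus of a determinant is the determinant of the hermitian Gram matrix. -/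
lemma det3_mul_conj (a b c : E) : starRingEnd ℂ (det3 a b c) * det3 a b c =
    inner ℂ a a * (inner ℂ b b * inner ℂ c c - inner ℂ b c * inner ℂ c b) -
    inner ℂ a b * (inner ℂ b a * inner ℂ c c - inner ℂ b c * inner ℂ c a) +
    inner ℂ a c * (inner ℂ b a * inner ℂ c b - inner ℂ b b * inner ℂ c a) := by
  simp only [det3, PiLp.inner_apply, Fin.sum_univ_three, map_add, map_sub, map_mul,
    RCLike.inner_apply]
  ring

/-- The complex determinant of the frame `F, ∂₁F, ∂₂F`. -/
def frameDet (F : ℝ × ℝ → E) (p : ℝ × ℝ) : ℂ :=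
  det3 (F p) (fderiv ℝ F p (1, 0)) (fderiv ℝ F p (0, 1))

namespace IsLegendrianFrame

variable {F : ℝ × ℝ → E} {p : ℝ × ℝ}

/-- The hermitian products of a Legendrian frame are real, and `F` is hermitian orthogonal to the
tangent plane, so the hermitian Gram matrix is `1 ⊕ g`. -/
lemma frameDet_mul_conj (hF : IsLegendrianFrame F p) :
    starRingEnd ℂ (frameDet F p) * frameDet F p = ((gram F p).det : ℂ) := by
  have h1 : ∀ w, inner ℂ (F p) (fderiv ℝ F p w) = 0 := fun w => by
    rw [inner_eq_rinner, hF.tangent, hF.reeb]; simp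
  have h2 : ∀ v w, inner ℂ (fderiv ℝ F p v) (fderiv ℝ F p w) = (metric F p v w : ℂ) := fun v w => by
    rw [inner_eq_rinner, hF.lagrangian, metric]; simp
  have h3 : inner ℂ (F p) (F p) = (1 : ℂ) := by
    rw [inner_eq_rinner, hF.self, rinner_I_self]; simp
  rw [frameDet, det3_mul_conj, h1, h1, h2, h2, h2, h2, h3, gram_det,
    metric_comm F p (0, 1) (1, 0)]
  push_cast
  ring

lemma frameDet_ne_zero (hF : IsLegendrianFrame F p) : frameDet F p ≠ 0 := fun h => by
  have h1 := hF.frameDet_mul_conj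
  rw [h, mul_zero] at h1
  exact (gram_det_pos hF.immersion).ne (by exact_mod_cast h1)

/-- Since `frameDet` does not vanish, `F, ∂₁F, ∂₂F` is a complex basis; the real and imaginary parts
of the Cramer coefficients are the coordinates. -/
lemma exists_coords (hF : IsLegendrianFrame F p) (v : E) :
    ∃ x₀ y₀ x y, HasCoords F p v x₀ y₀ x y := by
  have h := cramer3 (F p) (fderiv ℝ F p (1, 0)) (fderiv ℝ F p (0, 1)) v
  set z := fun c : ℂ => (frameDet F p)⁻¹ * c with hz
  have hv : v = z (det3 v (fderiv ℝ F p (1, 0)) (fderiv ℝ F p (0, 1))) • F p +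
      z (det3 (F p) v (fderiv ℝ F p (0, 1))) • fderiv ℝ F p (1, 0) +
      z (det3 (F p) (fderiv ℝ F p (1, 0)) v) • fderiv ℝ F p (0, 1) := by
    simp only [hz, mul_smul, ← smul_add, ← h]
    rw [← mul_smul]
    change v = ((frameDet F p)⁻¹ * frameDet F p) • v
    rw [inv_mul_cancel₀ hF.frameDet_ne_zero, one_smul]
  have hc : ∀ (c : ℂ) (w : E), c • w = c.re • w + c.im • Complex.I • w := fun c w => by
    conv_lhs => rw [← Complex.re_add_im c]
    rw [add_smul, mul_smul, Complex.coe_smul, Complex.coe_smul]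
  generalize z (det3 v (fderiv ℝ F p (1, 0)) (fderiv ℝ F p (0, 1))) = z₀ at hv
  generalize z (det3 (F p) v (fderiv ℝ F p (0, 1))) = z₁ at hv
  generalize z (det3 (F p) (fderiv ℝ F p (1, 0)) v) = z₂ at hv
  refine ⟨z₀.re, z₀.im, (z₁.re, z₂.re), (z₁.im, z₂.im), ?_⟩
  rw [HasCoords, clm_apply_eq _ (z₁.re, z₂.re), clm_apply_eq _ (z₁.im, z₂.im)]
  simp only [smul_add, I_smul_real_smul]
  rw [hc z₀, hc z₁, hc z₂] at hv
  rw [hv]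
  abel

end IsLegendrianFrame

/-! ### Legendrian immersions -/

lemma fderiv_fderiv_apply {W G : Type*} [NormedAddCommGroup W] [NormedSpace ℝ W]
    [NormedAddCommGroup G] [NormedSpace ℝ G] {f : W → G} {q : W}
    (hf : DifferentiableAt ℝ (fderiv ℝ f) q) (v w : W) :
    fderiv ℝ (fun q => fderiv ℝ f q w) q v = fderiv ℝ (fderiv ℝ f) q v w := by
  rw [fderiv_clm_apply hf (differentiableAt_const w)]
  simp

lemma fderiv_fderiv_comm {W G : Type*} [NormedAddCommGroup W] [NormedSpace ℝ W]
    [NormedAddCommGroup G] [NormedSpace ℝ G] {f : W → G} {q : W}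
    (hf : ContDiffAt ℝ ∞ f q) (v w : W) :
    fderiv ℝ (fun q => fderiv ℝ f q w) q v = fderiv ℝ (fun q => fderiv ℝ f q v) q w := by
  have h1 : DifferentiableAt ℝ (fderiv ℝ f) q :=
    (hf.fderiv_right (m := 1) (by norm_cast)).differentiableAt (by simp)
  rw [fderiv_fderiv_apply h1, fderiv_fderiv_apply h1]
  exact (hf.isSymmSndFDerivAt (by simpa using (by norm_cast : (2 : WithTop ℕ∞) ≤ ∞))) v w

lemma contDiff_fderiv_apply {W G : Type*} [NormedAddCommGroup W] [NormedSpace ℝ W]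
    [NormedAddCommGroup G] [NormedSpace ℝ G] {f : W → G}
    (hf : ContDiff ℝ ∞ f) (w : W) : ContDiff ℝ ∞ (fun q => fderiv ℝ f q w) :=
  (hf.fderiv_right (m := ∞) (by simp)).clm_apply contDiff_const

lemma differentiable_fderiv_apply {W G : Type*} [NormedAddCommGroup W] [NormedSpace ℝ W]
    [NormedAddCommGroup G] [NormedSpace ℝ G] {f : W → G}
    (hf : ContDiff ℝ ∞ f) (w : W) : Differentiable ℝ (fun q => fderiv ℝ f q w) :=
  (contDiff_fderiv_apply hf w).differentiable (by simp)

lemma fderiv_eq_zero_of_forall_eq {W : Type*} [NormedAddCommGroup W] [NormedSpace ℝ W]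
    {f : W → ℝ} {c : ℝ} (h : ∀ q, f q = c) (q v : W) : fderiv ℝ f q v = 0 := by
  rw [show f = fun _ => c from funext h]; simp

namespace IsLegendrianImmersion

variable {F : ℝ × ℝ → E} (hF : IsLegendrianImmersion F)
include hF

lemma differentiable : Differentiable ℝ F := hF.smooth.differentiable (by simp)

lemma rinner_self_eq (p : ℝ × ℝ) : rinner (F p) (F p) = 1 := by
  rw [rinner_self, hF.mem_sphere]; norm_num

lemma rinner_tangent (p w : ℝ × ℝ) : rinner (F p) (fderiv ℝ F p w) = 0 := by
  have h := fderiv_eq_zero_of_forall_eq hF.rinner_self_eq p w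
  rw [fderiv_rinner (hF.differentiable p) (hF.differentiable p), rinner_comm] at h
  linarith

lemma rinner_reeb (p w : ℝ × ℝ) : rinner (Complex.I • F p) (fderiv ℝ F p w) = 0 := by
  rw [← contactForm_eq]; exact hF.isotropic p w

lemma rinner_reeb_second_aux (p v w : ℝ × ℝ) :
    rinner (Complex.I • fderiv ℝ F p v) (fderiv ℝ F p w) +
      rinner (Complex.I • F p) (fderiv ℝ (fun q => fderiv ℝ F q w) p v) = 0 := by
  have h := fderiv_eq_zero_of_forall_eq (fun q => hF.rinner_reeb q w) p v
  rw [fderiv_rinner (differentiableAt_I_smul (hF.differentiable p))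
    (differentiable_fderiv_apply hF.smooth w p), fderiv_I_smul (hF.differentiable p)] at h
  exact h

/-- In the differentiated contact condition, the second derivative is symmetric in `v, w` while `⟨i
·, ·⟩` is antisymmetric, so both terms vanish separately. -/
lemma lagrangian (p v w : ℝ × ℝ) :
    rinner (Complex.I • fderiv ℝ F p v) (fderiv ℝ F p w) = 0 := by
  have h1 := hF.rinner_reeb_second_aux p v w
  have h2 := hF.rinner_reeb_second_aux p w v
  rw [fderiv_fderiv_comm hF.smooth.contDiffAt] at h2
  have h3 := rinner_I_right (fderiv ℝ F p v) (fderiv ℝ F p w)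
  rw [rinner_comm] at h3
  linarith

lemma frame (p : ℝ × ℝ) : IsLegendrianFrame F p :=
  ⟨hF.immersion p, hF.rinner_self_eq p, hF.rinner_tangent p, hF.rinner_reeb p, hF.lagrangian p⟩

lemma rinner_reeb_second (p v w : ℝ × ℝ) :
    rinner (Complex.I • F p) (fderiv ℝ (fun q => fderiv ℝ F q w) p v) = 0 := by
  have h := hF.rinner_reeb_second_aux p v w
  rwa [hF.lagrangian, zero_add] at h

/-- This is the derivative of `lagrangian`. With the symmetry of second derivatives it makes the
cubic form totally symmetric. -/
lemma cubicForm_comm (p u v w : ℝ × ℝ) :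
    rinner (fderiv ℝ (fun q => fderiv ℝ F q w) p v) (Complex.I • fderiv ℝ F p u) =
      rinner (fderiv ℝ (fun q => fderiv ℝ F q u) p v) (Complex.I • fderiv ℝ F p w) := by
  have h := fderiv_eq_zero_of_forall_eq (fun q => hF.lagrangian q u w) p v
  rw [fderiv_rinner (differentiableAt_I_smul (differentiable_fderiv_apply hF.smooth u p))
    (differentiable_fderiv_apply hF.smooth w p),
    fderiv_I_smul (differentiable_fderiv_apply hF.smooth u p)] at h
  rw [rinner_comm, rinner_I_right (fderiv ℝ (fun q => fderiv ℝ F q u) p v)]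
  linarith

lemma exists_second_coords (p v w : ℝ × ℝ) :
    ∃ x₀ x y, HasCoords F p (fderiv ℝ (fun q => fderiv ℝ F q w) p v) x₀ 0 x y := by
  obtain ⟨x₀, y₀, x, y, h⟩ := (hF.frame p).exists_coords (fderiv ℝ (fun q => fderiv ℝ F q w) p v)
  have h0 := h.rinner_reeb (hF.frame p)
  rw [rinner_comm, hF.rinner_reeb_second] at h0
  exact ⟨x₀, x, y, h0 ▸ h⟩

omit hF

lemma meanCurv_eq {p : ℝ × ℝ} (hF : IsLegendrianFrame F p) {x₀ : Fin 2 → Fin 2 → ℝ}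
    {x y : Fin 2 → Fin 2 → ℝ × ℝ} (h : ∀ i j, HasCoords F p
      (fderiv ℝ (fun q => fderiv ℝ F q (coordVec j)) p (coordVec i)) (x₀ i j) 0 (x i j) (y i j)) :
    meanCurv F p = Complex.I • fderiv ℝ F p (∑ i, ∑ j, (gram F p)⁻¹ i j • y i j) := by
  simp only [meanCurv, secondFF, map_sum, Finset.smul_sum, map_smul]
  refine Finset.sum_congr rfl fun i _ => Finset.sum_congr rfl fun j _ => ?_
  rw [(h i j).normalPart hF, zero_smul, zero_add, I_smul_real_smul]

end IsLegendrianImmersion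

/-! ### The Legendrian angle and the mean curvature -/

lemma fderiv_det3 {W : Type*} [NormedAddCommGroup W] [NormedSpace ℝ W] {f g h : W → E} {q : W}
    (hf : DifferentiableAt ℝ f q) (hg : DifferentiableAt ℝ g q) (hh : DifferentiableAt ℝ h q)
    (e : W) : fderiv ℝ (fun q => det3 (f q) (g q) (h q)) q e =
      det3 (fderiv ℝ f q e) (g q) (h q) + det3 (f q) (fderiv ℝ g q e) (h q) +
        det3 (f q) (g q) (fderiv ℝ h q e) := by
  have hc : ∀ {f : W → E}, DifferentiableAt ℝ f q → ∀ j,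
      HasFDerivAt (fun q => f q j) (((EuclideanSpace.proj j : E →L[ℂ] ℂ).restrictScalars ℝ).comp
        (fderiv ℝ f q)) q := fun {f} hf j =>
    ((EuclideanSpace.proj j : E →L[ℂ] ℂ).restrictScalars ℝ).hasFDerivAt.comp q hf.hasFDerivAt
  have h2 : ∀ i j, _ := fun i j => ((hc hg i).mul (hc hh j)).sub ((hc hg j).mul (hc hh i))
  have h3 := ((((hc hf 0).mul (h2 1 2)).sub ((hc hf 1).mul (h2 0 2))).add ((hc hf 2).mul (h2 0 1)))
  have h4 : HasFDerivAt (fun q => det3 (f q) (g q) (h q)) _ q := h3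
  rw [h4.fderiv]
  simp [det3]
  ring

lemma contDiffOn_det3 {W : Type*} [NormedAddCommGroup W] [NormedSpace ℝ W] {f g h : W → E}
    {s : Set W} {n : WithTop ℕ∞} (hf : ContDiffOn ℝ n f s) (hg : ContDiffOn ℝ n g s)
    (hh : ContDiffOn ℝ n h s) : ContDiffOn ℝ n (fun q => det3 (f q) (g q) (h q)) s := by
  have hc : ∀ {f : W → E}, ContDiffOn ℝ n f s → ∀ j, ContDiffOn ℝ n (fun q => f q j) s :=
    fun {f} hf j => ((EuclideanSpace.proj j : E →L[ℂ] ℂ).restrictScalars ℝ).contDiff.comp_contDiffOn hf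
  have h2 : ∀ i j, _ := fun i j => ((hc hg i).mul (hc hh j)).sub ((hc hg j).mul (hc hh i))
  exact (((hc hf 0).mul (h2 1 2)).sub ((hc hf 1).mul (h2 0 2))).add ((hc hf 2).mul (h2 0 1))

/-- The derivative of the Legendrian angle: the imaginary part of the logarithmic derivative of the
complex determinant of the frame. -/
def angleForm (F : ℝ × ℝ → E) (p w : ℝ × ℝ) : ℝ := (fderiv ℝ (frameDet F) p w / frameDet F p).im

lemma HasCoords.det3_second {F : ℝ × ℝ → E} {p : ℝ × ℝ} {v : E} {x₀ y₀ : ℝ} {x y : ℝ × ℝ}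
    (h : HasCoords F p v x₀ y₀ x y) : det3 (F p) v (fderiv ℝ F p (0, 1)) =
      (x.1 + y.1 * Complex.I) * frameDet F p := by
  rw [h, clm_apply_eq _ x, clm_apply_eq _ y, frameDet]
  simp [det3]
  ring

lemma HasCoords.det3_third {F : ℝ × ℝ → E} {p : ℝ × ℝ} {v : E} {x₀ y₀ : ℝ} {x y : ℝ × ℝ}
    (h : HasCoords F p v x₀ y₀ x y) : det3 (F p) (fderiv ℝ F p (1, 0)) v =
      (x.2 + y.2 * Complex.I) * frameDet F p := by
  rw [h, clm_apply_eq _ x, clm_apply_eq _ y, frameDet]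
  simp [det3]
  ring

lemma det3_tangent (F : ℝ × ℝ → E) (p w : ℝ × ℝ) :
    det3 (fderiv ℝ F p w) (fderiv ℝ F p (1, 0)) (fderiv ℝ F p (0, 1)) = 0 := by
  rw [clm_apply_eq _ w]
  simp [det3]
  ring

namespace IsLegendrianImmersion

variable {F : ℝ × ℝ → E} (hF : IsLegendrianImmersion F)
include hF

/-- Differentiate the determinant column by column. The column `F` becomes tangent and contributes
nothing; the other two contribute the diagonal entries of a complex matrix, so the logarithmic
derivative is its trace, and the imaginary part keeps only the normal coordinates. -/
lemma angleForm_eq {p w : ℝ × ℝ} {x₀ x₀' y₀ y₀' : ℝ} {x y x' y' : ℝ × ℝ}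
    (h : HasCoords F p (fderiv ℝ (fun q => fderiv ℝ F q (1, 0)) p w) x₀ y₀ x y)
    (h' : HasCoords F p (fderiv ℝ (fun q => fderiv ℝ F q (0, 1)) p w) x₀' y₀' x' y') :
    angleForm F p w = y.1 + y'.2 := by
  have hd : fderiv ℝ (frameDet F) p w = _ := fderiv_det3 (hF.differentiable p)
    (differentiable_fderiv_apply hF.smooth (1, 0) p)
    (differentiable_fderiv_apply hF.smooth (0, 1) p) w
  rw [angleForm, hd, det3_tangent, h.det3_second, h'.det3_third, zero_add, ← add_mul,
    mul_div_cancel_right₀ _ (hF.frame p).frameDet_ne_zero]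
  simp

/-- The squared length of the mean curvature vector in terms of the Legendrian angle. -/
lemma norm_meanCurv_sq (p : ℝ × ℝ) :
    ‖meanCurv F p‖ ^ 2 * (gram F p).det =
      metric F p (0, 1) (0, 1) * angleForm F p (1, 0) ^ 2 -
        2 * metric F p (1, 0) (0, 1) * angleForm F p (1, 0) * angleForm F p (0, 1) +
        metric F p (1, 0) (1, 0) * angleForm F p (0, 1) ^ 2 := by
  have hp := hF.frame p
  obtain ⟨a₁, x₁, y₁, h₁⟩ := hF.exists_second_coords p (1, 0) (1, 0)
  obtain ⟨a₂, x₂, y₂, h₂⟩ := hF.exists_second_coords p (1, 0) (0, 1)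
  obtain ⟨a₃, x₃, y₃, h₃⟩ := hF.exists_second_coords p (0, 1) (0, 1)
  have h₂' := h₂
  rw [fderiv_fderiv_comm hF.smooth.contDiffAt] at h₂'
  have hH := meanCurv_eq hp (x₀ := ![![a₁, a₂], ![a₂, a₃]]) (x := ![![x₁, x₂], ![x₂, x₃]])
    (y := ![![y₁, y₂], ![y₂, y₃]]) (by
      intro i j
      fin_cases i <;> fin_cases j
      exacts [h₁, h₂, h₂', h₃])
  have hc₁ := hF.cubicForm_comm p (0, 1) (1, 0) (1, 0)
  have hc₂ := hF.cubicForm_comm p (1, 0) (0, 1) (0, 1)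
  rw [h₁.rinner_normal hp, h₂.rinner_normal hp, metric_apply F p y₁, metric_apply F p y₂] at hc₁
  rw [h₃.rinner_normal hp, h₂'.rinner_normal hp, metric_apply F p y₃, metric_apply F p y₂] at hc₂
  have hd := (gram_det_pos hp.immersion).ne'
  -- The right side is `g⁻¹ dθ`, that is, `grad θ`. The two ways of tracing the cubic form agree
  -- because of the symmetries `hc₁` and `hc₂`.
  have hs : ∑ i, ∑ j, (gram F p)⁻¹ i j • (![![y₁, y₂], ![y₂, y₃]] : Fin 2 → Fin 2 → ℝ × ℝ) i j =
      ((metric F p (0, 1) (0, 1) * (y₁.1 + y₂.2) - metric F p (1, 0) (0, 1) * (y₂.1 + y₃.2)) /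
        (gram F p).det,
      (metric F p (1, 0) (1, 0) * (y₂.1 + y₃.2) - metric F p (1, 0) (0, 1) * (y₁.1 + y₂.2)) /
        (gram F p).det) := by
    rw [gram_inv]
    ext
    · simp [Fin.sum_univ_two]
      field_simp
      linear_combination hc₂
    · simp [Fin.sum_univ_two]
      field_simp
      linear_combination hc₁
  rw [hH, hs, ← rinner_self, rinner_I_I]
  change metric F p _ _ * _ = _
  rw [metric_apply, hF.angleForm_eq h₁ h₂, hF.angleForm_eq h₂' h₃]
  field_simp
  rw [gram_det]
  ring

end IsLegendrianImmersion
open MeasureTheory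

/-! ### Integrals of periodic functions over a fundamental domain -/

section Integral

variable {Λ : AddSubgroup (ℝ × ℝ)}

lemma countable_of_discrete (hΛ : DiscreteTopology Λ) : Countable Λ :=
  TopologicalSpace.separableSpace_iff_countable.1 inferInstance

lemma isClosed_add_lattice (hΛ : DiscreteTopology Λ) {K : Set (ℝ × ℝ)} (hK : IsCompact K) :
    IsClosed (K + (Λ : Set (ℝ × ℝ))) :=
  (AddSubgroup.isClosed_of_discrete).add_left_of_isCompact hK

lemma measurableSet_add_lattice [Countable Λ] {K : Set (ℝ × ℝ)} (hK : IsCompact K) :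
    MeasurableSet (K + (Λ : Set (ℝ × ℝ))) := by
  rw [show K + (Λ : Set (ℝ × ℝ)) = ⋃ l : Λ, (fun k => k + (l : ℝ × ℝ)) '' K by
    ext p
    simp only [Set.mem_add, Set.mem_iUnion, Set.mem_image, SetLike.mem_coe]
    exact ⟨fun ⟨k, hk, l, hl, h⟩ => ⟨⟨l, hl⟩, k, hk, h⟩, fun ⟨l, k, hk, h⟩ => ⟨k, hk, l, l.2, h⟩⟩]
  exact MeasurableSet.iUnion fun l =>
    (hK.image (continuous_id.add continuous_const)).measurableSet

/-- The pieces of the translates of `K` inside `D` have total volume `vol K`, because `D` is a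
fundamental domain. No boundedness of `D` is needed. -/
lemma measure_domain_inter_lt_top [Countable Λ] {K D : Set (ℝ × ℝ)} (hK : IsCompact K)
    (hD : IsAddFundamentalDomain Λ D volume) :
    volume (D ∩ (K + (Λ : Set (ℝ × ℝ)))) < ⊤ := by
  refine lt_of_le_of_lt ?_ (hK.measure_lt_top (μ := volume))
  rw [hD.measure_eq_tsum K]
  refine le_trans (measure_mono ?_) (measure_iUnion_le _)
  rintro p ⟨hpD, k, hk, l, hl, rfl⟩
  exact Set.mem_iUnion.2 ⟨⟨l, hl⟩, ⟨k, hk, add_comm _ _⟩, hpD⟩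

/-- Differentiation under the integral sign for families of periodic functions. -/
lemma hasDerivAt_integral_periodic [Countable Λ] {K D : Set (ℝ × ℝ)} (hK : IsCompact K)
    (hD : IsAddFundamentalDomain Λ D volume) {ε : ℝ} (hε : 0 < ε) {h : ℝ → ℝ × ℝ → ℝ}
    (hh : ContDiffOn ℝ 1 (fun q : ℝ × (ℝ × ℝ) => h q.1 q.2) (Set.Ioo (-ε) ε ×ˢ Set.univ))
    (hper : ∀ t ∈ Set.Ioo (-ε) ε, ∀ l ∈ Λ, ∀ p, h t (p + l) = h t p)
    {h' : ℝ × ℝ → ℝ} (hh' : ∀ p, HasDerivAt (fun t => h t p) (h' p) 0) :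
    HasDerivAt (fun t => ∫ p in D ∩ (K + (Λ : Set (ℝ × ℝ))), h t p)
      (∫ p in D ∩ (K + (Λ : Set (ℝ × ℝ))), h' p) 0 := by
  set U : Set (ℝ × (ℝ × ℝ)) := Set.Ioo (-ε) ε ×ˢ Set.univ with hU
  have hUo : IsOpen U := isOpen_Ioo.prod isOpen_univ
  set H : ℝ × (ℝ × ℝ) → ℝ := fun q => h q.1 q.2 with hH
  -- A compact time interval, so that the time derivative is bounded on `I × K`.
  set I : Set ℝ := Set.Icc (-(ε / 2)) (ε / 2) with hI
  have hIsub : I ⊆ Set.Ioo (-ε) ε := Set.Icc_subset_Ioo (by linarith) (by linarith)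
  have hdiff : ∀ q ∈ U, DifferentiableAt ℝ H q := fun q hq =>
    (hh.differentiableOn (by simp)).differentiableAt (hUo.mem_nhds hq)
  have hd : ∀ t ∈ Set.Ioo (-ε) ε, ∀ p, HasDerivAt (fun t => h t p) (fderiv ℝ H (t, p) (1, 0)) t := by
    intro t ht p
    have h1 : HasDerivAt (fun t : ℝ => (t, p)) ((1 : ℝ), (0 : ℝ × ℝ)) t :=
      (hasDerivAt_id t).prodMk (hasDerivAt_const t p)
    exact (hdiff (t, p) ⟨ht, trivial⟩).hasFDerivAt.comp_hasDerivAt t h1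
  have hcont : ContinuousOn (fun q => fderiv ℝ H q (1, 0)) U :=
    (hh.continuousOn_fderiv_of_isOpen hUo le_rfl).clm_apply continuousOn_const
  have hcomp : IsCompact (I ×ˢ K) := isCompact_Icc.prod hK
  have hsub : I ×ˢ K ⊆ U := Set.prod_mono hIsub (Set.subset_univ _)
  obtain ⟨C, hC⟩ := hcomp.exists_bound_of_continuousOn (hcont.mono hsub)
  obtain ⟨C₀, hC₀⟩ := hcomp.exists_bound_of_continuousOn (hh.continuousOn.mono hsub)
  have h0 : (0 : ℝ) ∈ Set.Ioo (-ε) ε := ⟨by linarith, hε⟩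
  have hslice : ∀ t ∈ Set.Ioo (-ε) ε, Continuous (h t) := fun t ht =>
    hh.continuousOn.comp_continuous (f := fun p : ℝ × ℝ => (t, p)) (by fun_prop)
      fun p => ⟨ht, trivial⟩
  have hslice' : Continuous fun p : ℝ × ℝ => fderiv ℝ H (0, p) (1, 0) :=
    hcont.comp_continuous (f := fun p : ℝ × ℝ => ((0 : ℝ), p)) (by fun_prop)
      fun p => ⟨h0, trivial⟩
  -- Periodicity carries the bound from `K` to all its translates.
  have hbound : ∀ p ∈ K + (Λ : Set (ℝ × ℝ)), ∀ t ∈ I, ‖fderiv ℝ H (t, p) (1, 0)‖ ≤ C := by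
    rintro _ ⟨k, hk, l, hl, rfl⟩ t ht
    have h1 := hd t (hIsub ht) k
    have h2 : HasDerivAt (fun t => h t k) (fderiv ℝ H (t, k + l) (1, 0)) t := by
      refine (hd t (hIsub ht) (k + l)).congr_of_eventuallyEq ?_
      filter_upwards [isOpen_Ioo.mem_nhds (hIsub ht)] with s hs
      exact (hper s hs l hl k).symm
    dsimp only
    rw [h2.unique h1]
    exact hC (t, k) ⟨ht, hk⟩
  have hbound₀ : ∀ p ∈ K + (Λ : Set (ℝ × ℝ)), ‖h 0 p‖ ≤ C₀ := by
    rintro _ ⟨k, hk, l, hl, rfl⟩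
    dsimp only
    rw [hper 0 h0 l hl k]
    exact hC₀ (0, k) ⟨⟨by linarith, by linarith⟩, hk⟩
  set S := D ∩ (K + (Λ : Set (ℝ × ℝ))) with hS
  have : IsFiniteMeasure (volume.restrict S) :=
    isFiniteMeasure_restrict.2 (measure_domain_inter_lt_top hK hD).ne
  have hSmeas : ∀ᵐ p ∂(volume.restrict S), p ∈ K + (Λ : Set (ℝ × ℝ)) := by
    exact ae_mono (Measure.restrict_mono Set.inter_subset_right le_rfl)
      (ae_restrict_mem (measurableSet_add_lattice hK))
  have hh'' : ∀ p, h' p = fderiv ℝ H (0, p) (1, 0) := fun p => (hh' p).unique (hd 0 h0 p)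
  rw [show h' = fun p => fderiv ℝ H (0, p) (1, 0) from funext hh'']
  refine (hasDerivAt_integral_of_dominated_loc_of_deriv_le (μ := volume.restrict S)
    (F := h) (F' := fun t p => fderiv ℝ H (t, p) (1, 0)) (bound := fun _ => C)
    (s := I) (Icc_mem_nhds (by linarith) (by linarith)) ?_ ?_ hslice'.aestronglyMeasurable ?_
    (integrable_const C) ?_).2
  · filter_upwards [isOpen_Ioo.mem_nhds h0] with t ht
    exact (hslice t ht).aestronglyMeasurable
  · refine Integrable.of_bound (hslice 0 h0).aestronglyMeasurable C₀ ?_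
    filter_upwards [hSmeas] with p hp using hbound₀ p hp
  · filter_upwards [hSmeas] with p hp t ht using hbound p hp t ht
  · exact Filter.Eventually.of_forall fun p t ht => hd t (hIsub ht) p

/-- A translate of `D` is again a fundamental domain, and the integral of a periodic function does
not depend on the choice of domain. -/
lemma setIntegral_translate [Countable Λ] {D : Set (ℝ × ℝ)}
    (hD : IsAddFundamentalDomain Λ D volume) {X : ℝ × ℝ → ℝ}
    (hper : ∀ l ∈ Λ, ∀ p, X (p + l) = X p) (v : ℝ × ℝ) :
    ∫ p in D, X (p + v) = ∫ p in D, X p := by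
  have h1 : IsAddFundamentalDomain Λ (v +ᵥ D) volume := hD.vadd_of_comm v
  have h2 : ∫ p in D, X p = ∫ p in v +ᵥ D, X p :=
    hD.setIntegral_eq h1 fun l p => by
      change X (l + p) = X p
      rw [add_comm]; exact hper l l.2 p
  rw [h2]
  have h3 := (measurePreserving_add_right (volume : Measure (ℝ × ℝ)) v).setIntegral_preimage_emb
    (measurableEmbedding_addRight v) X (v +ᵥ D)
  rw [← h3]
  congr 2
  ext p
  simp [Set.mem_vadd_set, add_comm]

/-- The integral of a partial derivative of a periodic function vanishes. -/
lemma setIntegral_fderiv_eq_zero [Countable Λ] {K D : Set (ℝ × ℝ)} (hK : IsCompact K)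
    (hD : IsAddFundamentalDomain Λ D volume) {X : ℝ × ℝ → ℝ} (hX : ContDiff ℝ 1 X)
    (hper : ∀ l ∈ Λ, ∀ p, X (p + l) = X p)
    (hsupp : ∀ p ∉ K + (Λ : Set (ℝ × ℝ)), X p = 0)
    (hclosed : IsClosed (K + (Λ : Set (ℝ × ℝ)))) (v : ℝ × ℝ) :
    ∫ p in D ∩ (K + (Λ : Set (ℝ × ℝ))), fderiv ℝ X p v = 0 := by
  -- For `|t| ≤ 1`, every translate `X(· + t v)` is supported in `K' + Λ`.
  set K' : Set (ℝ × ℝ) := (fun q : ℝ × (ℝ × ℝ) => q.2 - q.1 • v) '' (Set.Icc (-1) 1 ×ˢ K) with hK'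
  have hKc : IsCompact K' := (isCompact_Icc.prod hK).image (by fun_prop)
  have hKK : K + (Λ : Set (ℝ × ℝ)) ⊆ K' + (Λ : Set (ℝ × ℝ)) :=
    Set.add_subset_add_right fun k hk => ⟨(0, k), ⟨by norm_num, hk⟩, by simp⟩
  have hd : ∀ p, HasDerivAt (fun t : ℝ => X (p + t • v)) (fderiv ℝ X p v) 0 := by
    intro p
    have h1 : HasDerivAt (fun t : ℝ => p + t • v) v 0 := by
      simpa using ((hasDerivAt_id (0 : ℝ)).smul_const v).const_add p
    have h2 : HasFDerivAt X (fderiv ℝ X p) (p + (0 : ℝ) • v) := by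
      rw [zero_smul, add_zero]
      exact (hX.differentiable (by simp) p).hasFDerivAt
    exact h2.comp_hasDerivAt 0 h1
  -- The integral of `X(· + t v)` is constant for small `t` by translation invariance, while its
  -- derivative at `0` is the integral in question. This replaces the divergence theorem, so the
  -- boundary of `D` plays no role.
  have h1 := hasDerivAt_integral_periodic hKc hD one_pos (h := fun t p => X (p + t • v))
    (ContDiff.contDiffOn (hX.comp (by fun_prop)))
    (fun t _ l hl p => by rw [add_right_comm, hper l hl]) hd
  have hDm : ∀ {S : Set (ℝ × ℝ)} {Y : ℝ × ℝ → ℝ}, (∀ p ∉ S, Y p = 0) →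
      ∫ p in D ∩ S, Y p = ∫ p in D, Y p := by
    intro S Y hY
    exact (setIntegral_eq_of_subset_of_ae_sdiff_eq_zero hD.nullMeasurableSet
      Set.inter_subset_left
      (Filter.Eventually.of_forall fun p hp => hY p fun hS => hp.2 ⟨hp.1, hS⟩)).symm
  have hfd : ∀ p ∉ K + (Λ : Set (ℝ × ℝ)), fderiv ℝ X p v = 0 := by
    intro p hp
    have : X =ᶠ[nhds p] fun _ => 0 := by
      filter_upwards [hclosed.isOpen_compl.mem_nhds hp] with q hq using hsupp q hq
    rw [this.fderiv_eq]; simp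
  rw [hDm fun p hp => hfd p fun h => hp (hKK h)] at h1
  rw [hDm hfd]
  refine h1.unique ((hasDerivAt_const (0 : ℝ) (∫ p in D, X p)).congr_of_eventuallyEq ?_)
  filter_upwards [Icc_mem_nhds (show (-1 : ℝ) < 0 by norm_num) (show (0 : ℝ) < 1 by norm_num)]
    with t ht
  rw [hDm, setIntegral_translate hD hper]
  intro p hp
  refine hsupp _ fun ⟨k, hk, l, hl, hkl⟩ => hp ⟨k - t • v, ⟨(t, k), ⟨ht, hk⟩, rfl⟩, l, hl, ?_⟩
  dsimp only at hkl ⊢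
  rw [sub_add_eq_add_sub, hkl, add_sub_cancel_right]

end Integral

/-! ### First variation -/

section Smooth

variable {W G : Type*} [NormedAddCommGroup W] [NormedSpace ℝ W]
  [NormedAddCommGroup G] [NormedSpace ℝ G] {f : W → G} {U : Set W}

lemma contDiffOn_fderiv_apply (hU : IsOpen U) (hf : ContDiffOn ℝ ∞ f U) (e : W) :
    ContDiffOn ℝ ∞ (fun q => fderiv ℝ f q e) U :=
  (hf.fderiv_of_isOpen hU (m := ∞) (by simp)).clm_apply contDiffOn_const

lemma differentiableAt_of_mem (hU : IsOpen U) (hf : ContDiffOn ℝ ∞ f U) {q : W} (hq : q ∈ U) :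
    DifferentiableAt ℝ f q :=
  (hf.differentiableOn (by simp)).differentiableAt (hU.mem_nhds hq)

lemma fderiv_eq_zero_of_eqOn {f : W → ℝ} {c : ℝ} (hU : IsOpen U) (h : ∀ q ∈ U, f q = c) {q : W}
    (hq : q ∈ U) (e : W) : fderiv ℝ f q e = 0 := by
  have : f =ᶠ[nhds q] fun _ => c := by
    filter_upwards [hU.mem_nhds hq] with r hr using h r hr
  rw [this.fderiv_eq]; simp

end Smooth

lemma fderiv_slice {G : Type*} [NormedAddCommGroup G] [NormedSpace ℝ G]
    {f : ℝ × (ℝ × ℝ) → G} {t : ℝ} {p : ℝ × ℝ} (hf : DifferentiableAt ℝ f (t, p)) (w : ℝ × ℝ) :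
    fderiv ℝ (fun p => f (t, p)) p w = fderiv ℝ f (t, p) (0, w) := by
  have h1 : HasFDerivAt (fun p : ℝ × ℝ => (t, p)) (ContinuousLinearMap.inr ℝ ℝ (ℝ × ℝ)) p :=
    hasFDerivAt_prodMk_right t p
  have h2 : HasFDerivAt (fun p => f (t, p)) _ p := hf.hasFDerivAt.comp p h1
  rw [h2.fderiv]; rfl

lemma hasDerivAt_slice {G : Type*} [NormedAddCommGroup G] [NormedSpace ℝ G]
    {f : ℝ × (ℝ × ℝ) → G} {t : ℝ} {p : ℝ × ℝ} (hf : DifferentiableAt ℝ f (t, p)) :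
    HasDerivAt (fun t => f (t, p)) (fderiv ℝ f (t, p) (1, 0)) t :=
  hf.hasFDerivAt.comp_hasDerivAt t ((hasDerivAt_id t).prodMk (hasDerivAt_const t p))

lemma fderiv_add_period {G : Type*} [NormedAddCommGroup G] [NormedSpace ℝ G] {f : ℝ × ℝ → G}
    {l : ℝ × ℝ} (h : ∀ p, f (p + l) = f p) (p : ℝ × ℝ) : fderiv ℝ f (p + l) = fderiv ℝ f p := by
  rw [← fderiv_comp_add_right, show (fun x => f (x + l)) = f from funext h]

/-- The first order data of a Legendrian variation: the variation field `V`, and the variation `ψ` of the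
Legendrian angle. -/
structure IsFirstVariation (Λ : AddSubgroup (ℝ × ℝ)) (K : Set (ℝ × ℝ)) (F : ℝ × ℝ → E)
    (Φ : ℝ → ℝ × ℝ → E) (V : ℝ × ℝ → E) (ψ : ℝ × ℝ → ℝ) : Prop where
  smooth : ContDiff ℝ ∞ V
  smooth_angle : ContDiff ℝ ∞ ψ
  periodic : ∀ l ∈ Λ, ∀ p, V (p + l) = V p
  periodic_angle : ∀ l ∈ Λ, ∀ p, ψ (p + l) = ψ p
  support : ∀ p ∉ K + (Λ : Set (ℝ × ℝ)), V p = 0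
  support_angle : ∀ p ∉ K + (Λ : Set (ℝ × ℝ)), ψ p = 0
  position : ∀ p, rinner (V p) (F p) = 0
  reeb : ∀ p w, fderiv ℝ (fun q => rinner (V q) (Complex.I • F q)) p w =
    2 * rinner (V p) (Complex.I • fderiv ℝ F p w)
  metric : ∀ p v w, HasDerivAt (fun t => metric (Φ t) p v w)
    (fderiv ℝ (fun q => rinner (V q) (fderiv ℝ F q w)) p v +
      fderiv ℝ (fun q => rinner (V q) (fderiv ℝ F q v)) p w -
      2 * rinner (V p) (fderiv ℝ (fun q => fderiv ℝ F q w) p v)) 0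
  angle : ∀ p w, HasDerivAt (fun t => angleForm (Φ t) p w) (fderiv ℝ ψ p w) 0

/-- The density `(κ |H|² + 1) dμ`. -/
def scaledDensity (κ : ℝ) (F : ℝ × ℝ → E) (p : ℝ × ℝ) : ℝ :=
  (κ * ‖meanCurv F p‖ ^ 2 + 1) * areaDensity F p

/-- Only the metric and `dθ` appear, so the first variation never differentiates the second
fundamental form in time. -/
lemma IsLegendrianImmersion.scaledDensity_eq {F : ℝ × ℝ → E} (hF : IsLegendrianImmersion F)
    (κ : ℝ) (p : ℝ × ℝ) : scaledDensity κ F p =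
      √(CsL.metric F p (1, 0) (1, 0) * CsL.metric F p (0, 1) (0, 1) -
        CsL.metric F p (1, 0) (0, 1) ^ 2) +
      κ * (CsL.metric F p (0, 1) (0, 1) * angleForm F p (1, 0) ^ 2 -
        2 * CsL.metric F p (1, 0) (0, 1) * angleForm F p (1, 0) * angleForm F p (0, 1) +
        CsL.metric F p (1, 0) (1, 0) * angleForm F p (0, 1) ^ 2) /
      √(CsL.metric F p (1, 0) (1, 0) * CsL.metric F p (0, 1) (0, 1) -
        CsL.metric F p (1, 0) (0, 1) ^ 2) := by
  have hd := gram_det_pos (hF.immersion p)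
  rw [← hF.norm_meanCurv_sq, ← gram_det, scaledDensity, areaDensity]
  have hs := Real.sq_sqrt hd.le
  have hs0 := Real.sqrt_pos.2 hd
  field_simp
  rw [hs]
  ring

namespace IsLegendrianVariation

variable {Λ : AddSubgroup (ℝ × ℝ)} {F : ℝ × ℝ → E} {ε : ℝ} {K : Set (ℝ × ℝ)} {Φ : ℝ → ℝ × ℝ → E}

/-- The complex determinant of the frame of `Φ t`, as a function of all variables. -/
def detFun (Φ : ℝ → ℝ × ℝ → E) (q : ℝ × (ℝ × ℝ)) : ℂ :=
  det3 (Φ q.1 q.2) (fderiv ℝ (fun q : ℝ × (ℝ × ℝ) => Φ q.1 q.2) q (0, (1, 0)))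
    (fderiv ℝ (fun q : ℝ × (ℝ × ℝ) => Φ q.1 q.2) q (0, (0, 1)))

variable (h : IsLegendrianVariation Λ F ε K Φ)
include h

omit h in
lemma isOpen_domain (ε : ℝ) : IsOpen (Set.Ioo (-ε) ε ×ˢ (Set.univ : Set (ℝ × ℝ))) :=
  isOpen_Ioo.prod isOpen_univ

lemma differentiableAt {q : ℝ × (ℝ × ℝ)} (hq : q ∈ Set.Ioo (-ε) ε ×ˢ (Set.univ : Set (ℝ × ℝ))) :
    DifferentiableAt ℝ (fun q : ℝ × (ℝ × ℝ) => Φ q.1 q.2) q :=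
  differentiableAt_of_mem (isOpen_domain ε) h.smooth hq

lemma fderiv_eq {t : ℝ} (ht : t ∈ Set.Ioo (-ε) ε) (p w : ℝ × ℝ) :
    fderiv ℝ (Φ t) p w = fderiv ℝ (fun q : ℝ × (ℝ × ℝ) => Φ q.1 q.2) (t, p) (0, w) :=
  fderiv_slice (h.differentiableAt ⟨ht, trivial⟩) w

lemma metric_eq {t : ℝ} (ht : t ∈ Set.Ioo (-ε) ε) (p v w : ℝ × ℝ) :
    CsL.metric (Φ t) p v w = rinner (fderiv ℝ (fun q : ℝ × (ℝ × ℝ) => Φ q.1 q.2) (t, p) (0, v))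
      (fderiv ℝ (fun q : ℝ × (ℝ × ℝ) => Φ q.1 q.2) (t, p) (0, w)) := by
  rw [CsL.metric, h.fderiv_eq ht, h.fderiv_eq ht]

lemma frameDet_eq {t : ℝ} (ht : t ∈ Set.Ioo (-ε) ε) (p : ℝ × ℝ) :
    frameDet (Φ t) p = detFun Φ (t, p) := by
  rw [frameDet, h.fderiv_eq ht, h.fderiv_eq ht, detFun]

lemma smooth_detFun : ContDiffOn ℝ ∞ (detFun Φ) (Set.Ioo (-ε) ε ×ˢ Set.univ) :=
  contDiffOn_det3 h.smooth (contDiffOn_fderiv_apply (isOpen_domain ε) h.smooth _)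
    (contDiffOn_fderiv_apply (isOpen_domain ε) h.smooth _)

lemma detFun_ne_zero {q : ℝ × (ℝ × ℝ)} (hq : q ∈ Set.Ioo (-ε) ε ×ˢ (Set.univ : Set (ℝ × ℝ))) :
    detFun Φ q ≠ 0 := by
  rw [show q = (q.1, q.2) from rfl, ← h.frameDet_eq hq.1]
  exact ((h.legendrian q.1 hq.1).frame q.2).frameDet_ne_zero

lemma angleForm_eq {t : ℝ} (ht : t ∈ Set.Ioo (-ε) ε) (p w : ℝ × ℝ) :
    angleForm (Φ t) p w = (fderiv ℝ (detFun Φ) (t, p) (0, w) / detFun Φ (t, p)).im := by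
  have h1 : frameDet (Φ t) = fun p => detFun Φ (t, p) := funext fun p => h.frameDet_eq ht p
  rw [angleForm, h1, fderiv_slice (differentiableAt_of_mem (isOpen_domain ε) h.smooth_detFun
    ⟨ht, trivial⟩)]

lemma smooth_logDeriv (e : ℝ × (ℝ × ℝ)) :
    ContDiffOn ℝ ∞ (fun q => (fderiv ℝ (detFun Φ) q e / detFun Φ q).im)
      (Set.Ioo (-ε) ε ×ˢ Set.univ) :=
  Complex.imCLM.contDiff.comp_contDiffOn
    (((contDiffOn_fderiv_apply (isOpen_domain ε) h.smooth_detFun e).mul (h.smooth_detFun.inv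
      fun _ hq => h.detFun_ne_zero hq)).congr fun _ _ => div_eq_mul_inv _ _)

/-- The logarithmic derivative of the determinant is closed. -/
lemma fderiv_logDeriv_comm {q : ℝ × (ℝ × ℝ)}
    (hq : q ∈ Set.Ioo (-ε) ε ×ˢ (Set.univ : Set (ℝ × ℝ))) (e e' : ℝ × (ℝ × ℝ)) :
    fderiv ℝ (fun q => (fderiv ℝ (detFun Φ) q e / detFun Φ q).im) q e' =
      fderiv ℝ (fun q => (fderiv ℝ (detFun Φ) q e' / detFun Φ q).im) q e := by
  have hU := isOpen_domain ε
  have hd := differentiableAt_of_mem hU h.smooth_detFun hq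
  have key : ∀ e e', fderiv ℝ (fun q => (fderiv ℝ (detFun Φ) q e / detFun Φ q).im) q e' =
      ((detFun Φ q * fderiv ℝ (fun q => fderiv ℝ (detFun Φ) q e) q e' -
        fderiv ℝ (detFun Φ) q e * fderiv ℝ (detFun Φ) q e') / detFun Φ q ^ 2).im := by
    intro e e'
    have h1 := differentiableAt_of_mem hU (contDiffOn_fderiv_apply hU h.smooth_detFun e) hq
    have hne := h.detFun_ne_zero hq
    have h2 := ((hasDerivAt_inv hne).hasFDerivAt.restrictScalars ℝ).comp q hd.hasFDerivAt
    have h3 := Complex.imCLM.hasFDerivAt.comp q (h1.hasFDerivAt.mul h2)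
    have h4 : HasFDerivAt (fun q => (fderiv ℝ (detFun Φ) q e / detFun Φ q).im) _ q := h3
    rw [h4.fderiv]
    simp only [ContinuousLinearMap.comp_apply, Complex.imCLM_apply]
    congr 1
    simp
    field_simp
    ring
  rw [key, key, fderiv_fderiv_comm (h.smooth_detFun.contDiffAt (hU.mem_nhds hq)) e' e,
    mul_comm (fderiv ℝ (detFun Φ) q e)]

omit h in
lemma contDiff_slice {G : Type*} [NormedAddCommGroup G] [NormedSpace ℝ G] (hε : 0 < ε)
    {f : ℝ × (ℝ × ℝ) → G} (hf : ContDiffOn ℝ ∞ f (Set.Ioo (-ε) ε ×ˢ Set.univ)) :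
    ContDiff ℝ ∞ (fun p : ℝ × ℝ => f (0, p)) := by
  rw [← contDiffOn_univ]
  exact hf.comp (s := Set.univ) (g := f) (f := fun p : ℝ × ℝ => ((0 : ℝ), p)) (by fun_prop)
    fun p _ => ⟨⟨by simpa using hε, hε⟩, trivial⟩

/-- The variation field of a Legendrian variation. -/
lemma isFirstVariation (hε : 0 < ε) (hK : IsClosed (K + (Λ : Set (ℝ × ℝ)))) :
    IsFirstVariation Λ K F Φ
      (fun p => fderiv ℝ (fun q : ℝ × (ℝ × ℝ) => Φ q.1 q.2) (0, p) (1, 0))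
      (fun p => (fderiv ℝ (detFun Φ) (0, p) (1, 0) / detFun Φ (0, p)).im) := by
  set Ψ : ℝ × (ℝ × ℝ) → E := fun q => Φ q.1 q.2 with hΨ
  have hU := isOpen_domain ε
  have h0 : (0 : ℝ) ∈ Set.Ioo (-ε) ε := ⟨by simpa using hε, hε⟩
  have hmem : ∀ {t}, t ∈ Set.Ioo (-ε) ε → ∀ p, (t, p) ∈ Set.Ioo (-ε) ε ×ˢ (Set.univ : Set (ℝ × ℝ)) :=
    fun ht p => ⟨ht, trivial⟩
  have hsm := fun e => contDiffOn_fderiv_apply hU h.smooth e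
  have hd := fun q hq => h.differentiableAt (q := q) hq
  have hd2 := fun e q hq => differentiableAt_of_mem hU (hsm e) (q := q) hq
  have hcomm := fun q hq e e' => fderiv_fderiv_comm (h.smooth.contDiffAt (hU.mem_nhds hq)) (q := q) e e'
  have hF : ∀ p w, fderiv ℝ F p w = fderiv ℝ Ψ (0, p) (0, w) := fun p w => by
    rw [← h.start]; exact h.fderiv_eq h0 p w
  have hstart : ∀ p, F p = Ψ (0, p) := fun p => by rw [← h.start]
  have hev : ∀ᶠ t in nhds (0 : ℝ), t ∈ Set.Ioo (-ε) ε := isOpen_Ioo.mem_nhds h0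
  refine ⟨contDiff_slice hε (hsm _), contDiff_slice hε (h.smooth_logDeriv _), ?_, ?_, ?_, ?_, ?_,
    ?_, ?_, ?_⟩
  · intro l hl p
    have h1 := hasDerivAt_slice (hd _ (hmem h0 p))
    have h2 := hasDerivAt_slice (hd _ (hmem h0 (p + l)))
    refine (h2.congr_of_eventuallyEq ?_).unique h1
    filter_upwards [hev] with t ht using (h.periodic t ht l hl p).symm
  · intro l hl p
    have hD : ∀ t ∈ Set.Ioo (-ε) ε, detFun Φ (t, p + l) = detFun Φ (t, p) := fun t ht => by
      have := h.periodic t ht l hl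
      rw [← h.frameDet_eq ht, ← h.frameDet_eq ht, frameDet, fderiv_add_period this, this, frameDet]
    have h1 := hasDerivAt_slice (differentiableAt_of_mem hU h.smooth_detFun (hmem h0 p))
    have h2 := hasDerivAt_slice (differentiableAt_of_mem hU h.smooth_detFun (hmem h0 (p + l)))
    have h3 := (h2.congr_of_eventuallyEq (f₁ := fun t => detFun Φ (t, p)) (by
      filter_upwards [hev] with t ht using (hD t ht).symm)).unique h1
    rw [h3, hD 0 h0]
  · intro p hp
    refine (hasDerivAt_slice (hd _ (hmem h0 p))).unique
      ((hasDerivAt_const (0 : ℝ) (F p)).congr_of_eventuallyEq ?_)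
    filter_upwards [hev] with t ht using h.support t ht p hp
  · intro p hp
    have h1 : fderiv ℝ (detFun Φ) (0, p) (1, 0) = 0 := by
      refine (hasDerivAt_slice (differentiableAt_of_mem hU h.smooth_detFun (hmem h0 p))).unique
        ((hasDerivAt_const (0 : ℝ) (frameDet F p)).congr_of_eventuallyEq ?_)
      filter_upwards [hev] with t ht
      -- The determinant contains derivatives, so agreement is needed near `p`; this is where
      -- closedness of `K + Λ` enters.
      have h2 : Φ t =ᶠ[nhds p] F := by
        filter_upwards [hK.isOpen_compl.mem_nhds hp] with q hq using h.support t ht q hq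
      rw [← h.frameDet_eq ht, frameDet, h2.fderiv_eq, h2.eq_of_nhds, frameDet]
    rw [h1]; simp
  · intro p
    have h1 := fderiv_eq_zero_of_eqOn hU (f := fun q => rinner (Ψ q) (Ψ q)) (c := 1)
      (fun q hq => (h.legendrian q.1 hq.1).rinner_self_eq q.2) (hmem h0 p) (1, 0)
    rw [fderiv_rinner (hd _ (hmem h0 p)) (hd _ (hmem h0 p)), rinner_comm (Ψ (0, p))] at h1
    rw [hstart]
    linarith
  · intro p w
    -- The contact condition differentiated in time gives `⟨iF, ∂_w V⟩ = ⟨V, i ∂_w F⟩`, so the two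
    -- terms of the product rule are equal; hence the factor 2.
    have h1 := fderiv_eq_zero_of_eqOn hU
      (f := fun q => rinner (Complex.I • Ψ q) (fderiv ℝ Ψ q (0, w))) (c := 0)
      (fun q hq => by
        have := (h.legendrian q.1 hq.1).rinner_reeb q.2 w
        rwa [h.fderiv_eq hq.1] at this) (hmem h0 p) (1, 0)
    rw [fderiv_rinner (differentiableAt_I_smul (hd _ (hmem h0 p))) (hd2 _ _ (hmem h0 p)),
      fderiv_I_smul (hd _ (hmem h0 p)), hcomm _ (hmem h0 p)] at h1
    have h2 := (hd2 (1, 0) _ (hmem h0 p))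
    have h3 := differentiableAt_I_smul (hd _ (hmem h0 p))
    have h4 := differentiableAt_of_mem hU (contDiffOn_rinner (hsm (1, 0))
      (h.smooth.const_smul Complex.I : ContDiffOn ℝ ∞ (fun q => Complex.I • Ψ q) _)) (hmem h0 p)
    simp only [hstart, hF]
    rw [fderiv_slice h4, fderiv_rinner h2 h3, fderiv_I_smul (hd _ (hmem h0 p)),
      rinner_comm _ (Complex.I • Ψ (0, p))]
    rw [rinner_I_right (fderiv ℝ Ψ (0, p) (1, 0))]
    linarith
  · intro p v w
    have h1 : ∀ w, DifferentiableAt ℝ (fun q => rinner (fderiv ℝ Ψ q (1, 0)) (fderiv ℝ Ψ q (0, w)))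
        (0, p) := fun w =>
      differentiableAt_of_mem hU (contDiffOn_rinner (hsm (1, 0)) (hsm (0, w))) (hmem h0 p)
    have h2 := hasDerivAt_slice (differentiableAt_of_mem hU
      (contDiffOn_rinner (hsm (0, v)) (hsm (0, w))) (hmem h0 p))
    have h3 : ∀ w, DifferentiableAt ℝ (fun q => fderiv ℝ Ψ q (0, w)) (0, p) :=
      fun w => hd2 _ _ (hmem h0 p)
    refine (h2.congr_of_eventuallyEq (by
      filter_upwards [hev] with t ht using h.metric_eq ht p v w)).congr_deriv ?_
    simp only [hF]
    rw [fderiv_slice (h1 w), fderiv_slice (h1 v), fderiv_slice (h3 w),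
      fderiv_rinner (h3 v) (h3 w), fderiv_rinner (hd2 _ _ (hmem h0 p)) (h3 w),
      fderiv_rinner (hd2 _ _ (hmem h0 p)) (h3 v), hcomm _ (hmem h0 p) (1, 0) (0, v),
      hcomm _ (hmem h0 p) (1, 0) (0, w), hcomm _ (hmem h0 p) (0, w) (0, v),
      rinner_comm (fderiv ℝ Ψ (0, p) (0, v))]
    ring
  · intro p w
    have h1 := hasDerivAt_slice (differentiableAt_of_mem hU (h.smooth_logDeriv (0, w)) (hmem h0 p))
    refine (h1.congr_of_eventuallyEq (by
      filter_upwards [hev] with t ht using h.angleForm_eq ht p w)).congr_deriv ?_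
    -- Closedness of `Im d log det` exchanges the time derivative of `dθ` for the space derivative
    -- of `ψ`.
    rw [fderiv_slice (f := fun q => (fderiv ℝ (detFun Φ) q (1, 0) / detFun Φ q).im)
      (differentiableAt_of_mem hU (h.smooth_logDeriv (1, 0)) (hmem h0 p)),
      h.fderiv_logDeriv_comm (hmem h0 p)]

lemma contDiffOn_scaledDensity (κ : ℝ) :
    ContDiffOn ℝ 1 (fun q : ℝ × (ℝ × ℝ) => scaledDensity κ (Φ q.1) q.2)
      (Set.Ioo (-ε) ε ×ˢ Set.univ) := by
  have hU := isOpen_domain ε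
  have hm : ∀ v w, ContDiffOn ℝ ∞ (fun q : ℝ × (ℝ × ℝ) => CsL.metric (Φ q.1) q.2 v w)
      (Set.Ioo (-ε) ε ×ˢ Set.univ) := fun v w =>
    (contDiffOn_rinner (contDiffOn_fderiv_apply hU h.smooth (0, v))
      (contDiffOn_fderiv_apply hU h.smooth (0, w))).congr fun q hq => h.metric_eq hq.1 q.2 v w
  have ha : ∀ w, ContDiffOn ℝ ∞ (fun q : ℝ × (ℝ × ℝ) => angleForm (Φ q.1) q.2 w)
      (Set.Ioo (-ε) ε ×ˢ Set.univ) := fun w =>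
    (h.smooth_logDeriv (0, w)).congr fun q hq => h.angleForm_eq hq.1 q.2 w
  have hpos : ∀ q ∈ Set.Ioo (-ε) ε ×ˢ (Set.univ : Set (ℝ × ℝ)),
      0 < CsL.metric (Φ q.1) q.2 (1, 0) (1, 0) * CsL.metric (Φ q.1) q.2 (0, 1) (0, 1) -
        CsL.metric (Φ q.1) q.2 (1, 0) (0, 1) ^ 2 := fun q hq => by
    rw [← gram_det]; exact gram_det_pos ((h.legendrian q.1 hq.1).immersion q.2)
  have hs := (((hm (1, 0) (1, 0)).mul (hm (0, 1) (0, 1))).sub ((hm (1, 0) (0, 1)).pow 2)).sqrt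
    fun q hq => (hpos q hq).ne'
  have hN := (((hm (0, 1) (0, 1)).mul ((ha (1, 0)).pow 2)).sub
    (((contDiffOn_const (c := (2 : ℝ))).mul (hm (1, 0) (0, 1))).mul (ha (1, 0)) |>.mul
      (ha (0, 1)))).add ((hm (1, 0) (1, 0)).mul ((ha (0, 1)).pow 2))
  exact ((hs.add (((contDiffOn_const (c := κ)).mul hN).div hs
    fun q hq => (Real.sqrt_pos.2 (hpos q hq)).ne')).congr fun q hq =>
    (h.legendrian q.1 hq.1).scaledDensity_eq κ q.2).of_le (by norm_cast)

end IsLegendrianVariation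

/-! ### Criticality of surfaces with one-variable coefficients -/

lemma HasCoords.I_smul {F : ℝ × ℝ → E} {p : ℝ × ℝ} {v : E} {x₀ y₀ : ℝ} {x y : ℝ × ℝ}
    (h : HasCoords F p v x₀ y₀ x y) : HasCoords F p (Complex.I • v) (-y₀) x₀ (-y) x := by
  rw [HasCoords, h]
  simp only [smul_add, I_smul_real_smul, I_smul_I_smul, map_neg, smul_neg, neg_smul]
  abel

/-- Multiplication by `i` turns normal coordinates into tangential ones up to sign, and `tanCoord`
recovers the latter. -/
lemma HasCoords.normal_unique {F : ℝ × ℝ → E} {p : ℝ × ℝ} {v : E} {x₀ y₀ x₀' y₀' : ℝ}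
    {x y x' y' : ℝ × ℝ} (h : HasCoords F p v x₀ y₀ x y) (h' : HasCoords F p v x₀' y₀' x' y')
    (hF : IsLegendrianFrame F p) : y = y' := by
  have h1 := h.I_smul.tanCoord hF
  rw [h'.I_smul.tanCoord hF] at h1
  exact (neg_injective h1).symm

/-- A Legendrian immersion with diagonal metric `diag(E₁(x), E₂(x))`, second fundamental form depending
on the first variable only, and Legendrian angle `m x + k y`. -/
structure HasDiagonalCoords (F : ℝ × ℝ → E) (E₁ E₂ E₁' E₂' : ℝ → ℝ) (b₁₁ b₁₂ b₂₂ : ℝ → ℝ × ℝ)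
    (m k : ℝ) : Prop where
  legendrian : IsLegendrianImmersion F
  smooth_E₁ : ContDiff ℝ ∞ E₁
  smooth_E₂ : ContDiff ℝ ∞ E₂
  smooth_b₁₁ : ContDiff ℝ ∞ b₁₁
  smooth_b₁₂ : ContDiff ℝ ∞ b₁₂
  smooth_b₂₂ : ContDiff ℝ ∞ b₂₂
  metric₁₁ : ∀ p, metric F p (1, 0) (1, 0) = E₁ p.1
  metric₁₂ : ∀ p, metric F p (1, 0) (0, 1) = 0
  metric₂₂ : ∀ p, metric F p (0, 1) (0, 1) = E₂ p.1
  coords₁₁ : ∀ p, HasCoords F p (fderiv ℝ (fun q => fderiv ℝ F q (1, 0)) p (1, 0))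
    (-E₁ p.1) 0 (E₁' p.1 / (2 * E₁ p.1), 0) (b₁₁ p.1)
  coords₁₂ : ∀ p, HasCoords F p (fderiv ℝ (fun q => fderiv ℝ F q (0, 1)) p (1, 0))
    0 0 (0, E₂' p.1 / (2 * E₂ p.1)) (b₁₂ p.1)
  coords₂₂ : ∀ p, HasCoords F p (fderiv ℝ (fun q => fderiv ℝ F q (0, 1)) p (0, 1))
    (-E₂ p.1) 0 (-E₂' p.1 / (2 * E₁ p.1), 0) (b₂₂ p.1)
  angle₁ : ∀ x, (b₁₁ x).1 + (b₁₂ x).2 = m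
  angle₂ : ∀ x, (b₁₂ x).1 + (b₂₂ x).2 = k

namespace HasDiagonalCoords

variable {F : ℝ × ℝ → E} {E₁ E₂ E₁' E₂' : ℝ → ℝ} {b₁₁ b₁₂ b₂₂ : ℝ → ℝ × ℝ} {m k : ℝ}
  (h : HasDiagonalCoords F E₁ E₂ E₁' E₂' b₁₁ b₁₂ b₂₂ m k)
include h

lemma coords₂₁ (p : ℝ × ℝ) : HasCoords F p (fderiv ℝ (fun q => fderiv ℝ F q (1, 0)) p (0, 1))
    0 0 (0, E₂' p.1 / (2 * E₂ p.1)) (b₁₂ p.1) := by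
  rw [fderiv_fderiv_comm h.legendrian.smooth.contDiffAt]; exact h.coords₁₂ p

lemma E₁_pos (x : ℝ) : 0 < E₁ x := by
  rw [← h.metric₁₁ (x, 0)]; exact metric_self_pos (h.legendrian.immersion _) (by simp)

lemma E₂_pos (x : ℝ) : 0 < E₂ x := by
  rw [← h.metric₂₂ (x, 0)]; exact metric_self_pos (h.legendrian.immersion _) (by simp)

lemma gram_eq (p : ℝ × ℝ) : gram F p = !![E₁ p.1, 0; 0, E₂ p.1] := by
  rw [CsL.gram_eq, h.metric₁₁, h.metric₁₂, h.metric₂₂]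

lemma gram_inv (p : ℝ × ℝ) : (gram F p)⁻¹ = !![1 / E₁ p.1, 0; 0, 1 / E₂ p.1] := by
  have h1 := (h.E₁_pos p.1).ne'
  have h2 := (h.E₂_pos p.1).ne'
  rw [CsL.gram_inv, gram_det, h.metric₁₁, h.metric₁₂, h.metric₂₂]
  ext i j
  fin_cases i <;> fin_cases j <;> simp <;> field_simp

lemma metric_apply (p v w : ℝ × ℝ) :
    CsL.metric F p v w = v.1 * w.1 * E₁ p.1 + v.2 * w.2 * E₂ p.1 := by
  rw [CsL.metric_apply, h.metric₁₁, h.metric₁₂, h.metric₂₂]; ring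

lemma meanCurv_eq (p : ℝ × ℝ) : meanCurv F p = Complex.I • fderiv ℝ F p
    ((1 / E₁ p.1) • b₁₁ p.1 + (1 / E₂ p.1) • b₂₂ p.1) := by
  rw [IsLegendrianImmersion.meanCurv_eq (h.legendrian.frame p)
    (x₀ := ![![_, _], ![_, _]]) (x := ![![_, _], ![_, _]])
    (y := ![![b₁₁ p.1, b₁₂ p.1], ![b₁₂ p.1, b₂₂ p.1]]) (by
      intro i j
      fin_cases i <;> fin_cases j
      exacts [h.coords₁₁ p, h.coords₁₂ p, h.coords₂₁ p, h.coords₂₂ p]), h.gram_inv]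
  simp [Fin.sum_univ_two]

lemma angleForm₁ (p : ℝ × ℝ) : angleForm F p (1, 0) = m := by
  rw [h.legendrian.angleForm_eq (h.coords₁₁ p) (h.coords₁₂ p), h.angle₁]

lemma angleForm₂ (p : ℝ × ℝ) : angleForm F p (0, 1) = k := by
  rw [h.legendrian.angleForm_eq (h.coords₂₁ p) (h.coords₂₂ p), h.angle₂]

section Periodic

variable {l : ℝ × ℝ} (hl : ∀ p, F (p + l) = F p)
include hl

lemma E₁_periodic (p : ℝ × ℝ) : E₁ (p + l).1 = E₁ p.1 := by
  rw [← h.metric₁₁, ← h.metric₁₁, CsL.metric, fderiv_add_period hl, CsL.metric]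

lemma E₂_periodic (p : ℝ × ℝ) : E₂ (p + l).1 = E₂ p.1 := by
  rw [← h.metric₂₂, ← h.metric₂₂, CsL.metric, fderiv_add_period hl, CsL.metric]

omit h in
lemma hasCoords_periodic {p : ℝ × ℝ} {v w : ℝ × ℝ} {x₀ y₀ : ℝ} {x y : ℝ × ℝ}
    (hc : HasCoords F (p + l) (fderiv ℝ (fun q => fderiv ℝ F q w) (p + l) v) x₀ y₀ x y) :
    HasCoords F p (fderiv ℝ (fun q => fderiv ℝ F q w) p v) x₀ y₀ x y := by
  rw [HasCoords, fderiv_add_period (f := fun q => fderiv ℝ F q w)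
    (fun p => by rw [fderiv_add_period hl]), hl, fderiv_add_period hl] at hc
  exact hc

/-- A period may move `x`, and the coefficient functions are not assumed periodic; they inherit
periodicity from `F` by uniqueness of coordinates. -/
lemma b_periodic (p : ℝ × ℝ) : b₁₁ (p + l).1 = b₁₁ p.1 ∧ b₁₂ (p + l).1 = b₁₂ p.1 ∧
    b₂₂ (p + l).1 = b₂₂ p.1 :=
  ⟨(hasCoords_periodic hl (h.coords₁₁ (p + l))).normal_unique (h.coords₁₁ p) (h.legendrian.frame p),
    (hasCoords_periodic hl (h.coords₁₂ (p + l))).normal_unique (h.coords₁₂ p) (h.legendrian.frame p),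
    (hasCoords_periodic hl (h.coords₂₂ (p + l))).normal_unique (h.coords₂₂ p) (h.legendrian.frame p)⟩

end Periodic

/-- The derivative of the density in terms of the derivatives of the metric and of the angle. -/
lemma hasDerivAt_scaledDensity (κ : ℝ) {Φ : ℝ → ℝ × ℝ → E} {ε : ℝ} (hε : 0 < ε) (hΦ0 : Φ 0 = F)
    (hΦ : ∀ t ∈ Set.Ioo (-ε) ε, IsLegendrianImmersion (Φ t)) {p : ℝ × ℝ} {α β γ θ₁ θ₂ : ℝ}
    (hα : HasDerivAt (fun t => CsL.metric (Φ t) p (1, 0) (1, 0)) α 0)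
    (hβ : HasDerivAt (fun t => CsL.metric (Φ t) p (1, 0) (0, 1)) β 0)
    (hγ : HasDerivAt (fun t => CsL.metric (Φ t) p (0, 1) (0, 1)) γ 0)
    (hθ₁ : HasDerivAt (fun t => angleForm (Φ t) p (1, 0)) θ₁ 0)
    (hθ₂ : HasDerivAt (fun t => angleForm (Φ t) p (0, 1)) θ₂ 0) {s : ℝ}
    (hs : s = √(E₁ p.1 * E₂ p.1)) :
    HasDerivAt (fun t => scaledDensity κ (Φ t) p)
      ((E₂ p.1 / (2 * s) + κ * (k ^ 2 / (2 * s) - E₂ p.1 * m ^ 2 / (2 * s * E₁ p.1))) * α +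
        -2 * κ * m * k / s * β +
        (E₁ p.1 / (2 * s) + κ * (m ^ 2 / (2 * s) - E₁ p.1 * k ^ 2 / (2 * s * E₂ p.1))) * γ +
        2 * κ * (E₂ p.1 * m / s * θ₁ + E₁ p.1 * k / s * θ₂)) 0 := by
  have hE₁ := h.E₁_pos p.1
  have hE₂ := h.E₂_pos p.1
  have hss : s ^ 2 = E₁ p.1 * E₂ p.1 := by rw [hs]; exact Real.sq_sqrt (by positivity)
  have hs0 : 0 < s := by rw [hs]; positivity
  have e₁ : CsL.metric (Φ 0) p (1, 0) (1, 0) = E₁ p.1 := by rw [hΦ0, h.metric₁₁]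
  have e₂ : CsL.metric (Φ 0) p (1, 0) (0, 1) = 0 := by rw [hΦ0, h.metric₁₂]
  have e₃ : CsL.metric (Φ 0) p (0, 1) (0, 1) = E₂ p.1 := by rw [hΦ0, h.metric₂₂]
  have e₄ : angleForm (Φ 0) p (1, 0) = m := by rw [hΦ0, h.angleForm₁]
  have e₅ : angleForm (Φ 0) p (0, 1) = k := by rw [hΦ0, h.angleForm₂]
  have e₀ : CsL.metric (Φ 0) p (1, 0) (1, 0) * CsL.metric (Φ 0) p (0, 1) (0, 1) -
      CsL.metric (Φ 0) p (1, 0) (0, 1) ^ 2 = E₁ p.1 * E₂ p.1 := by rw [e₁, e₂, e₃]; ring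
  have hS := ((hα.fun_mul hγ).fun_sub (hβ.fun_pow 2)).sqrt (by rw [e₀]; positivity)
  have hN := ((hγ.fun_mul (hθ₁.fun_pow 2)).fun_sub
    (((hβ.const_mul 2).fun_mul hθ₁).fun_mul hθ₂)).fun_add (hα.fun_mul (hθ₂.fun_pow 2))
  have hT := hS.fun_add ((hN.const_mul κ).fun_div hS (by rw [e₀]; positivity))
  refine (hT.congr_of_eventuallyEq ?_).congr_deriv ?_
  · filter_upwards [isOpen_Ioo.mem_nhds (show (0 : ℝ) ∈ Set.Ioo (-ε) ε from
      ⟨by linarith, hε⟩)] with t ht using (hΦ t ht).scaledDensity_eq κ p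
  · rw [e₀, ← hs, e₁, e₂, e₃, e₄, e₅]
    push_cast
    generalize E₁ p.1 = a at *
    generalize E₂ p.1 = b at *
    -- Eliminating `E₂` through `s² = E₁E₂` leaves a rational identity.
    have hb : b = s ^ 2 / a := by rw [hss]; field_simp
    subst hb
    field_simp
    ring

end HasDiagonalCoords

lemma fderiv_coeff_mul {g : ℝ → ℝ} {g' : ℝ} {f : ℝ × ℝ → ℝ} {p : ℝ × ℝ}
    (hg : HasDerivAt g g' p.1) (hf : DifferentiableAt ℝ f p) (w : ℝ × ℝ) :
    fderiv ℝ (fun p => g p.1 * f p) p w = g p.1 * fderiv ℝ f p w + w.1 * g' * f p := by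
  have h1 : HasFDerivAt (fun p : ℝ × ℝ => g p.1) (g' • ContinuousLinearMap.fst ℝ ℝ ℝ) p :=
    hg.comp_hasFDerivAt p hasFDerivAt_fst
  have h2 : HasFDerivAt (fun p => g p.1 * f p) _ p := h1.mul hf.hasFDerivAt
  rw [h2.fderiv]
  simp
  ring

/-- `V ⊥ F` removes the position term, and `reeb` turns the normal term into derivatives of `f`. As
the Reeb coordinate of `v` is zero, `f` itself does not occur. -/
lemma IsFirstVariation.two_mul_rinner {Λ : AddSubgroup (ℝ × ℝ)} {K : Set (ℝ × ℝ)}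
    {F : ℝ × ℝ → E} {Φ : ℝ → ℝ × ℝ → E} {V : ℝ × ℝ → E} {ψ : ℝ × ℝ → ℝ} (hV : IsFirstVariation Λ K F Φ V ψ) {p : ℝ × ℝ} {v : E}
    {x₀ : ℝ} {x y : ℝ × ℝ} (hv : HasCoords F p v x₀ 0 x y) :
    2 * rinner (V p) v = 2 * (x.1 * rinner (V p) (fderiv ℝ F p (1, 0)) +
      x.2 * rinner (V p) (fderiv ℝ F p (0, 1))) +
      (y.1 * fderiv ℝ (fun q => rinner (V q) (Complex.I • F q)) p (1, 0) +
        y.2 * fderiv ℝ (fun q => rinner (V q) (Complex.I • F q)) p (0, 1)) := by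
  rw [hv, hV.reeb, hV.reeb, clm_apply_eq _ x, clm_apply_eq _ y]
  simp only [rinner_add_right, rinner_smul_right, smul_add, I_smul_real_smul, hV.position]
  ring

namespace HasDiagonalCoords

variable {F : ℝ × ℝ → E} {E₁ E₂ E₁' E₂' : ℝ → ℝ} {b₁₁ b₁₂ b₂₂ : ℝ → ℝ × ℝ} {m k : ℝ}
  (h : HasDiagonalCoords F E₁ E₂ E₁' E₂' b₁₁ b₁₂ b₂₂ m k)
include h

/-- A conservation law criterion for the criticality of `∫ (κ |H|² + 1) dμ`. -/
theorem isLegendrianCritical {Λ : AddSubgroup (ℝ × ℝ)} (hΛ : DiscreteTopology Λ)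
    (hper : IsPeriodic Λ F) (κ : ℝ) {s A B C : ℝ → ℝ} {μ ν : ℝ}
    (hs : ∀ x, s x = √(E₁ x * E₂ x))
    (hA : ∀ x, A x = E₂ x / (2 * s x) +
      κ * (k ^ 2 / (2 * s x) - E₂ x * m ^ 2 / (2 * s x * E₁ x)))
    (hB : ∀ x, B x = -2 * κ * m * k / s x)
    (hC : ∀ x, C x = E₁ x / (2 * s x) +
      κ * (m ^ 2 / (2 * s x) - E₁ x * k ^ 2 / (2 * s x * E₂ x)))
    (hA' : ∀ x, HasDerivAt A ((C x * E₂' x - A x * E₁' x) / (2 * E₁ x)) x)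
    (hB' : ∀ x, HasDerivAt B (-(B x * E₂' x) / E₂ x) x)
    (hν : ∀ x, E₂ x * m / s x = ν)
    (hμ : ∀ x, A x * (b₁₁ x).1 + B x * (b₁₂ x).1 + C x * (b₂₂ x).1 = μ) :
    IsLegendrianCritical (scaledDensity κ) Λ F := by
  intro ε K D Φ hε hK hD hΦ
  have hcount := countable_of_discrete hΛ
  have hcl := isClosed_add_lattice hΛ hK
  have hV := hΦ.isFirstVariation hε hcl
  generalize (fun p => fderiv ℝ (fun q : ℝ × (ℝ × ℝ) => Φ q.1 q.2) (0, p) (1, 0)) = V at hV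
  generalize (fun p => (fderiv ℝ (IsLegendrianVariation.detFun Φ) (0, p) (1, 0) /
    IsLegendrianVariation.detFun Φ (0, p)).im) = ψ at hV
  have hE₁ := h.E₁_pos
  have hE₂ := h.E₂_pos
  have hs0 : ∀ x, 0 < s x := fun x => by
    rw [hs]; exact Real.sqrt_pos.2 (mul_pos (hE₁ x) (hE₂ x))
  have sE₁ := h.smooth_E₁
  have sE₂ := h.smooth_E₂
  have ss : ContDiff ℝ ∞ s := by
    rw [show s = fun x => √(E₁ x * E₂ x) from funext hs]
    exact (sE₁.mul sE₂).sqrt fun x => (mul_pos (hE₁ x) (hE₂ x)).ne'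
  have sinv : ContDiff ℝ ∞ fun x => (2 * s x)⁻¹ :=
    (contDiff_const.mul ss).inv fun x => (mul_pos two_pos (hs0 x)).ne'
  have sinv₁ : ContDiff ℝ ∞ fun x => (E₁ x)⁻¹ := sE₁.inv fun x => (hE₁ x).ne'
  have sinv₂ : ContDiff ℝ ∞ fun x => (E₂ x)⁻¹ := sE₂.inv fun x => (hE₂ x).ne'
  have sA : ContDiff ℝ ∞ A := by
    rw [show A = fun x => E₂ x * (2 * s x)⁻¹ +
      κ * (k ^ 2 * (2 * s x)⁻¹ - m ^ 2 * (E₂ x * (2 * s x)⁻¹ * (E₁ x)⁻¹)) from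
      funext fun x => by rw [hA, mul_inv]; field_simp]
    fun_prop
  have sB : ContDiff ℝ ∞ B := by
    rw [show B = fun x => -4 * κ * m * k * (2 * s x)⁻¹ from
      funext fun x => by rw [hB]; field_simp; ring]
    fun_prop
  have sC : ContDiff ℝ ∞ C := by
    rw [show C = fun x => E₁ x * (2 * s x)⁻¹ +
      κ * (m ^ 2 * (2 * s x)⁻¹ - k ^ 2 * (E₁ x * (2 * s x)⁻¹ * (E₂ x)⁻¹)) from
      funext fun x => by rw [hC, mul_inv]; field_simp]
    fun_prop
  -- This coefficient multiplies `∂₂f`, so it may depend on `x`; the one multiplying `∂₁f` has to be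
  -- the constant `μ`. The same holds for `η` and `ν` with `ψ` in place of `f`.
  set β : ℝ → ℝ := fun x => A x * (b₁₁ x).2 + B x * (b₁₂ x).2 + C x * (b₂₂ x).2 with hβ
  have sβ : ContDiff ℝ ∞ β :=
    ((sA.mul h.smooth_b₁₁.snd).add (sB.mul h.smooth_b₁₂.snd)).add (sC.mul h.smooth_b₂₂.snd)
  set η : ℝ → ℝ := fun x => 2 * κ * (E₁ x * k / s x) with hη
  have sη : ContDiff ℝ ∞ η := by
    rw [show η = fun x => 4 * κ * (E₁ x * k * (2 * s x)⁻¹) from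
      funext fun x => by simp only [hη]; field_simp; ring]
    fun_prop
  set f : ℝ × ℝ → ℝ := fun q => rinner (V q) (Complex.I • F q) with hf
  set ξ₁ : ℝ × ℝ → ℝ := fun q => rinner (V q) (fderiv ℝ F q (1, 0)) with hξ₁
  set ξ₂ : ℝ × ℝ → ℝ := fun q => rinner (V q) (fderiv ℝ F q (0, 1)) with hξ₂
  have sF := h.legendrian.smooth
  have sf : ContDiff ℝ ∞ f := contDiff_rinner hV.smooth (sF.const_smul Complex.I)
  have sξ₁ : ContDiff ℝ ∞ ξ₁ := contDiff_rinner hV.smooth (contDiff_fderiv_apply sF _)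
  have sξ₂ : ContDiff ℝ ∞ ξ₂ := contDiff_rinner hV.smooth (contDiff_fderiv_apply sF _)
  have sψ := hV.smooth_angle
  -- The current whose divergence is the varied density: the stress tensor applied to the tangential
  -- part of `V`, then the normal part through `f` and the angle part through `ψ`.
  set X₁ : ℝ × ℝ → ℝ := fun p => 2 * (A p.1 * ξ₁ p) + B p.1 * ξ₂ p - μ * f p + 2 * κ * ν * ψ p
    with hX₁
  set X₂ : ℝ × ℝ → ℝ := fun p => B p.1 * ξ₁ p + 2 * (C p.1 * ξ₂ p) - β p.1 * f p + η p.1 * ψ p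
    with hX₂
  have sX₁ : ContDiff ℝ ∞ X₁ := by fun_prop
  have sX₂ : ContDiff ℝ ∞ X₂ := by fun_prop
  have perV : ∀ l ∈ Λ, ∀ p, ξ₁ (p + l) = ξ₁ p ∧ ξ₂ (p + l) = ξ₂ p ∧ f (p + l) = f p ∧
      ψ (p + l) = ψ p := fun l hl p => by
    simp only [hξ₁, hξ₂, hf, hV.periodic l hl, fderiv_add_period (hper l hl), hper l hl,
      hV.periodic_angle l hl, and_self]
  have perE : ∀ l ∈ Λ, ∀ p, s (p + l).1 = s p.1 ∧ A (p + l).1 = A p.1 ∧ B (p + l).1 = B p.1 ∧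
      C (p + l).1 = C p.1 := fun l hl p => by
    simp only [hA, hB, hC, hs, h.E₁_periodic (hper l hl), h.E₂_periodic (hper l hl), and_self]
  have perX₁ : ∀ l ∈ Λ, ∀ p, X₁ (p + l) = X₁ p := fun l hl p => by
    obtain ⟨h1, h2, h3, h4⟩ := perV l hl p
    obtain ⟨h5, h6, h7, h8⟩ := perE l hl p
    simp only [hX₁, h1, h2, h3, h4, h6, h7]
  have perX₂ : ∀ l ∈ Λ, ∀ p, X₂ (p + l) = X₂ p := fun l hl p => by
    obtain ⟨h1, h2, h3, h4⟩ := perV l hl p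
    obtain ⟨h5, h6, h7, h8⟩ := perE l hl p
    obtain ⟨h9, h10, h11⟩ := h.b_periodic (hper l hl) p
    simp only [hX₂, hβ, hη, h1, h2, h3, h4, h5, h6, h7, h8, h9, h10, h11,
      h.E₁_periodic (hper l hl)]
  have hsupp : ∀ p ∉ K + (Λ : Set (ℝ × ℝ)), X₁ p = 0 ∧ X₂ p = 0 := fun p hp => by
    simp only [hX₁, hX₂, hξ₁, hξ₂, hf, hV.support p hp, hV.support_angle p hp, rinner_zero_left]
    simp
  have hderiv : ∀ p, HasDerivAt (fun t => scaledDensity κ (Φ t) p)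
      (fderiv ℝ X₁ p (1, 0) + fderiv ℝ X₂ p (0, 1)) 0 := by
    intro p
    refine (h.hasDerivAt_scaledDensity κ hε hΦ.start hΦ.legendrian (hV.metric p (1, 0) (1, 0))
      (hV.metric p (1, 0) (0, 1)) (hV.metric p (0, 1) (0, 1)) (hV.angle p (1, 0))
      (hV.angle p (0, 1)) (hs p.1)).congr_deriv ?_
    have dξ₁ : DifferentiableAt ℝ ξ₁ p := (sξ₁.differentiable (by simp)) p
    have dξ₂ : DifferentiableAt ℝ ξ₂ p := (sξ₂.differentiable (by simp)) p
    have df : DifferentiableAt ℝ f p := (sf.differentiable (by simp)) p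
    have dψ : DifferentiableAt ℝ ψ p := (sψ.differentiable (by simp)) p
    have dco : ∀ {g : ℝ → ℝ}, ContDiff ℝ ∞ g → HasDerivAt g (deriv g p.1) p.1 := fun hg =>
      ((hg.differentiable (by simp)) p.1).hasDerivAt
    have dm : ∀ {g : ℝ → ℝ} {u : ℝ × ℝ → ℝ}, ContDiff ℝ ∞ g → DifferentiableAt ℝ u p →
        DifferentiableAt ℝ (fun p => g p.1 * u p) p := fun hg hu =>
      (((hg.differentiable (by simp)) p.1).comp p differentiableAt_fst).mul hu
    have hd₁ : fderiv ℝ X₁ p (1, 0) = 2 * (A p.1 * fderiv ℝ ξ₁ p (1, 0) +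
        (C p.1 * E₂' p.1 - A p.1 * E₁' p.1) / (2 * E₁ p.1) * ξ₁ p) +
        (B p.1 * fderiv ℝ ξ₂ p (1, 0) + -(B p.1 * E₂' p.1) / E₂ p.1 * ξ₂ p) -
        μ * fderiv ℝ f p (1, 0) + 2 * κ * ν * fderiv ℝ ψ p (1, 0) := by
      have h1 : HasFDerivAt X₁ _ p := ((((dm sA dξ₁).hasFDerivAt.const_mul 2).fun_add
        (dm sB dξ₂).hasFDerivAt).fun_sub (df.hasFDerivAt.const_mul μ)).fun_add
        (dψ.hasFDerivAt.const_mul (2 * κ * ν))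
      rw [h1.fderiv]
      simp [fderiv_coeff_mul (hA' p.1) dξ₁, fderiv_coeff_mul (hB' p.1) dξ₂]
    have hd₂ : fderiv ℝ X₂ p (0, 1) = B p.1 * fderiv ℝ ξ₁ p (0, 1) +
        2 * (C p.1 * fderiv ℝ ξ₂ p (0, 1)) - β p.1 * fderiv ℝ f p (0, 1) +
        η p.1 * fderiv ℝ ψ p (0, 1) := by
      have h1 : HasFDerivAt X₂ _ p := (((dm sB dξ₁).hasFDerivAt.fun_add
        ((dm sC dξ₂).hasFDerivAt.const_mul 2)).fun_sub (dm sβ df).hasFDerivAt).fun_add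
        (dm sη dψ).hasFDerivAt
      rw [h1.fderiv]
      simp [fderiv_coeff_mul (dco sB) dξ₁, fderiv_coeff_mul (dco sC) dξ₂,
        fderiv_coeff_mul (dco sβ) df, fderiv_coeff_mul (dco sη) dψ]
    rw [hd₁, hd₂, hV.two_mul_rinner (h.coords₁₁ p), hV.two_mul_rinner (h.coords₁₂ p),
      hV.two_mul_rinner (h.coords₂₂ p), ← hA, ← hB, ← hC, ← hμ p.1, ← hν p.1]
    simp only [hβ, hη]
    have h1 := (hE₁ p.1).ne'
    have h2 := (hE₂ p.1).ne'
    change _ * (fderiv ℝ ξ₁ p (1, 0) + fderiv ℝ ξ₁ p (1, 0) -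
        (2 * (_ * ξ₁ p + _ * ξ₂ p) + (_ * fderiv ℝ f p (1, 0) + _ * fderiv ℝ f p (0, 1)))) +
      _ * (fderiv ℝ ξ₂ p (1, 0) + fderiv ℝ ξ₁ p (0, 1) -
        (2 * (_ * ξ₁ p + _ * ξ₂ p) + (_ * fderiv ℝ f p (1, 0) + _ * fderiv ℝ f p (0, 1)))) +
      _ * (fderiv ℝ ξ₂ p (0, 1) + fderiv ℝ ξ₂ p (0, 1) -
        (2 * (_ * ξ₁ p + _ * ξ₂ p) + (_ * fderiv ℝ f p (1, 0) + _ * fderiv ℝ f p (0, 1)))) +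
      _ = _
    field_simp
    ring
  have hint := hasDerivAt_integral_periodic hK hD hε (hΦ.contDiffOn_scaledDensity κ)
    (fun t ht l hl p => by
      have := hΦ.periodic t ht l hl
      rw [(hΦ.legendrian t ht).scaledDensity_eq, (hΦ.legendrian t ht).scaledDensity_eq]
      simp only [CsL.metric, angleForm, fderiv_add_period this]
      have hfd : ∀ p, frameDet (Φ t) (p + l) = frameDet (Φ t) p := fun p => by
        rw [frameDet, fderiv_add_period this, this, frameDet]
      rw [fderiv_add_period hfd, hfd]) hderiv
  have h1 := setIntegral_fderiv_eq_zero hK hD (sX₁.of_le (by norm_cast)) perX₁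
    (fun p hp => (hsupp p hp).1) hcl (1, 0)
  have h2 := setIntegral_fderiv_eq_zero hK hD (sX₂.of_le (by norm_cast)) perX₂
    (fun p hp => (hsupp p hp).2) hcl (0, 1)
  -- The integrands are bounded on `K`, hence on `K + Λ` by periodicity, and the region has finite
  -- measure.
  have hI : ∀ {X : ℝ × ℝ → ℝ} (w : ℝ × ℝ), ContDiff ℝ ∞ X →
      (∀ l ∈ Λ, ∀ p, X (p + l) = X p) →
      IntegrableOn (fun p => fderiv ℝ X p w) (D ∩ (K + (Λ : Set (ℝ × ℝ)))) := by
    intro X w sX perX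
    have hc : Continuous fun p => fderiv ℝ X p w := (contDiff_fderiv_apply sX w).continuous
    obtain ⟨c, hc'⟩ := hK.exists_bound_of_continuousOn hc.continuousOn
    refine IntegrableOn.of_bound (measure_domain_inter_lt_top hK hD) hc.aestronglyMeasurable c ?_
    refine ae_mono (Measure.restrict_mono Set.inter_subset_right le_rfl)
      ((ae_restrict_mem (measurableSet_add_lattice hK)).mono ?_)
    rintro _ ⟨q, hq, l, hl, rfl⟩
    dsimp only
    rw [fderiv_add_period (perX l hl)]
    exact hc' q hq
  rwa [integral_add (hI _ sX₁ perX₁) (hI _ sX₂ perX₂), h1, h2, add_zero] at hint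

end HasDiagonalCoords

lemma areaDensity_eq_scaledDensity : areaDensity = scaledDensity 0 := by
  ext F p; simp [scaledDensity]

lemma willmoreDensity_eq_scaledDensity : willmoreDensity = scaledDensity (1 / 4) := by
  ext F p; simp only [scaledDensity, willmoreDensity]; ring

/-! ### Geometry of surfaces with one-variable coefficients -/

section HasCoords

variable {F : ℝ × ℝ → E} {p : ℝ × ℝ} {v v' : E} {x₀ y₀ x₀' y₀' : ℝ} {x y x' y' : ℝ × ℝ}

lemma HasCoords.add (h : HasCoords F p v x₀ y₀ x y) (h' : HasCoords F p v' x₀' y₀' x' y') :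
    HasCoords F p (v + v') (x₀ + x₀') (y₀ + y₀') (x + x') (y + y') := by
  rw [HasCoords, h, h']
  simp only [map_add, smul_add, add_smul]
  abel

lemma HasCoords.smul (h : HasCoords F p v x₀ y₀ x y) (c : ℝ) :
    HasCoords F p (c • v) (c * x₀) (c * y₀) (c • x) (c • y) := by
  rw [HasCoords, h]
  simp only [map_smul, smul_add, mul_smul, I_smul_real_smul]

lemma hasCoords_tangent (F : ℝ × ℝ → E) (p w : ℝ × ℝ) :
    HasCoords F p (fderiv ℝ F p w) 0 0 w 0 := by
  simp [HasCoords]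

end HasCoords

lemma tanCoord_add (F : ℝ × ℝ → E) (p : ℝ × ℝ) (v w : E) :
    tanCoord F p (v + w) = tanCoord F p v + tanCoord F p w := by
  simp only [tanCoord_eq, rinner_add_left]
  ext <;> simp <;> ring

lemma tanCoord_smul (F : ℝ × ℝ → E) (p : ℝ × ℝ) (c : ℝ) (v : E) :
    tanCoord F p (c • v) = c • tanCoord F p v := by
  simp only [tanCoord_eq, rinner_smul_left]
  ext <;> simp <;> ring

lemma covDeriv_eq (F V : ℝ × ℝ → E) (p w : ℝ × ℝ) :
    covDeriv F V p w = w.1 • covDeriv F V p (1, 0) + w.2 • covDeriv F V p (0, 1) := by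
  rw [covDeriv, clm_apply_eq _ w, tanCoord_add, tanCoord_smul, tanCoord_smul, covDeriv, covDeriv]

lemma isParallel_iff (F V : ℝ × ℝ → E) :
    IsParallel F V ↔ ∀ p, covDeriv F V p (1, 0) = 0 ∧ covDeriv F V p (0, 1) = 0 :=
  ⟨fun h p => ⟨h p _, h p _⟩, fun h p w => by rw [covDeriv_eq, (h p).1, (h p).2]; simp⟩

namespace HasDiagonalCoords

variable {F : ℝ × ℝ → E} {E₁ E₂ E₁' E₂' : ℝ → ℝ} {b₁₁ b₁₂ b₂₂ : ℝ → ℝ × ℝ} {m k : ℝ}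
  (h : HasDiagonalCoords F E₁ E₂ E₁' E₂' b₁₁ b₁₂ b₂₂ m k)
include h

lemma JH_eq (p : ℝ × ℝ) : JH F p = Complex.I • meanCurv F p := by
  rw [JH, contactJ, h.meanCurv_eq, contactForm_eq, rinner_I_I, h.legendrian.rinner_tangent,
    zero_smul, sub_zero]

lemma divergence_eq (V : ℝ × ℝ → E) (p : ℝ × ℝ) :
    divergence F V p = (covDeriv F V p (1, 0)).1 + (covDeriv F V p (0, 1)).2 := by
  have h1 := (h.E₁_pos p.1).ne'
  have h2 := (h.E₂_pos p.1).ne'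
  simp only [divergence, Fin.sum_univ_two, h.gram_inv, h.metric_apply, coordVec]
  simp
  field_simp

lemma secondFF_eq (p v w : ℝ × ℝ) : secondFF F p v w = Complex.I • fderiv ℝ F p
    ((v.1 * w.1) • b₁₁ p.1 + (v.1 * w.2 + v.2 * w.1) • b₁₂ p.1 + (v.2 * w.2) • b₂₂ p.1) := by
  have hd : DifferentiableAt ℝ (fderiv ℝ F) p :=
    ((h.legendrian.smooth.fderiv_right (m := ∞) (by simp)).differentiable (by simp)) p
  have hc := ((((h.coords₁₁ p).smul w.1).add ((h.coords₁₂ p).smul w.2)).smul v.1).add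
    ((((h.coords₂₁ p).smul w.1).add ((h.coords₂₂ p).smul w.2)).smul v.2)
  have he : fderiv ℝ (fun q => fderiv ℝ F q w) p v = v.1 •
      (w.1 • fderiv ℝ (fun q => fderiv ℝ F q (1, 0)) p (1, 0) +
        w.2 • fderiv ℝ (fun q => fderiv ℝ F q (0, 1)) p (1, 0)) +
      v.2 • (w.1 • fderiv ℝ (fun q => fderiv ℝ F q (1, 0)) p (0, 1) +
        w.2 • fderiv ℝ (fun q => fderiv ℝ F q (0, 1)) p (0, 1)) := by
    simp only [fderiv_fderiv_apply hd]
    conv_lhs => rw [clm_apply_eq _ v, add_apply,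
      smul_apply, smul_apply,
      clm_apply_eq (fderiv ℝ (fderiv ℝ F) p (1, 0)) w,
      clm_apply_eq (fderiv ℝ (fderiv ℝ F) p (0, 1)) w]
  rw [secondFF, he, hc.normalPart (h.legendrian.frame p)]
  simp only [mul_zero, add_zero, zero_smul, zero_add]
  congr 2
  module

lemma fderiv_tangent_field {g₁ g₂ : ℝ → ℝ} {g₁' g₂' : ℝ} {p : ℝ × ℝ}
    (hg₁ : HasDerivAt g₁ g₁' p.1) (hg₂ : HasDerivAt g₂ g₂' p.1) (w : ℝ × ℝ) :
    fderiv ℝ (fun q => g₁ q.1 • fderiv ℝ F q (1, 0) + g₂ q.1 • fderiv ℝ F q (0, 1)) p w =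
      g₁ p.1 • fderiv ℝ (fun q => fderiv ℝ F q (1, 0)) p w +
        (w.1 * g₁') • fderiv ℝ F p (1, 0) +
      (g₂ p.1 • fderiv ℝ (fun q => fderiv ℝ F q (0, 1)) p w +
        (w.1 * g₂') • fderiv ℝ F p (0, 1)) := by
  have hs := h.legendrian.smooth
  have hc : ∀ {g : ℝ → ℝ} {g' : ℝ}, HasDerivAt g g' p.1 → HasFDerivAt (fun p : ℝ × ℝ => g p.1)
      (g' • ContinuousLinearMap.fst ℝ ℝ ℝ) p := fun hg => hg.comp_hasFDerivAt p hasFDerivAt_fst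
  have h1 := ((hc hg₁).fun_smul (differentiable_fderiv_apply hs (1, 0) p).hasFDerivAt).fun_add
    ((hc hg₂).fun_smul (differentiable_fderiv_apply hs (0, 1) p).hasFDerivAt)
  rw [h1.fderiv]
  simp [mul_comm]

/-- The tangential coordinates of the second derivatives of `F` are the Christoffel symbols of
`diag(E₁(x), E₂(x))`. -/
lemma covDeriv_tangent_field₁ {g₁ g₂ : ℝ → ℝ} {g₁' g₂' : ℝ} {p : ℝ × ℝ}
    (hg₁ : HasDerivAt g₁ g₁' p.1) (hg₂ : HasDerivAt g₂ g₂' p.1) :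
    covDeriv F (fun q => g₁ q.1 • fderiv ℝ F q (1, 0) + g₂ q.1 • fderiv ℝ F q (0, 1)) p (1, 0) =
      (g₁ p.1 * (E₁' p.1 / (2 * E₁ p.1)) + g₁', g₂ p.1 * (E₂' p.1 / (2 * E₂ p.1)) + g₂') := by
  rw [covDeriv, h.fderiv_tangent_field hg₁ hg₂,
    ((((h.coords₁₁ p).smul _).add ((hasCoords_tangent F p _).smul _)).add
      (((h.coords₁₂ p).smul _).add ((hasCoords_tangent F p _).smul _))).tanCoord
      (h.legendrian.frame p)]
  ext <;> simp

lemma covDeriv_tangent_field₂ {g₁ g₂ : ℝ → ℝ} {g₁' g₂' : ℝ} {p : ℝ × ℝ}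
    (hg₁ : HasDerivAt g₁ g₁' p.1) (hg₂ : HasDerivAt g₂ g₂' p.1) :
    covDeriv F (fun q => g₁ q.1 • fderiv ℝ F q (1, 0) + g₂ q.1 • fderiv ℝ F q (0, 1)) p (0, 1) =
      (g₂ p.1 * (-E₂' p.1 / (2 * E₁ p.1)), g₁ p.1 * (E₂' p.1 / (2 * E₂ p.1))) := by
  rw [covDeriv, h.fderiv_tangent_field hg₁ hg₂,
    ((((h.coords₂₁ p).smul _).add ((hasCoords_tangent F p _).smul _)).add
      (((h.coords₂₂ p).smul _).add ((hasCoords_tangent F p _).smul _))).tanCoord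
      (h.legendrian.frame p)]
  ext <;> simp

end HasDiagonalCoords

/-! ### Surfaces with a one-parameter group of diagonal symmetries -/

/-- The surface `(x, y) ↦ (r_j(x) exp(i σ_j y))_j`. -/
def orbitSurface (r : Fin 3 → ℝ → ℂ) (σ : Fin 3 → ℝ) (p : ℝ × ℝ) : E :=
  WithLp.toLp 2 fun j => r j p.1 * Complex.exp (Complex.I * (σ j * p.2 : ℝ))

namespace orbitSurface

variable {r r' r'' : Fin 3 → ℝ → ℂ} {σ : Fin 3 → ℝ}

lemma apply (p : ℝ × ℝ) (j : Fin 3) :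
    orbitSurface r σ p j = r j p.1 * Complex.exp (Complex.I * (σ j * p.2 : ℝ)) := rfl

lemma contDiff (hr : ∀ j, ContDiff ℝ ∞ (r j)) : ContDiff ℝ ∞ (orbitSurface r σ) := by
  refine (PiLp.contDiff_toLp (𝕜 := ℝ) (p := 2)).comp (contDiff_pi.2 fun j => ?_)
  have h1 : ContDiff ℝ ∞ fun p : ℝ × ℝ => Complex.exp (Complex.I * (σ j * p.2 : ℝ)) :=
    (contDiff_const.mul (Complex.ofRealCLM.contDiff.comp
      (contDiff_const.mul contDiff_snd))).cexp
  exact ((hr j).comp contDiff_fst).mul h1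

lemma hasFDerivAt (hr : ∀ j x, HasDerivAt (r j) (r' j x) x) (p : ℝ × ℝ) :
    ∃ L : ℝ × ℝ →L[ℝ] E, HasFDerivAt (orbitSurface r σ) L p ∧
      L (1, 0) = orbitSurface r' σ p ∧
      L (0, 1) = orbitSurface (fun j x => Complex.I * σ j * r j x) σ p := by
  have h1 : ∀ j, HasFDerivAt (fun p : ℝ × ℝ => r j p.1)
      ((ContinuousLinearMap.fst ℝ ℝ ℝ).smulRight (r' j p.1)) p := fun j =>
    (hr j p.1).hasFDerivAt.comp p hasFDerivAt_fst
  have h2 : ∀ j, HasDerivAt (fun y : ℝ => Complex.exp (Complex.I * (σ j * y : ℝ)))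
      (Complex.exp (Complex.I * (σ j * p.2 : ℝ)) * (Complex.I * (σ j * 1 : ℝ))) p.2 := fun j =>
    (((hasDerivAt_id p.2).const_mul (σ j)).ofReal_comp.const_mul Complex.I).cexp
  have h3 : ∀ j, HasFDerivAt (fun p : ℝ × ℝ => Complex.exp (Complex.I * (σ j * p.2 : ℝ)))
      ((ContinuousLinearMap.snd ℝ ℝ ℝ).smulRight
        (Complex.exp (Complex.I * (σ j * p.2 : ℝ)) * (Complex.I * (σ j * 1 : ℝ)))) p := fun j =>
    (h2 j).hasFDerivAt.comp p hasFDerivAt_snd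
  have h4 := fun j => (h1 j).mul (h3 j)
  have h5 := hasFDerivAt_pi.2 h4
  refine ⟨_, (PiLp.continuousLinearEquiv 2 ℝ fun _ : Fin 3 => ℂ).symm.hasFDerivAt.comp p h5, ?_, ?_⟩
  · ext j
    simp [apply, mul_comm]
  · ext j
    simp [apply]
    ring

lemma fderiv_fst (hr : ∀ j x, HasDerivAt (r j) (r' j x) x) (p : ℝ × ℝ) :
    fderiv ℝ (orbitSurface r σ) p (1, 0) = orbitSurface r' σ p := by
  obtain ⟨L, h1, h2, h3⟩ := hasFDerivAt (σ := σ) hr p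
  rw [h1.fderiv, h2]

lemma fderiv_snd (hr : ∀ j x, HasDerivAt (r j) (r' j x) x) (p : ℝ × ℝ) :
    fderiv ℝ (orbitSurface r σ) p (0, 1) =
      orbitSurface (fun j x => Complex.I * σ j * r j x) σ p := by
  obtain ⟨L, h1, h2, h3⟩ := hasFDerivAt (σ := σ) hr p
  rw [h1.fderiv, h3]

/-- The common phases have modulus one and cancel, so inner products depend on `x` alone. -/
lemma rinner_eq (p : ℝ × ℝ) : rinner (orbitSurface r σ p) (orbitSurface r' σ p) =
    ∑ j, ((r j p.1).re * (r' j p.1).re + (r j p.1).im * (r' j p.1).im) := by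
  rw [rinner_apply]
  refine Finset.sum_congr rfl fun j _ => ?_
  have h1 : (Complex.exp (Complex.I * (σ j * p.2 : ℝ))).re ^ 2 +
      (Complex.exp (Complex.I * (σ j * p.2 : ℝ))).im ^ 2 = 1 := by
    have h := Complex.normSq_eq_norm_sq (Complex.exp (Complex.I * (σ j * p.2 : ℝ)))
    rw [Complex.norm_exp_I_mul_ofReal, Complex.normSq_apply] at h
    linarith
  simp only [apply, Complex.mul_re, Complex.mul_im]
  linear_combination ((r j p.1).re * (r' j p.1).re + (r j p.1).im * (r' j p.1).im) * h1

lemma I_smul (p : ℝ × ℝ) :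
    Complex.I • orbitSurface r σ p = orbitSurface (fun j x => Complex.I * r j x) σ p := by
  ext j
  simp [apply, mul_assoc]

/-- The group `diag(exp(iσ_j y))` acts by unitary maps, so every condition need only be checked on
the profile curve, with `∂_y` acting on component `j` as `iσ_j`. The hypotheses `hc₁₁`, `hc₁₂`,
`hc₂₂` are the structure equations, component by component. -/
lemma hasDiagonalCoords (hr : ∀ j x, HasDerivAt (r j) (r' j x) x)
    (hr' : ∀ j x, HasDerivAt (r' j) (r'' j x) x) (hsm : ∀ j, ContDiff ℝ ∞ (r j))
    {E₁ E₂ E₁' E₂' : ℝ → ℝ} {b₁₁ b₁₂ b₂₂ : ℝ → ℝ × ℝ} {m k : ℝ}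
    (sE₁ : ContDiff ℝ ∞ E₁) (sE₂ : ContDiff ℝ ∞ E₂) (sb₁₁ : ContDiff ℝ ∞ b₁₁)
    (sb₁₂ : ContDiff ℝ ∞ b₁₂) (sb₂₂ : ContDiff ℝ ∞ b₂₂)
    (hE₁ : ∀ x, 0 < E₁ x) (hE₂ : ∀ x, 0 < E₂ x)
    (hsphere : ∀ x, ∑ j, Complex.normSq (r j x) = 1)
    (hreeb₁ : ∀ x, ∑ j, ((r j x).re * (r' j x).im - (r j x).im * (r' j x).re) = 0)
    (hreeb₂ : ∀ x, ∑ j, σ j * Complex.normSq (r j x) = 0)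
    (hm₁₁ : ∀ x, ∑ j, Complex.normSq (r' j x) = E₁ x)
    (hm₁₂ : ∀ x, ∑ j, σ j * ((r j x).re * (r' j x).im - (r j x).im * (r' j x).re) = 0)
    (hm₂₂ : ∀ x, ∑ j, σ j ^ 2 * Complex.normSq (r j x) = E₂ x)
    (hc₁₁ : ∀ j x, r'' j x = -E₁ x * r j x + E₁' x / (2 * E₁ x) * r' j x +
      Complex.I * (b₁₁ x).1 * r' j x - (b₁₁ x).2 * σ j * r j x)
    (hc₁₂ : ∀ j x, Complex.I * σ j * r' j x = E₂' x / (2 * E₂ x) * (Complex.I * σ j * r j x) +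
      Complex.I * (b₁₂ x).1 * r' j x - (b₁₂ x).2 * σ j * r j x)
    (hc₂₂ : ∀ j x, -σ j ^ 2 * r j x = -E₂ x * r j x - E₂' x / (2 * E₁ x) * r' j x +
      Complex.I * (b₂₂ x).1 * r' j x - (b₂₂ x).2 * σ j * r j x)
    (angle₁ : ∀ x, (b₁₁ x).1 + (b₁₂ x).2 = m) (angle₂ : ∀ x, (b₁₂ x).1 + (b₂₂ x).2 = k) :
    HasDiagonalCoords (orbitSurface r σ) E₁ E₂ E₁' E₂' b₁₁ b₁₂ b₂₂ m k := by
  have hs : ∀ j x, HasDerivAt (fun x => Complex.I * σ j * r j x) (Complex.I * σ j * r' j x) x :=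
    fun j x => (hr j x).const_mul _
  have m₁₁ : ∀ p, metric (orbitSurface r σ) p (1, 0) (1, 0) = E₁ p.1 := fun p => by
    rw [metric, fderiv_fst hr, rinner_eq, ← hm₁₁]; rfl
  have m₁₂ : ∀ p, metric (orbitSurface r σ) p (1, 0) (0, 1) = 0 := fun p => by
    rw [metric, fderiv_fst hr, fderiv_snd hr, rinner_eq, ← hm₁₂ p.1]
    exact Finset.sum_congr rfl fun j _ => by simp; ring
  have m₂₂ : ∀ p, metric (orbitSurface r σ) p (0, 1) (0, 1) = E₂ p.1 := fun p => by
    rw [metric, fderiv_snd hr, rinner_eq, ← hm₂₂ p.1]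
    exact Finset.sum_congr rfl fun j _ => by simp [Complex.normSq_apply]; ring
  have f₁ : (fun q => fderiv ℝ (orbitSurface r σ) q (1, 0)) = orbitSurface r' σ :=
    funext (fderiv_fst hr)
  have f₂ : (fun q => fderiv ℝ (orbitSurface r σ) q (0, 1)) =
      orbitSurface (fun j x => Complex.I * σ j * r j x) σ := funext (fderiv_snd hr)
  refine ⟨⟨contDiff hsm, fun p => ?_, fun p => ?_, fun p w => ?_⟩, sE₁, sE₂, sb₁₁, sb₁₂, sb₂₂,
    m₁₁, m₁₂, m₂₂, fun p => ?_, fun p => ?_, fun p => ?_, angle₁, angle₂⟩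
  · have h1 : ‖orbitSurface r σ p‖ ^ 2 = 1 := by
      rw [← rinner_self, rinner_eq, ← hsphere p.1]; rfl
    exact (pow_eq_one_iff_of_nonneg (norm_nonneg _) two_ne_zero).1 h1
  · rw [injective_iff_map_eq_zero]
    intro w hw
    have h1 : metric (orbitSurface r σ) p w w = 0 := by rw [metric, hw, rinner_zero_left]
    rw [metric_apply, m₁₁, m₁₂, m₂₂] at h1
    have h2 := hE₁ p.1
    have h3 := hE₂ p.1
    have h4 : w.1 = 0 := by
      by_contra h0
      have : 0 < w.1 * w.1 * E₁ p.1 := mul_pos (mul_self_pos.2 h0) h2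
      nlinarith [mul_nonneg (mul_self_nonneg w.2) h3.le]
    have h5 : w.2 = 0 := by
      by_contra h0
      have : 0 < w.2 * w.2 * E₂ p.1 := mul_pos (mul_self_pos.2 h0) h3
      nlinarith [mul_nonneg (mul_self_nonneg w.1) h2.le]
    exact Prod.ext h4 h5
  · rw [contactForm_eq, clm_apply_eq _ w, rinner_add_right, rinner_smul_right, rinner_smul_right,
      fderiv_fst hr, fderiv_snd hr, I_smul, rinner_eq, rinner_eq]
    have h1 := hreeb₁ p.1
    have h2 := hreeb₂ p.1
    simp [Fin.sum_univ_three, Complex.normSq_apply] at h1 h2 ⊢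
    linear_combination w.1 * h1 + w.2 * h2
  · rw [f₁, HasCoords, fderiv_fst hr', clm_apply_eq _ (_, (0 : ℝ)), clm_apply_eq _ (b₁₁ p.1),
      fderiv_fst hr, fderiv_snd hr]
    ext j
    have := hc₁₁ j p.1
    simp [apply]
    linear_combination Complex.exp (Complex.I * (σ j * p.2)) * this -
      Complex.exp (Complex.I * (σ j * p.2)) * (b₁₁ p.1).2 * σ j * r j p.1 * Complex.I_sq
  · rw [f₂, HasCoords, fderiv_fst hs, clm_apply_eq _ ((0 : ℝ), _), clm_apply_eq _ (b₁₂ p.1),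
      fderiv_fst hr, fderiv_snd hr]
    ext j
    have := hc₁₂ j p.1
    simp [apply]
    linear_combination Complex.exp (Complex.I * (σ j * p.2)) * this -
      Complex.exp (Complex.I * (σ j * p.2)) * (b₁₂ p.1).2 * σ j * r j p.1 * Complex.I_sq
  · rw [f₂, HasCoords, fderiv_snd hs, clm_apply_eq _ (_, (0 : ℝ)), clm_apply_eq _ (b₂₂ p.1),
      fderiv_fst hr, fderiv_snd hr]
    ext j
    have := hc₂₂ j p.1
    simp [apply]
    linear_combination Complex.exp (Complex.I * (σ j * p.2)) * this -
      Complex.exp (Complex.I * (σ j * p.2)) * ((b₂₂ p.1).2 * σ j * r j p.1 -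
        σ j ^ 2 * r j p.1) * Complex.I_sq

end orbitSurface

/-! ### Mironov's examples -/

lemma mironovU_eq (a b c x : ℝ) :
    mironovU a b c x = c * (a * Real.sin x ^ 2 + b * Real.cos x ^ 2) := by
  rw [mironovU, Real.cos_two_mul]
  linear_combination c * a * -Real.sin_sq_add_cos_sq x

/-- The derivative of `mironovU`. -/
def mironovU' (a b c x : ℝ) : ℝ := 2 * c * (a - b) * (Real.sin x * Real.cos x)

lemma hasDerivAt_mironovU (a b c x : ℝ) :
    HasDerivAt (mironovU a b c) (mironovU' a b c x) x := by
  rw [show mironovU a b c = fun x => c * (a * Real.sin x ^ 2 + b * Real.cos x ^ 2) from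
    funext (mironovU_eq a b c)]
  have h := ((((Real.hasDerivAt_sin x).fun_pow 2).const_mul a).fun_add
    (((Real.hasDerivAt_cos x).fun_pow 2).const_mul b)).const_mul c
  refine h.congr_deriv ?_
  rw [mironovU']; push_cast; ring

lemma contDiff_mironovU (a b c : ℝ) : ContDiff ℝ ∞ (mironovU a b c) := by
  rw [show mironovU a b c = fun x => c * (a * Real.sin x ^ 2 + b * Real.cos x ^ 2) from
    funext (mironovU_eq a b c)]
  have h1 : ContDiff ℝ ∞ Real.sin := Real.contDiff_sin
  have h2 : ContDiff ℝ ∞ Real.cos := Real.contDiff_cos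
  fun_prop

/-- The moduli of the components of Mironov's surface. -/
def mironovProfile (a b c : ℝ) : Fin 3 → ℝ → ℝ :=
  ![fun x => √(c / (a + c)) * Real.sin x, fun x => √(c / (b + c)) * Real.cos x,
    fun x => √((a * b + mironovU a b c x) / ((a + c) * (b + c)))]

/-- The derivative of `mironovProfile`. -/
def mironovProfile' (a b c : ℝ) : Fin 3 → ℝ → ℝ :=
  ![fun x => √(c / (a + c)) * Real.cos x, fun x => √(c / (b + c)) * -Real.sin x,
    fun x => mironovU' a b c x / (2 * ((a + c) * (b + c)) * mironovProfile a b c 2 x)]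

/-- The second derivative of `mironovProfile`. -/
def mironovProfile'' (a b c : ℝ) : Fin 3 → ℝ → ℝ :=
  ![fun x => √(c / (a + c)) * -Real.sin x, fun x => √(c / (b + c)) * -Real.cos x,
    fun x => (2 * c * (a - b) * (Real.cos x ^ 2 - Real.sin x ^ 2) *
        (2 * ((a + c) * (b + c)) * mironovProfile a b c 2 x) -
      mironovU' a b c x * (2 * ((a + c) * (b + c)) * mironovProfile' a b c 2 x)) /
      (2 * ((a + c) * (b + c)) * mironovProfile a b c 2 x) ^ 2]

lemma mironov_eq {a b c : ℝ} (ha : 0 < a) (hb : 0 < b) (hc : 0 < c) : mironov a b c =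
    orbitSurface (fun j x => (mironovProfile a b c j x : ℂ)) ![a, b, -c] := by
  ext p j
  -- `ζ²` is affine in `u`, so the derivatives of `ζ` can be expressed through those of `u`.
  have h1 : a * Real.sin p.1 ^ 2 / (a + c) + b * Real.cos p.1 ^ 2 / (b + c) =
      (a * b + mironovU a b c p.1) / ((a + c) * (b + c)) := by
    rw [mironovU_eq]
    field_simp
    linear_combination a * b * Real.sin_sq_add_cos_sq p.1
  fin_cases j
  · simp [mironov, orbitSurface.apply, mironovProfile]
  · simp [mironov, orbitSurface.apply, mironovProfile]
  · simp [mironov, orbitSurface.apply, mironovProfile, h1]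

section

variable {a b c : ℝ} (ha : 0 < a) (hb : 0 < b) (hc : 0 < c)
include ha hb hc

lemma mironovU_pos (x : ℝ) : 0 < mironovU a b c x := by
  rw [mironovU_eq]
  have h := Real.sin_sq_add_cos_sq x
  rcases eq_or_ne (Real.sin x) 0 with h0 | h0
  · have h1 : Real.cos x ^ 2 = 1 := by rw [h0] at h; linarith
    rw [h0, h1]; positivity
  · positivity

lemma mironovProfile_pos (x : ℝ) : 0 < mironovProfile a b c 2 x := by
  have := mironovU_pos ha hb hc x
  exact Real.sqrt_pos.2 (by positivity)

lemma mironovProfile_sq (x : ℝ) : (a + c) * (b + c) * mironovProfile a b c 2 x ^ 2 =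
    a * b + mironovU a b c x := by
  have := mironovU_pos ha hb hc x
  have h : mironovProfile a b c 2 x ^ 2 = (a * b + mironovU a b c x) / ((a + c) * (b + c)) :=
    Real.sq_sqrt (by positivity)
  rw [h]; field_simp

lemma hasDerivAt_mironovProfile (j : Fin 3) (x : ℝ) :
    HasDerivAt (mironovProfile a b c j) (mironovProfile' a b c j x) x := by
  fin_cases j
  · exact (Real.hasDerivAt_sin x).const_mul _
  · exact (Real.hasDerivAt_cos x).const_mul _
  · have hp := mironovU_pos ha hb hc x
    have h := (((hasDerivAt_mironovU a b c x).const_add (a * b)).div_const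
      ((a + c) * (b + c))).sqrt (by positivity)
    refine h.congr_deriv ?_
    simp only [mironovProfile', mironovProfile]
    change _ = mironovU' a b c x / (2 * ((a + c) * (b + c)) *
      √((a * b + mironovU a b c x) / ((a + c) * (b + c))))
    have : 0 < √((a * b + mironovU a b c x) / ((a + c) * (b + c))) :=
      Real.sqrt_pos.2 (by positivity)
    field_simp

lemma hasDerivAt_mironovProfile' (j : Fin 3) (x : ℝ) :
    HasDerivAt (mironovProfile' a b c j) (mironovProfile'' a b c j x) x := by
  fin_cases j
  · exact (Real.hasDerivAt_cos x).const_mul _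
  · exact (Real.hasDerivAt_sin x).neg.const_mul _
  · have hp := mironovProfile_pos ha hb hc x
    have h1 : HasDerivAt (mironovU' a b c)
        (2 * c * (a - b) * (Real.cos x ^ 2 - Real.sin x ^ 2)) x :=
      (((Real.hasDerivAt_sin x).fun_mul (Real.hasDerivAt_cos x)).const_mul
        (2 * c * (a - b))).congr_deriv (by ring)
    exact h1.fun_div ((hasDerivAt_mironovProfile ha hb hc 2 x).const_mul _) (by positivity)

lemma contDiff_mironovProfile (j : Fin 3) : ContDiff ℝ ∞ (mironovProfile a b c j) := by
  fin_cases j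
  · exact contDiff_const.mul Real.contDiff_sin
  · exact contDiff_const.mul Real.contDiff_cos
  · exact (((contDiff_const (c := a * b)).add (contDiff_mironovU a b c)).div_const _).sqrt
      fun x => by have := mironovU_pos ha hb hc x; positivity

/-- The algebraic relations between the values of the profile functions at a point. -/
lemma mironov_relations (x : ℝ) : ∃ f g S C z : ℝ, S ^ 2 + C ^ 2 = 1 ∧ f ^ 2 * (a + c) = c ∧
    g ^ 2 * (b + c) = c ∧ (a + c) * (b + c) * z ^ 2 = a * b + mironovU a b c x ∧ 0 < z ∧
    mironovU a b c x = c * (a * S ^ 2 + b * C ^ 2) ∧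
    mironovU' a b c x = 2 * c * (a - b) * (S * C) ∧
    (∀ j, mironovProfile a b c j x = ![f * S, g * C, z] j) ∧
    (∀ j, mironovProfile' a b c j x =
      ![f * C, g * -S, mironovU' a b c x / (2 * ((a + c) * (b + c)) * z)] j) ∧
    (∀ j, mironovProfile'' a b c j x = ![f * -S, g * -C,
      (2 * c * (a - b) * (C ^ 2 - S ^ 2) * (2 * ((a + c) * (b + c)) * z) -
      mironovU' a b c x * (2 * ((a + c) * (b + c)) *
        (mironovU' a b c x / (2 * ((a + c) * (b + c)) * z)))) /
      (2 * ((a + c) * (b + c)) * z) ^ 2] j) := by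
  refine ⟨√(c / (a + c)), √(c / (b + c)), Real.sin x, Real.cos x, mironovProfile a b c 2 x,
    Real.sin_sq_add_cos_sq x, ?_, ?_, mironovProfile_sq ha hb hc x, mironovProfile_pos ha hb hc x,
    mironovU_eq a b c x, rfl, fun j => ?_, fun j => ?_, fun j => ?_⟩
  · rw [Real.sq_sqrt (by positivity)]; field_simp
  · rw [Real.sq_sqrt (by positivity)]; field_simp
  all_goals fin_cases j <;> rfl

/-! ### Structure equations of Mironov's profile curve -/

lemma mironov_sphere (x : ℝ) : ∑ j, mironovProfile a b c j x ^ 2 = 1 := by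
  obtain ⟨f, g, S, C, z, h1, h2, h3, h4, h5, h6, h7, h8, h9, h10⟩ := mironov_relations ha hb hc x
  simp only [h8, Fin.sum_univ_three]
  simp
  have hf : f ^ 2 = c / (a + c) := by field_simp; linarith
  have hg : g ^ 2 = c / (b + c) := by field_simp; linarith
  have hz : z ^ 2 = (a * b + mironovU a b c x) / ((a + c) * (b + c)) := by field_simp; linarith
  have hC : C ^ 2 = 1 - S ^ 2 := by linarith
  rw [mul_pow, mul_pow, hf, hg, hz, h6, hC]
  field_simp
  ring

lemma mironov_metric₁₁ (x : ℝ) : ∑ j, mironovProfile' a b c j x ^ 2 =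
    mironovU a b c x / (a * b + mironovU a b c x) := by
  have hu := mironovU_pos ha hb hc x
  obtain ⟨f, g, S, C, z, h1, h2, h3, h4, h5, h6, h7, h8, h9, h10⟩ := mironov_relations ha hb hc x
  simp only [h9, Fin.sum_univ_three]
  simp
  have hf : f ^ 2 = c / (a + c) := by field_simp; linarith
  have hg : g ^ 2 = c / (b + c) := by field_simp; linarith
  have hz : z ^ 2 = (a * b + mironovU a b c x) / ((a + c) * (b + c)) := by field_simp; linarith
  have hC : C ^ 2 = 1 - S ^ 2 := by linarith
  rw [mul_pow, mul_pow, div_pow, mul_pow _ z, hf, hg, hz, h7]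
  field_simp
  simp only [hC]
  rw [h6, hC]
  ring

lemma mironov_metric₂₂ (x : ℝ) :
    ∑ j, (![a, b, -c] : Fin 3 → ℝ) j ^ 2 * mironovProfile a b c j x ^ 2 = mironovU a b c x := by
  obtain ⟨f, g, S, C, z, h1, h2, h3, h4, h5, h6, h7, h8, h9, h10⟩ := mironov_relations ha hb hc x
  simp only [h8, Fin.sum_univ_three]
  simp
  have hf : f ^ 2 = c / (a + c) := by field_simp; linarith
  have hg : g ^ 2 = c / (b + c) := by field_simp; linarith
  have hz : z ^ 2 = (a * b + mironovU a b c x) / ((a + c) * (b + c)) := by field_simp; linarith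
  have hC : C ^ 2 = 1 - S ^ 2 := by linarith
  rw [mul_pow, mul_pow, hf, hg, hz, h6, hC]
  field_simp
  ring

lemma mironov_isotropic (x : ℝ) :
    ∑ j, (![a, b, -c] : Fin 3 → ℝ) j * mironovProfile a b c j x ^ 2 = 0 := by
  obtain ⟨f, g, S, C, z, h1, h2, h3, h4, h5, h6, h7, h8, h9, h10⟩ := mironov_relations ha hb hc x
  simp only [h8, Fin.sum_univ_three]
  simp
  have hf : f ^ 2 = c / (a + c) := by field_simp; linarith
  have hg : g ^ 2 = c / (b + c) := by field_simp; linarith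
  have hz : z ^ 2 = (a * b + mironovU a b c x) / ((a + c) * (b + c)) := by field_simp; linarith
  have hC : C ^ 2 = 1 - S ^ 2 := by linarith
  rw [mul_pow, mul_pow, hf, hg, hz, h6, hC]
  field_simp
  ring

/-- The derivative of the coefficient `u / (ab + u)` of the metric of Mironov's surface. -/
def mironovE' (a b c x : ℝ) : ℝ :=
  a * b * mironovU' a b c x / (a * b + mironovU a b c x) ^ 2

/-- All three moduli solve one second order linear equation, with the frequency as parameter. The
trigonometric components reduce to `S² + C² = 1`, the third to a differential equation for `u`. -/
lemma mironov_frame₁₁ (j : Fin 3) (x : ℝ) : mironovProfile'' a b c j x =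
    -(mironovU a b c x / (a * b + mironovU a b c x)) * mironovProfile a b c j x +
      mironovE' a b c x / (2 * (mironovU a b c x / (a * b + mironovU a b c x))) *
        mironovProfile' a b c j x -
      a * b * c / ((a * b + mironovU a b c x) * mironovU a b c x) * (![a, b, -c] : Fin 3 → ℝ) j *
        mironovProfile a b c j x := by
  have hu := mironovU_pos ha hb hc x
  obtain ⟨f, g, S, C, z, h1, h2, h3, h4, h5, h6, h7, h8, h9, h10⟩ := mironov_relations ha hb hc x
  have hC : C ^ 2 = 1 - S ^ 2 := by linarith
  have hS : S ^ 2 = 1 - C ^ 2 := by linarith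
  have hU : 0 < a * b + mironovU a b c x := by positivity
  -- As `z²` is a constant multiple of `ab + u`, the logarithmic derivative of `z` is `u' / (2(ab +
  -- u))`.
  have hz' : mironovU' a b c x / (2 * ((a + c) * (b + c)) * z) =
      mironovU' a b c x / (2 * (a * b + mironovU a b c x)) * z := by
    rw [← h4]; field_simp
  have hz'' : ∀ D, (D * (2 * ((a + c) * (b + c)) * z) - mironovU' a b c x * (2 * ((a + c) * (b + c)) *
      (mironovU' a b c x / (2 * (a * b + mironovU a b c x)) * z))) /
      (2 * ((a + c) * (b + c)) * z) ^ 2 = (D / (2 * (a * b + mironovU a b c x)) -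
        mironovU' a b c x ^ 2 / (4 * (a * b + mironovU a b c x) ^ 2)) * z := fun D => by
    rw [← h4]; field_simp; ring
  rw [h8, h9, h10, mironovE', hz', hz'']
  fin_cases j <;> simp
  · field_simp
    rw [h7, h6]
    linear_combination -2 * f * S * c * a ^ 2 * b * h1
  · field_simp
    rw [h7, h6]
    linear_combination -2 * g * C * c * a * b ^ 2 * h1
  -- This is the equation `2uu'' - u'² = -4u² + 4abc²`.
  · have key : 2 * (2 * c * (a - b) * (C ^ 2 - S ^ 2)) * mironovU a b c x -
        mironovU' a b c x ^ 2 = -4 * mironovU a b c x ^ 2 + 4 * a * b * c ^ 2 := by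
      rw [h7, h6]
      linear_combination 4 * c ^ 2 * a * b * (S ^ 2 + C ^ 2 + 1) * h1
    field_simp
    linear_combination 4 * (a * b + mironovU a b c x) * key

lemma mironov_frame₁₂ (j : Fin 3) (x : ℝ) :
    (![a, b, -c] : Fin 3 → ℝ) j * mironovProfile' a b c j x =
      mironovU' a b c x / (2 * mironovU a b c x) *
        ((![a, b, -c] : Fin 3 → ℝ) j * mironovProfile a b c j x) +
      a * b * c / mironovU a b c x * mironovProfile' a b c j x := by
  have hu := mironovU_pos ha hb hc x
  obtain ⟨f, g, S, C, z, h1, h2, h3, h4, h5, h6, h7, h8, h9, h10⟩ := mironov_relations ha hb hc x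
  have hU : 0 < a * b + mironovU a b c x := by positivity
  have hz' : mironovU' a b c x / (2 * ((a + c) * (b + c)) * z) =
      mironovU' a b c x / (2 * (a * b + mironovU a b c x)) * z := by
    rw [← h4]; field_simp
  rw [h8, h9, hz']
  fin_cases j <;> simp
  · field_simp
    rw [h7, h6]
    linear_combination 2 * f * C * c * b * h1
  · field_simp
    rw [h7, h6]
    linear_combination -2 * g * S * c * a * h1
  · field_simp
    ring

lemma mironov_frame₂₂ (j : Fin 3) (x : ℝ) :
    -(![a, b, -c] : Fin 3 → ℝ) j ^ 2 * mironovProfile a b c j x =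
      -mironovU a b c x * mironovProfile a b c j x -
      mironovU' a b c x / (2 * (mironovU a b c x / (a * b + mironovU a b c x))) *
        mironovProfile' a b c j x -
      (a + b - c - a * b * c / mironovU a b c x) * (![a, b, -c] : Fin 3 → ℝ) j *
        mironovProfile a b c j x := by
  have hu := mironovU_pos ha hb hc x
  obtain ⟨f, g, S, C, z, h1, h2, h3, h4, h5, h6, h7, h8, h9, h10⟩ := mironov_relations ha hb hc x
  have hU : 0 < a * b + mironovU a b c x := by positivity
  have hz' : mironovU' a b c x / (2 * ((a + c) * (b + c)) * z) =
      mironovU' a b c x / (2 * (a * b + mironovU a b c x)) * z := by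
    rw [← h4]; field_simp
  rw [h8, h9, hz']
  have hS : S ^ 2 = 1 - C ^ 2 := by linarith
  fin_cases j <;> simp
  · field_simp
    rw [h7]
    have e : c * (a - b) * C ^ 2 = c * a - mironovU a b c x := by rw [h6, hS]; ring
    linear_combination 2 * f * S * (a * b + mironovU a b c x) * e
  · field_simp
    rw [h7]
    have e : c * (a - b) * S ^ 2 = mironovU a b c x - c * b := by rw [h6, hS]; ring
    linear_combination -2 * g * C * (a * b + mironovU a b c x) * e
  · field_simp
    -- The first integral of the equation for `u`, which oscillates between `ca` and `cb`.
    have e : mironovU' a b c x ^ 2 = 4 * (c * a - mironovU a b c x) * (mironovU a b c x - c * b) := by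
      have e₁ : c * (a - b) * C ^ 2 = c * a - mironovU a b c x := by rw [h6, hS]; ring
      have e₂ : c * (a - b) * S ^ 2 = mironovU a b c x - c * b := by rw [h6, hS]; ring
      rw [h7, ← e₁, ← e₂]
      ring
    linear_combination e

end

/-! ### Periods, curvature and criticality of Mironov's surfaces -/

lemma exp_I_mul_eq_one_iff (t : ℝ) :
    Complex.exp (Complex.I * t) = 1 ↔ ∃ n : ℤ, t = 2 * Real.pi * n := by
  rw [Complex.exp_eq_one_iff]
  refine exists_congr fun n => ⟨fun h => ?_, fun h => ?_⟩
  · have h1 : (t : ℂ) = (2 * Real.pi * n : ℝ) := by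
      refine mul_left_cancel₀ Complex.I_ne_zero (h.trans ?_)
      push_cast; ring
    exact_mod_cast h1
  · rw [h]; push_cast; ring

section

variable {a b c : ℝ} (ha : 0 < a) (hb : 0 < b) (hc : 0 < c)
include ha hb hc

/-- The profile is real, so the determinant of the frame is imaginary up to the factor
`exp(i(a+b-c)y)`; this explains the angle coefficients `0` and `a+b-c`. -/
lemma mironov_hasDiagonalCoords : HasDiagonalCoords (mironov a b c)
    (fun x => mironovU a b c x / (a * b + mironovU a b c x)) (mironovU a b c)
    (mironovE' a b c) (mironovU' a b c)
    (fun x => (0, a * b * c / ((a * b + mironovU a b c x) * mironovU a b c x)))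
    (fun x => (a * b * c / mironovU a b c x, 0))
    (fun x => (0, a + b - c - a * b * c / mironovU a b c x)) 0 (a + b - c) := by
  have hu := mironovU_pos ha hb hc
  have hU : ∀ x, 0 < a * b + mironovU a b c x := fun x => by have := hu x; positivity
  have su := contDiff_mironovU a b c
  have sU : ContDiff ℝ ∞ fun x => a * b + mironovU a b c x := contDiff_const.add su
  rw [mironov_eq ha hb hc]
  refine orbitSurface.hasDiagonalCoords (r' := fun j x => (mironovProfile' a b c j x : ℂ))
    (r'' := fun j x => (mironovProfile'' a b c j x : ℂ))
    (fun j x => (hasDerivAt_mironovProfile ha hb hc j x).ofReal_comp)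
    (fun j x => (hasDerivAt_mironovProfile' ha hb hc j x).ofReal_comp)
    (fun j => Complex.ofRealCLM.contDiff.comp (contDiff_mironovProfile ha hb hc j))
    (su.div sU fun x => (hU x).ne') su
    (contDiff_const.prodMk (contDiff_const.div (sU.mul su) fun x => (mul_pos (hU x) (hu x)).ne'))
    ((contDiff_const.div su fun x => (hu x).ne').prodMk contDiff_const)
    (contDiff_const.prodMk (contDiff_const.sub (contDiff_const.div su fun x => (hu x).ne')))
    (fun x => div_pos (hu x) (hU x)) hu
    (fun x => ?_) (fun x => ?_) (fun x => ?_) (fun x => ?_) (fun x => ?_) (fun x => ?_)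
    (fun j x => ?_) (fun j x => ?_) (fun j x => ?_) (fun x => ?_) (fun x => ?_)
  · simp only [Complex.normSq_ofReal, ← pow_two]
    exact mironov_sphere ha hb hc x
  · simp
  · simp only [Complex.normSq_ofReal, ← pow_two]
    exact mironov_isotropic ha hb hc x
  · simp only [Complex.normSq_ofReal, ← pow_two]
    exact mironov_metric₁₁ ha hb hc x
  · simp
  · simp only [Complex.normSq_ofReal, ← pow_two]
    exact mironov_metric₂₂ ha hb hc x
  · have h := congrArg (fun t : ℝ => (t : ℂ)) (mironov_frame₁₁ ha hb hc j x)
    push_cast at h ⊢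
    linear_combination h
  · have h := congrArg (fun t : ℝ => (t : ℂ)) (mironov_frame₁₂ ha hb hc j x)
    push_cast at h ⊢
    linear_combination Complex.I * h
  · have h := congrArg (fun t : ℝ => (t : ℂ)) (mironov_frame₂₂ ha hb hc j x)
    push_cast at h ⊢
    linear_combination h
  · simp
  · dsimp only; ring

lemma mironov_period_iff (T : ℝ) :
    (∀ x y : ℝ, mironov a b c (x, y + T) = mironov a b c (x, y)) ↔
      ∃ k l m : ℤ, a * T = 2 * Real.pi * k ∧ b * T = 2 * Real.pi * l ∧ c * T = 2 * Real.pi * m := by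
  have hz := mironovProfile_pos ha hb hc 0
  have hcomp : ∀ (x y : ℝ) (j : Fin 3), mironov a b c (x, y) j = mironovProfile a b c j x *
      Complex.exp (Complex.I * ((![a, b, -c] : Fin 3 → ℝ) j * y : ℝ)) := fun x y j => by
    rw [mironov_eq ha hb hc]; rfl
  constructor
  · intro h
    have key : ∀ j x, mironovProfile a b c j x ≠ 0 →
        ∃ n : ℤ, (![a, b, -c] : Fin 3 → ℝ) j * T = 2 * Real.pi * n := fun j x hx => by
      have h1 := congrArg (fun v : E => v j) (h x 0)
      simp only [hcomp, zero_add, mul_zero, Complex.ofReal_zero, Complex.exp_zero] at h1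
      exact (exp_I_mul_eq_one_iff _).1
        (mul_left_cancel₀ (by exact_mod_cast hx) h1)
    -- Each phase is tested where its modulus does not vanish: `φ` at `π/2`, `ψ` and `ζ` at `0`.
    obtain ⟨k, hk⟩ := key 0 (Real.pi / 2) (by
      have : 0 < √(c / (a + c)) := Real.sqrt_pos.2 (by positivity)
      simp [mironovProfile, this.ne'])
    obtain ⟨l, hl⟩ := key 1 0 (by
      have : 0 < √(c / (b + c)) := Real.sqrt_pos.2 (by positivity)
      simp [mironovProfile, this.ne'])
    obtain ⟨m, hm⟩ := key 2 0 hz.ne'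
    refine ⟨k, l, -m, hk, hl, ?_⟩
    simp at hm
    push_cast
    linarith
  · rintro ⟨k, l, m, hk, hl, hm⟩ x y
    ext j
    have h1 : Complex.exp (Complex.I * ((![a, b, -c] : Fin 3 → ℝ) j * T : ℝ)) = 1 := by
      rw [exp_I_mul_eq_one_iff]
      fin_cases j
      · exact ⟨k, hk⟩
      · exact ⟨l, hl⟩
      · exact ⟨-m, by simp; linarith⟩
    rw [hcomp, hcomp, mul_add, Complex.ofReal_add, mul_add, Complex.exp_add, h1, mul_one]

lemma mironov_meanCurv (p : ℝ × ℝ) : meanCurv (mironov a b c) p =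
    ((a + b - c) / mironovU a b c p.1) • (Complex.I • fderiv ℝ (mironov a b c) p (0, 1)) := by
  have hu := mironovU_pos ha hb hc p.1
  have h : (1 / (mironovU a b c p.1 / (a * b + mironovU a b c p.1))) •
      ((0 : ℝ), a * b * c / ((a * b + mironovU a b c p.1) * mironovU a b c p.1)) +
      (1 / mironovU a b c p.1) • ((0 : ℝ), a + b - c - a * b * c / mironovU a b c p.1) =
      ((a + b - c) / mironovU a b c p.1) • ((0 : ℝ), (1 : ℝ)) := by
    ext
    · simp
    · simp
      field_simp
      ring
  rw [(mironov_hasDiagonalCoords ha hb hc).meanCurv_eq, h, map_smul, I_smul_real_smul]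

lemma mironov_JH : JH (mironov a b c) = fun q => (0 : ℝ) • fderiv ℝ (mironov a b c) q (1, 0) +
    (-((a + b - c) / mironovU a b c q.1)) • fderiv ℝ (mironov a b c) q (0, 1) := by
  ext1 q
  rw [(mironov_hasDiagonalCoords ha hb hc).JH_eq, mironov_meanCurv ha hb hc, I_smul_real_smul,
    I_smul_I_smul]
  simp

lemma hasDerivAt_mironov_coeff (x : ℝ) :
    HasDerivAt (fun x => -((a + b - c) / mironovU a b c x))
      ((a + b - c) * mironovU' a b c x / mironovU a b c x ^ 2) x := by
  have hu := mironovU_pos ha hb hc x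
  exact (((hasDerivAt_const x (a + b - c)).fun_div (hasDerivAt_mironovU a b c x)
    hu.ne').fun_neg).congr_deriv (by ring)

lemma mironov_covDeriv₁ (p : ℝ × ℝ) : covDeriv (mironov a b c) (JH (mironov a b c)) p (1, 0) =
    (0, (a + b - c) * mironovU' a b c p.1 / (2 * mironovU a b c p.1 ^ 2)) := by
  have hu := mironovU_pos ha hb hc p.1
  rw [mironov_JH ha hb hc, (mironov_hasDiagonalCoords ha hb hc).covDeriv_tangent_field₁
    (hasDerivAt_const _ (0 : ℝ)) (hasDerivAt_mironov_coeff ha hb hc p.1)]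
  ext
  · simp
  · dsimp only
    field_simp
    ring

lemma mironov_covDeriv₂ (p : ℝ × ℝ) : covDeriv (mironov a b c) (JH (mironov a b c)) p (0, 1) =
    ((a * b + mironovU a b c p.1) * (a + b - c) * mironovU' a b c p.1 /
      (2 * mironovU a b c p.1 ^ 2), 0) := by
  have hu := mironovU_pos ha hb hc p.1
  rw [mironov_JH ha hb hc, (mironov_hasDiagonalCoords ha hb hc).covDeriv_tangent_field₂
    (hasDerivAt_const _ (0 : ℝ)) (hasDerivAt_mironov_coeff ha hb hc p.1)]
  ext
  · dsimp only
    field_simp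
  · simp

lemma mironov_divergence (p : ℝ × ℝ) :
    divergence (mironov a b c) (fun q => Complex.I • meanCurv (mironov a b c) q) p = 0 := by
  have h := mironov_hasDiagonalCoords ha hb hc
  rw [← show JH (mironov a b c) = fun q => Complex.I • meanCurv (mironov a b c) q from
    funext h.JH_eq, h.divergence_eq, mironov_covDeriv₁ ha hb hc, mironov_covDeriv₂ ha hb hc]
  simp

lemma mironov_secondFF_sum (p : ℝ × ℝ) (e : Fin 2 → ℝ × ℝ)
    (he : IsOrthonormalFrame (mironov a b c) p e) :
    ∑ i, rinner (secondFF (mironov a b c) p (e i)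
      (covDeriv (mironov a b c) (JH (mironov a b c)) p (e i))) (meanCurv (mironov a b c) p) = 0 := by
  have h := mironov_hasDiagonalCoords ha hb hc
  have h00 := he 0 0
  have h11 := he 1 1
  have h01 := he 0 1
  rw [h.metric_apply] at h00 h11 h01
  simp only [if_true, zero_ne_one, if_false] at h00 h11 h01
  -- The sum of `eᵢ ⊗ eᵢ` is the inverse metric, whose off-diagonal entry is zero.
  have hs : (e 0).1 * (e 0).2 + (e 1).1 * (e 1).2 = 0 := by
    linear_combination (-(e 0).1 * (e 0).2) * h11 - (e 1).1 * (e 1).2 * h00 +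
      ((e 0).1 * (e 1).2 + (e 1).1 * (e 0).2) * h01
  -- `∇JH` exchanges the coordinate directions, while `⟨B(·,·), H⟩` is diagonal because `H` is a
  -- multiple of `i∂_y`; so only the mixed term `v₁v₂` survives.
  obtain ⟨τ, hτ⟩ : ∃ τ : ℝ, ∀ v : ℝ × ℝ, rinner (secondFF (mironov a b c) p v
      (covDeriv (mironov a b c) (JH (mironov a b c)) p v)) (meanCurv (mironov a b c) p) =
      τ * (v.1 * v.2) := by
    refine ⟨(a + b - c) * ((a * b + mironovU a b c p.1) * (a + b - c) * mironovU' a b c p.1 /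
      (2 * mironovU a b c p.1 ^ 2) * (a * b * c / ((a * b + mironovU a b c p.1) *
        mironovU a b c p.1)) + (a + b - c) * mironovU' a b c p.1 / (2 * mironovU a b c p.1 ^ 2) *
        (a + b - c - a * b * c / mironovU a b c p.1)), fun v => ?_⟩
    have hu := (mironovU_pos ha hb hc p.1).ne'
    rw [covDeriv_eq, mironov_covDeriv₁ ha hb hc, mironov_covDeriv₂ ha hb hc, h.secondFF_eq,
      mironov_meanCurv ha hb hc, rinner_smul_right, rinner_I_I]
    change _ * metric _ _ _ _ = _
    rw [h.metric_apply]
    simp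
    field_simp
  rw [Fin.sum_univ_two, hτ, hτ, ← mul_add, hs, mul_zero]

lemma mironov_isMinimal_iff : IsMinimal (mironov a b c) ↔ a + b = c := by
  constructor
  · intro h
    have h1 := h (0, 0)
    have hu := mironovU_pos ha hb hc 0
    rw [mironov_meanCurv ha hb hc, smul_eq_zero, div_eq_zero_iff] at h1
    rcases h1 with (h1 | h1) | h1
    · linarith
    · exact absurd h1 hu.ne'
    · have hd := (mironov_hasDiagonalCoords ha hb hc).legendrian.immersion (0, 0)
      have h2 := metric_self_pos hd (w := (0, 1)) (by simp)
      rw [metric, ← rinner_I_I, h1, rinner_zero_left] at h2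
      exact absurd h2 (lt_irrefl _)
  · intro h p
    rw [mironov_meanCurv ha hb hc, h, sub_self, zero_div, zero_smul]

lemma mironov_isParallel_iff :
    IsParallel (mironov a b c) (JH (mironov a b c)) ↔ a + b = c ∨ a = b := by
  rw [isParallel_iff]
  constructor
  · intro h
    -- At `x = π/4` the derivative `u'` equals `c(a - b)`.
    have h1 := congrArg Prod.snd (h (Real.pi / 4, 0)).1
    have hu := mironovU_pos ha hb hc (Real.pi / 4)
    rw [mironov_covDeriv₁ ha hb hc] at h1
    have h2 : (√2 : ℝ) ≠ 0 := by positivity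
    simp [mironovU', hu.ne', hc.ne', h2] at h1
    rcases h1 with h1 | h1
    · left; linarith
    · right; linarith
  · intro h p
    rw [mironov_covDeriv₁ ha hb hc, mironov_covDeriv₂ ha hb hc]
    rcases h with h | h <;> simp [mironovU', h]

lemma mironov_isLegendrianCritical {Λ : AddSubgroup (ℝ × ℝ)} (hΛ : DiscreteTopology Λ)
    (hper : IsPeriodic Λ (mironov a b c)) (κ : ℝ) :
    IsLegendrianCritical (scaledDensity κ) Λ (mironov a b c) := by
  have hu := mironovU_pos ha hb hc
  have hU : ∀ x, 0 < a * b + mironovU a b c x := fun x => by have := hu x; positivity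
  have hw : ∀ x, 0 < √(a * b + mironovU a b c x) := fun x => Real.sqrt_pos.2 (hU x)
  have hw2 : ∀ x, √(a * b + mironovU a b c x) ^ 2 = a * b + mironovU a b c x := fun x =>
    Real.sq_sqrt (hU x).le
  have h := mironov_hasDiagonalCoords ha hb hc
  have hw' : ∀ x, HasDerivAt (fun x => √(a * b + mironovU a b c x))
      (mironovU' a b c x / (2 * √(a * b + mironovU a b c x))) x := fun x =>
    ((hasDerivAt_mironovU a b c x).const_add (a * b)).sqrt (hU x).ne'
  -- With `m = 0` the mixed stress `B` and the flux `ν` vanish, and `b₁₁`, `b₂₂` have no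
  -- `x`-component, so `μ = 0`. Only the law for `A` has content.
  refine h.isLegendrianCritical hΛ hper κ
    (s := fun x => mironovU a b c x / √(a * b + mironovU a b c x))
    (A := fun x => √(a * b + mironovU a b c x) / 2 +
      κ * ((a + b - c) ^ 2 * √(a * b + mironovU a b c x) / (2 * mironovU a b c x)))
    (B := fun _ => 0)
    (C := fun x => 1 / (2 * √(a * b + mironovU a b c x)) -
      κ * ((a + b - c) ^ 2 / (2 * √(a * b + mironovU a b c x) * mironovU a b c x)))
    (μ := 0) (ν := 0) ?_ ?_ ?_ ?_ ?_ ?_ ?_ ?_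
  · intro x
    rw [div_mul_eq_mul_div, ← pow_two, Real.sqrt_div (by positivity), Real.sqrt_sq (hu x).le]
  · intro x
    have h1 := hu x
    have h2 := hw x
    field_simp
    ring
  · intro x
    simp
  · intro x
    have h1 := hu x
    have h2 := hw x
    have h3 := hw2 x
    generalize √(a * b + mironovU a b c x) = w at h2 h3 ⊢
    rw [← h3]
    field_simp
    ring
  · intro x
    have h1 := hu x
    have h2 := hw x
    have h3 := hw2 x
    refine (((hw' x).div_const 2).fun_add ((((hw' x).const_mul ((a + b - c) ^ 2)).fun_div
      ((hasDerivAt_mironovU a b c x).const_mul 2) (by positivity)).const_mul κ)).congr_deriv ?_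
    -- In terms of `w = √(ab + u)` the law becomes a rational identity.
    have h4 : mironovU a b c x = √(a * b + mironovU a b c x) ^ 2 - a * b := by linarith
    generalize √(a * b + mironovU a b c x) = w at h2 h3 h4 ⊢
    rw [mironovE', ← h3]
    field_simp
    rw [h4]
    ring
  · intro x
    simpa using hasDerivAt_const x (0 : ℝ)
  · intro x
    simp
  · intro x
    simp

end

lemma isCsL_of_critical {Λ : AddSubgroup (ℝ × ℝ)} {F : ℝ × ℝ → E}
    (hF : IsLegendrianImmersion F) (hper : IsPeriodic Λ F)
    (hcrit : ∀ κ, IsLegendrianCritical (scaledDensity κ) Λ F) : IsCsL Λ F ∧ IsCsLWillmore Λ F :=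
  ⟨⟨hF, hper, areaDensity_eq_scaledDensity ▸ hcrit 0⟩,
    ⟨hF, hper, willmoreDensity_eq_scaledDensity ▸ hcrit (1 / 4)⟩⟩

/-! ### Calabi tori -/

section

variable (r₁ r₂ r₃ r₄ : ℝ)

/-- The moduli of the components of the Calabi torus. -/
def calabiCoeff : Fin 3 → ℝ := ![r₁ * r₃, r₁ * r₄, r₂]

/-- The frequencies of the Calabi torus in the first variable. -/
def calabiFreq₁ : Fin 3 → ℝ := ![r₂ / r₁, r₂ / r₁, -(r₁ / r₂)]

/-- The frequencies of the Calabi torus in the second variable. -/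
def calabiFreq₂ : Fin 3 → ℝ := ![r₄ / r₃, -(r₃ / r₄), 0]

/-- The profile curve of the Calabi torus. -/
def calabiProfile (j : Fin 3) (t : ℝ) : ℂ :=
  calabiCoeff r₁ r₂ r₃ r₄ j * Complex.exp (Complex.I * (calabiFreq₁ r₁ r₂ j * t : ℝ))

lemma calabi_eq : calabi r₁ r₂ r₃ r₄ =
    orbitSurface (calabiProfile r₁ r₂ r₃ r₄) (calabiFreq₂ r₃ r₄) := by
  ext p j
  fin_cases j <;>
    simp [calabi, orbitSurface.apply, calabiProfile, calabiCoeff, calabiFreq₁, calabiFreq₂,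
      mul_assoc, ← Complex.exp_add, mul_add, sub_eq_add_neg]

lemma hasDerivAt_calabiProfile (j : Fin 3) (t : ℝ) : HasDerivAt (calabiProfile r₁ r₂ r₃ r₄ j)
    (Complex.I * calabiFreq₁ r₁ r₂ j * calabiProfile r₁ r₂ r₃ r₄ j t) t := by
  have h := ((((hasDerivAt_id t).const_mul (calabiFreq₁ r₁ r₂ j)).ofReal_comp.const_mul
    Complex.I).cexp).const_mul (calabiCoeff r₁ r₂ r₃ r₄ j : ℂ)
  refine h.congr_deriv ?_
  simp [calabiProfile]
  ring

lemma contDiff_calabiProfile (j : Fin 3) : ContDiff ℝ ∞ (calabiProfile r₁ r₂ r₃ r₄ j) :=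
  contDiff_const.mul (contDiff_const.mul
    (Complex.ofRealCLM.contDiff.comp (contDiff_const.mul contDiff_id))).cexp

lemma normSq_calabiProfile (j : Fin 3) (t : ℝ) :
    Complex.normSq (calabiProfile r₁ r₂ r₃ r₄ j t) = calabiCoeff r₁ r₂ r₃ r₄ j ^ 2 := by
  rw [calabiProfile, Complex.normSq_mul, Complex.normSq_eq_norm_sq (Complex.exp _),
    Complex.norm_exp_I_mul_ofReal, Complex.normSq_ofReal]
  ring

variable {r₁ r₂ r₃ r₄} (h₁ : r₁ ≠ 0) (h₂ : r₂ ≠ 0) (h₃ : r₃ ≠ 0) (h₄ : r₄ ≠ 0)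
  (h₁₂ : r₁ ^ 2 + r₂ ^ 2 = 1) (h₃₄ : r₃ ^ 2 + r₄ ^ 2 = 1)
include h₁ h₂ h₃ h₄ h₁₂ h₃₄

/-- Moduli and frequencies are constant, so the structure equations become quadratic relations
between the frequencies of each component. -/
lemma calabi_hasDiagonalCoords : HasDiagonalCoords (calabi r₁ r₂ r₃ r₄)
    (fun _ => 1) (fun _ => r₁ ^ 2) (fun _ => 0) (fun _ => 0)
    (fun _ => (r₂ / r₁ - r₁ / r₂, 0)) (fun _ => (0, r₂ / r₁))
    (fun _ => (r₁ * r₂, r₄ / r₃ - r₃ / r₄)) (2 * r₂ / r₁ - r₁ / r₂) (r₄ / r₃ - r₃ / r₄) := by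
  have hn : ∀ (j : Fin 3) (t : ℝ), (calabiProfile r₁ r₂ r₃ r₄ j t).re *
      (Complex.I * calabiFreq₁ r₁ r₂ j * calabiProfile r₁ r₂ r₃ r₄ j t).im -
      (calabiProfile r₁ r₂ r₃ r₄ j t).im *
      (Complex.I * calabiFreq₁ r₁ r₂ j * calabiProfile r₁ r₂ r₃ r₄ j t).re =
      calabiFreq₁ r₁ r₂ j * calabiCoeff r₁ r₂ r₃ r₄ j ^ 2 := fun j t => by
    rw [← normSq_calabiProfile r₁ r₂ r₃ r₄ j t, Complex.normSq_apply]
    simp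
    ring
  have hn' : ∀ (j : Fin 3) (t : ℝ),
      Complex.normSq (Complex.I * calabiFreq₁ r₁ r₂ j * calabiProfile r₁ r₂ r₃ r₄ j t) =
      calabiFreq₁ r₁ r₂ j ^ 2 * calabiCoeff r₁ r₂ r₃ r₄ j ^ 2 := fun j t => by
    rw [Complex.normSq_mul, Complex.normSq_mul, normSq_calabiProfile, Complex.normSq_I,
      Complex.normSq_ofReal]
    ring
  rw [calabi_eq]
  refine orbitSurface.hasDiagonalCoords (hasDerivAt_calabiProfile r₁ r₂ r₃ r₄)
    (fun j t => (hasDerivAt_calabiProfile r₁ r₂ r₃ r₄ j t).const_mul _)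
    (contDiff_calabiProfile r₁ r₂ r₃ r₄) contDiff_const contDiff_const contDiff_const
    contDiff_const contDiff_const (fun _ => one_pos) (fun _ => by positivity)
    (fun x => ?_) (fun x => ?_) (fun x => ?_) (fun x => ?_) (fun x => ?_) (fun x => ?_)
    (fun j x => ?_) (fun j x => ?_) (fun j x => ?_) (fun x => ?_) (fun x => ?_)
  · simp only [normSq_calabiProfile, Fin.sum_univ_three]
    simp [calabiCoeff]
    linear_combination r₁ ^ 2 * h₃₄ + h₁₂
  · simp only [hn, Fin.sum_univ_three]
    simp [calabiCoeff, calabiFreq₁]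
    field_simp
    linear_combination r₂ * r₁ * h₃₄
  · simp only [normSq_calabiProfile, Fin.sum_univ_three]
    simp [calabiCoeff, calabiFreq₂]
    field_simp
    ring
  · simp only [hn', Fin.sum_univ_three]
    simp [calabiCoeff, calabiFreq₁]
    field_simp
    linear_combination r₂ ^ 2 * h₃₄ + h₁₂
  · simp only [hn, Fin.sum_univ_three]
    simp [calabiCoeff, calabiFreq₁, calabiFreq₂]
    field_simp
    ring
  · simp only [normSq_calabiProfile, Fin.sum_univ_three]
    simp [calabiCoeff, calabiFreq₂]
    field_simp
    linear_combination h₃₄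
  -- The two frequencies `r₂/r₁` and `-r₁/r₂` have product `-1`, so they are the roots of this
  -- quadratic.
  · have key : calabiFreq₁ r₁ r₂ j ^ 2 = 1 + (r₂ / r₁ - r₁ / r₂) * calabiFreq₁ r₁ r₂ j := by
      fin_cases j <;> simp [calabiFreq₁] <;> field_simp <;> ring
    have h := congrArg (fun t : ℝ => (t : ℂ)) key
    push_cast at h ⊢
    linear_combination (-calabiProfile r₁ r₂ r₃ r₄ j x) * h +
      calabiProfile r₁ r₂ r₃ r₄ j x * (calabiFreq₁ r₁ r₂ j ^ 2 -
        (r₂ / r₁ - r₁ / r₂) * calabiFreq₁ r₁ r₂ j) * Complex.I_sq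
  -- The second frequency vanishes in the only component whose first frequency is not `r₂/r₁`.
  · have key : calabiFreq₁ r₁ r₂ j * calabiFreq₂ r₃ r₄ j = r₂ / r₁ * calabiFreq₂ r₃ r₄ j := by
      fin_cases j <;> simp [calabiFreq₁, calabiFreq₂]
    have h := congrArg (fun t : ℝ => (t : ℂ)) key
    push_cast at h ⊢
    linear_combination (-calabiProfile r₁ r₂ r₃ r₄ j x) * h +
      calabiProfile r₁ r₂ r₃ r₄ j x * (calabiFreq₁ r₁ r₂ j * calabiFreq₂ r₃ r₄ j) * Complex.I_sq
  · have key : calabiFreq₂ r₃ r₄ j ^ 2 = r₁ ^ 2 + r₁ * r₂ * calabiFreq₁ r₁ r₂ j +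
        (r₄ / r₃ - r₃ / r₄) * calabiFreq₂ r₃ r₄ j := by
      fin_cases j <;> simp [calabiFreq₁, calabiFreq₂] <;> field_simp
      · linear_combination -r₃ ^ 2 * h₁₂
      · linear_combination -r₄ ^ 2 * h₁₂
      · ring
    have h := congrArg (fun t : ℝ => (t : ℂ)) key
    push_cast at h ⊢
    linear_combination (-calabiProfile r₁ r₂ r₃ r₄ j x) * h -
      calabiProfile r₁ r₂ r₃ r₄ j x * (r₁ * r₂ * calabiFreq₁ r₁ r₂ j) * Complex.I_sq
  · ring
  · ring

omit h₁₂ h₃₄ in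
lemma calabi_period_iff (t₀ s₀ : ℝ) :
    (∀ t s : ℝ, calabi r₁ r₂ r₃ r₄ (t + t₀, s + s₀) = calabi r₁ r₂ r₃ r₄ (t, s)) ↔
      ∃ k l m : ℤ, r₂ / r₁ * t₀ + r₄ / r₃ * s₀ = 2 * Real.pi * k ∧
        r₂ / r₁ * t₀ - r₃ / r₄ * s₀ = 2 * Real.pi * l ∧ r₁ / r₂ * t₀ = 2 * Real.pi * m := by
  have hcoeff : ∀ j, calabiCoeff r₁ r₂ r₃ r₄ j ≠ 0 := by
    intro j; fin_cases j <;> simp [calabiCoeff, *]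
  have hcomp : ∀ (t s : ℝ) (j : Fin 3), calabi r₁ r₂ r₃ r₄ (t, s) j = calabiCoeff r₁ r₂ r₃ r₄ j *
      Complex.exp (Complex.I * (calabiFreq₁ r₁ r₂ j * t + calabiFreq₂ r₃ r₄ j * s : ℝ)) := by
    intro t s j
    rw [calabi_eq, orbitSurface.apply, calabiProfile, mul_assoc, ← Complex.exp_add]
    push_cast
    rw [mul_add]
  constructor
  · intro h
    have key : ∀ j, ∃ n : ℤ,
        calabiFreq₁ r₁ r₂ j * t₀ + calabiFreq₂ r₃ r₄ j * s₀ = 2 * Real.pi * n := fun j => by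
      have h1 := congrArg (fun v : E => v j) (h 0 0)
      simp only [hcomp, zero_add, mul_zero, Complex.ofReal_zero, Complex.exp_zero] at h1
      exact (exp_I_mul_eq_one_iff _).1 (mul_left_cancel₀ (by exact_mod_cast hcoeff j) h1)
    obtain ⟨k, hk⟩ := key 0
    obtain ⟨l, hl⟩ := key 1
    obtain ⟨m, hm⟩ := key 2
    refine ⟨k, l, -m, hk, ?_, ?_⟩
    · simp [calabiFreq₁, calabiFreq₂] at hl
      linarith
    · simp [calabiFreq₁, calabiFreq₂] at hm
      push_cast
      linarith
  · rintro ⟨k, l, m, hk, hl, hm⟩ t s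
    ext j
    have h1 : Complex.exp (Complex.I * (calabiFreq₁ r₁ r₂ j * t₀ + calabiFreq₂ r₃ r₄ j * s₀ : ℝ)) =
        1 := by
      rw [exp_I_mul_eq_one_iff]
      fin_cases j
      · exact ⟨k, hk⟩
      · exact ⟨l, by simp [calabiFreq₁, calabiFreq₂]; linarith⟩
      · exact ⟨-m, by simp [calabiFreq₁, calabiFreq₂]; linarith⟩
    rw [hcomp, hcomp, show calabiFreq₁ r₁ r₂ j * (t + t₀) + calabiFreq₂ r₃ r₄ j * (s + s₀) =
      (calabiFreq₁ r₁ r₂ j * t + calabiFreq₂ r₃ r₄ j * s) +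
      (calabiFreq₁ r₁ r₂ j * t₀ + calabiFreq₂ r₃ r₄ j * s₀) by ring, Complex.ofReal_add, mul_add,
      Complex.exp_add, h1, mul_one]

lemma calabi_meanCurv (p : ℝ × ℝ) : meanCurv (calabi r₁ r₂ r₃ r₄) p =
    (2 * r₂ / r₁ - r₁ / r₂) • (Complex.I • fderiv ℝ (calabi r₁ r₂ r₃ r₄) p (1, 0)) +
    (1 / r₁ * (r₄ / r₃ - r₃ / r₄)) •
      (Complex.I • ((1 / r₁) • fderiv ℝ (calabi r₁ r₂ r₃ r₄) p (0, 1))) := by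
  have h : (1 / (1 : ℝ)) • ((r₂ / r₁ - r₁ / r₂, (0 : ℝ)) : ℝ × ℝ) +
      (1 / r₁ ^ 2) • ((r₁ * r₂, r₄ / r₃ - r₃ / r₄) : ℝ × ℝ) =
      (2 * r₂ / r₁ - r₁ / r₂) • ((1, 0) : ℝ × ℝ) +
      (1 / r₁ * (r₄ / r₃ - r₃ / r₄) * (1 / r₁)) • ((0, 1) : ℝ × ℝ) := by
    ext
    · simp; field_simp; ring
    · simp; field_simp
  rw [(calabi_hasDiagonalCoords h₁ h₂ h₃ h₄ h₁₂ h₃₄).meanCurv_eq, h, map_add, map_smul, map_smul,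
    mul_smul, smul_add]
  simp only [I_smul_real_smul]

lemma calabi_isParallel : IsParallel (calabi r₁ r₂ r₃ r₄) (JH (calabi r₁ r₂ r₃ r₄)) := by
  have h := calabi_hasDiagonalCoords h₁ h₂ h₃ h₄ h₁₂ h₃₄
  have hJ : JH (calabi r₁ r₂ r₃ r₄) = fun q =>
      (-(2 * r₂ / r₁ - r₁ / r₂)) • fderiv ℝ (calabi r₁ r₂ r₃ r₄) q (1, 0) +
      (-(1 / r₁ * (r₄ / r₃ - r₃ / r₄) * (1 / r₁))) • fderiv ℝ (calabi r₁ r₂ r₃ r₄) q (0, 1) := by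
    ext1 q
    rw [h.JH_eq, calabi_meanCurv h₁ h₂ h₃ h₄ h₁₂ h₃₄, smul_add]
    simp only [I_smul_real_smul, I_smul_I_smul, mul_smul, neg_smul, smul_neg]
  rw [isParallel_iff]
  intro p
  rw [hJ, h.covDeriv_tangent_field₁ (g₁ := fun _ => _) (g₂ := fun _ => _)
    (hasDerivAt_const _ _) (hasDerivAt_const _ _),
    h.covDeriv_tangent_field₂ (g₁ := fun _ => _) (g₂ := fun _ => _)
    (hasDerivAt_const _ _) (hasDerivAt_const _ _)]
  simp

/-- Every coefficient is constant, so the conservation laws hold trivially, with `μ` and `ν` the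
constants that occur. -/
lemma calabi_isLegendrianCritical {Λ : AddSubgroup (ℝ × ℝ)} (hΛ : DiscreteTopology Λ)
    (hper : IsPeriodic Λ (calabi r₁ r₂ r₃ r₄)) (κ : ℝ) :
    IsLegendrianCritical (scaledDensity κ) Λ (calabi r₁ r₂ r₃ r₄) :=
  (calabi_hasDiagonalCoords h₁ h₂ h₃ h₄ h₁₂ h₃₄).isLegendrianCritical hΛ hper κ
    (fun _ => rfl) (fun _ => rfl) (fun _ => rfl) (fun _ => rfl)
    (fun x => by simpa using hasDerivAt_const x _) (fun x => by simpa using hasDerivAt_const x _)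
    (fun _ => rfl) (fun _ => rfl)

end

end CsL
end

theorem mainTheorem4 :
    (∀ a b c : ℝ, 0 < a → 0 < b → 0 < c →
      CsL.IsLegendrianImmersion (CsL.mironov a b c) ∧
      (∀ x y : ℝ, CsL.mironov a b c (x + 2 * Real.pi, y) = CsL.mironov a b c (x, y)) ∧
      (∀ T : ℝ, (∀ x y : ℝ, CsL.mironov a b c (x, y + T) = CsL.mironov a b c (x, y)) ↔
        ∃ k l m : ℤ, a * T = 2 * Real.pi * k ∧ b * T = 2 * Real.pi * l ∧
          c * T = 2 * Real.pi * m) ∧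
      (∀ x y : ℝ, 0 < CsL.mironovU a b c x ∧
        CsL.gram (CsL.mironov a b c) (x, y) =
          !![CsL.mironovU a b c x / (a * b + CsL.mironovU a b c x), 0;
            0, CsL.mironovU a b c x]) ∧
      (∀ x y : ℝ, CsL.meanCurv (CsL.mironov a b c) (x, y) =
        ((a + b - c) / CsL.mironovU a b c x) •
          (Complex.I • fderiv ℝ (CsL.mironov a b c) (x, y) (0, 1))) ∧
      (∀ p, CsL.JH (CsL.mironov a b c) p = Complex.I • CsL.meanCurv (CsL.mironov a b c) p) ∧
      (∀ x y : ℝ, CsL.covDeriv (CsL.mironov a b c) (CsL.JH (CsL.mironov a b c)) (x, y) (1, 0) =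
          (0, (a + b - c) * deriv (CsL.mironovU a b c) x / (2 * CsL.mironovU a b c x ^ 2)) ∧
        CsL.covDeriv (CsL.mironov a b c) (CsL.JH (CsL.mironov a b c)) (x, y) (0, 1) =
          ((a * b + CsL.mironovU a b c x) * (a + b - c) * deriv (CsL.mironovU a b c) x /
            (2 * CsL.mironovU a b c x ^ 2), 0)) ∧
      (∀ p, CsL.divergence (CsL.mironov a b c)
        (fun q => Complex.I • CsL.meanCurv (CsL.mironov a b c) q) p = 0) ∧
      (∀ (p : ℝ × ℝ) (e : Fin 2 → ℝ × ℝ), CsL.IsOrthonormalFrame (CsL.mironov a b c) p e →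
        ∑ i, CsL.rinner (CsL.secondFF (CsL.mironov a b c) p (e i)
          (CsL.covDeriv (CsL.mironov a b c) (CsL.JH (CsL.mironov a b c)) p (e i)))
          (CsL.meanCurv (CsL.mironov a b c) p) = 0) ∧
      (∀ Λ : AddSubgroup (ℝ × ℝ), DiscreteTopology Λ → CsL.IsPeriodic Λ (CsL.mironov a b c) →
        CsL.IsCsL Λ (CsL.mironov a b c) ∧ CsL.IsCsLWillmore Λ (CsL.mironov a b c)) ∧
      (CsL.IsMinimal (CsL.mironov a b c) ↔ a + b = c) ∧
      (CsL.IsParallel (CsL.mironov a b c) (CsL.JH (CsL.mironov a b c)) ↔ a + b = c ∨ a = b)) ∧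
    (∀ r₁ r₂ r₃ r₄ : ℝ, r₁ ≠ 0 → r₂ ≠ 0 → r₃ ≠ 0 → r₄ ≠ 0 →
      r₁ ^ 2 + r₂ ^ 2 = 1 → r₃ ^ 2 + r₄ ^ 2 = 1 →
      CsL.IsLegendrianImmersion (CsL.calabi r₁ r₂ r₃ r₄) ∧
      (∀ t₀ s₀ : ℝ, (∀ t s : ℝ, CsL.calabi r₁ r₂ r₃ r₄ (t + t₀, s + s₀) =
          CsL.calabi r₁ r₂ r₃ r₄ (t, s)) ↔
        ∃ k l m : ℤ, r₂ / r₁ * t₀ + r₄ / r₃ * s₀ = 2 * Real.pi * k ∧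
          r₂ / r₁ * t₀ - r₃ / r₄ * s₀ = 2 * Real.pi * l ∧ r₁ / r₂ * t₀ = 2 * Real.pi * m) ∧
      (∀ p, CsL.meanCurv (CsL.calabi r₁ r₂ r₃ r₄) p =
        (2 * r₂ / r₁ - r₁ / r₂) •
            (Complex.I • fderiv ℝ (CsL.calabi r₁ r₂ r₃ r₄) p (1, 0)) +
          (1 / r₁ * (r₄ / r₃ - r₃ / r₄)) •
            (Complex.I • ((1 / r₁) • fderiv ℝ (CsL.calabi r₁ r₂ r₃ r₄) p (0, 1)))) ∧
      CsL.IsParallel (CsL.calabi r₁ r₂ r₃ r₄) (CsL.JH (CsL.calabi r₁ r₂ r₃ r₄)) ∧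
      (∀ Λ : AddSubgroup (ℝ × ℝ), DiscreteTopology Λ →
        CsL.IsPeriodic Λ (CsL.calabi r₁ r₂ r₃ r₄) →
        CsL.IsCsL Λ (CsL.calabi r₁ r₂ r₃ r₄) ∧
          CsL.IsCsLWillmore Λ (CsL.calabi r₁ r₂ r₃ r₄))) := by
  refine ⟨fun a b c ha hb hc => ?_, fun r₁ r₂ r₃ r₄ h₁ h₂ h₃ h₄ h₁₂ h₃₄ => ?_⟩
  · have h := CsL.mironov_hasDiagonalCoords ha hb hc
    have hu' : ∀ x, deriv (CsL.mironovU a b c) x = CsL.mironovU' a b c x := fun x =>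
      (CsL.hasDerivAt_mironovU a b c x).deriv
    refine ⟨h.legendrian, fun x y => ?_, CsL.mironov_period_iff ha hb hc,
      fun x y => ⟨CsL.mironovU_pos ha hb hc x, h.gram_eq (x, y)⟩,
      fun x y => CsL.mironov_meanCurv ha hb hc (x, y), h.JH_eq, fun x y => ?_,
      CsL.mironov_divergence ha hb hc, CsL.mironov_secondFF_sum ha hb hc,
      fun Λ hΛ hper => CsL.isCsL_of_critical h.legendrian hper
        (CsL.mironov_isLegendrianCritical ha hb hc hΛ hper),
      CsL.mironov_isMinimal_iff ha hb hc, CsL.mironov_isParallel_iff ha hb hc⟩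
    · simp only [CsL.mironov, Real.sin_add_two_pi, Real.cos_add_two_pi]
    · rw [hu']
      exact ⟨CsL.mironov_covDeriv₁ ha hb hc (x, y), CsL.mironov_covDeriv₂ ha hb hc (x, y)⟩
  · have h := CsL.calabi_hasDiagonalCoords h₁ h₂ h₃ h₄ h₁₂ h₃₄
    exact ⟨h.legendrian, CsL.calabi_period_iff h₁ h₂ h₃ h₄,
      CsL.calabi_meanCurv h₁ h₂ h₃ h₄ h₁₂ h₃₄, CsL.calabi_isParallel h₁ h₂ h₃ h₄ h₁₂ h₃₄,
      fun Λ hΛ hper => CsL.isCsL_of_critical h.legendrian hper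
        (CsL.calabi_isLegendrianCritical h₁ h₂ h₃ h₄ h₁₂ h₃₄ hΛ hper)⟩
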